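/- **Notation.** Let $\tilde{\mathbb C}$ be the universal covering space of $\mathbb C\setminus\{0\}$, let $W$ be the Riemann surface of $\sqrt t$ (so $\arg t$ is taken modulo $4\pi$), $W_r=\{t\in W:0<|t|<r\}$, and let $S(d,\alpha,R)$ be the sector $0<|t|<R$, $|\arg t-d|<\alpha/2$. $D$ denotes a disc centred at $0\in\mathbb C$ whose radius is not specified and may be taken as small as needed. $\mathcal O^2(\mathbb C)$ is the set of entire functions $f$ with $|f(x)|\le C_1e^{C_2|x|^2}$ for some $C_1,C_2>0$. Consider the heat equation $$\partial_tu=\partial_z^2u,\qquad u(0,z)=\varphi(z),\tag{H}$$ with formal solution $\hat u(t,z)=\sum_{m\ge0}\varphi^{(2m)}(z)t^m/m!$. The series $\hat u=\sum_m u_m(z)t^m$ is *$1$-summable in the direction $d$* if, over some disc $D$, it is of Gevrey order $1$ ($|u_m(z)|\le AB^m m!$) and its modified Borel transform $\sum_m u_m(z)\frac{m!}{(2m)!}s^m$ continues analytically to an unbounded sector $S(d,\varepsilon',\infty)$, $\varepsilon'>0$, with growth at most $C_1e^{C_2|s|}$ on proper subsectors, uniformly in $z\in D$; if $g$ is this continuation,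 the *$1$-sum* is $\frac1{\sqrt{\pi t}}\int g(s,z)e^{-s/(4t)}\,d\sqrt s$ over any ray $\arg s=\theta$ with $|\theta-d|<\varepsilon'/2$. It is *$1$-summable* if it is so in all directions but finitely many modulo $2\pi$; a direction in which it is not $1$-summable is *singular*. The line $\mathcal L_d=\{\arg t=d\}$ is a *Stokes line* if $d$ is singular and all directions near $d$, other than $d$, are not; then $\mathcal L_{d\pm\pi/2}$ are *anti-Stokes lines*, and the *jump* across $\mathcal L_d$ is $u^{d^+}-u^{d^-}$, the difference of the $1$-sums in directions close to $d$ and greater, respectively less, than $d$. An *actual solution* on $S\times D$ is a holomorphic $u$ on $S\times D$ with $\partial_tu=\partial_z^2u$ and $u(t,z)\to\varphi(z)$ as $t\to0$, $t\in S$, where $\varphi\in\mathcal O(D)$. For $V\subseteq W$, either a sector of opening greater than $\pi$ or $V=W_r$, a finite family $\{u_i\}$, $u_i\in\mathcal O(V_i\times D)$, is a *maximal family of solutions on $V\times D$* if $\hat u$ is $1$-summable; the $V_i\subseteq V$ are sectors of opening greater than $\pi$ covering $V$; each $u_i$ is an actual solution on $V_i\times D$; $u_i\not\equiv u_j$ on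 $(V_i\cap V_j)\times D$ whenever $i\ne j$ and $V_i\cap V_j\neq\emptyset$; and every actual solution on some $\tilde V\times D$, with $\tilde V\subseteq V$ a sector containing points of argument $d$, that is the $1$-sum of $\hat u$ in a nonsingular direction $d$ coincides on $(\tilde V\cap V_i)\times D$ with $u_i$ for some $i$ with $\tilde V\cap V_i\ne\emptyset$. **Corollary 5.6.** Let $n\ge1$, $a_{-1},\dots,a_{1-n}\in\mathbb C$, $a_{-n},z_0\in\mathbb C\setminus\{0\}$, $\tilde\varphi\in\mathcal O^2(\mathbb C)$, and $$\varphi(z)=\sum_{j=1}^{n}\frac{a_{-j}}{(z-z_0)^j}+\tilde\varphi(z).$$ Set $\delta:=2\arg z_0$ (for any choice of the argument) and $$u^\theta(t,z)=\frac1{\sqrt{4\pi t}}\int_{e^{i\theta/2}\mathbb R_+}\bigl(\varphi(z+s)+\varphi(z-s)\bigr)e^{-s^2/(4t)}\,ds .$$ 1. The Stokes lines for $\hat u$ are exactly $\mathcal L_\delta$ and $\mathcal L_{\delta+2\pi}$, and the anti-Stokes lines are exactly $\mathcal L_{\delta\pm\pi/2}$ and $\mathcal L_{\delta+2\pi\pm\pi/2}$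 (arguments modulo $4\pi$). 2. There are functions $u_1$, $u_2$ such that $u_1=u^\theta$ for all $\theta\in(\delta,\delta+2\pi)$ mod $4\pi$ and $u_2=u^\theta$ for all $\theta\in(\delta+2\pi,\delta+4\pi)$ mod $4\pi$ (for each such $\theta$, and over a disc depending on $\theta$, the integral converges and equality holds on $S(\theta,\alpha,r')$ for every $\alpha<\pi$ and suitable $r'>0$), these being also the $1$-sums of $\hat u$ in the directions $\theta$, and such that for every $\varepsilon\in(0,\pi)$ there are $r>0$ and a disc $D$ for which: (a) $u_l\in\mathcal O(V_l\times D)$ for $l=1,2$, where $V_1=S(\delta+\pi,3\pi-\varepsilon,r)$ and $V_2=S(\delta+3\pi,3\pi-\varepsilon,r)$, and $\{u_1,u_2\}$ is a maximal family of solutions of (H) on $W_r\times D$; (b) the jump across $\mathcal L_\delta$ is, for $(t,z)\in S(\delta,\pi-\varepsilon,r)\times D$, $$u_1-u_2=u^{\delta^+}-u^{\delta^-}=-i\sqrt{\pi/t}\,\sum_{k=0}^{n-1}\frac{a_{k-n}}{(n-k-1)!}\,\frac{d^{\,n-k-1}}{ds^{\,n-k-1}}e^{-s^2/(4t)}\Big|_{s=z_0-z};$$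 (c) the jump across $\mathcal L_{\delta+2\pi}$ is, for $(t,z)\in S(\delta+2\pi,\pi-\varepsilon,r)\times D$, $$u_2-u_1=u^{(\delta+2\pi)^+}-u^{(\delta+2\pi)^-}=-i\sqrt{\pi/t}\,\sum_{k=0}^{n-1}\frac{(-1)^{k-n}a_{k-n}}{(n-k-1)!}\,\frac{d^{\,n-k-1}}{ds^{\,n-k-1}}e^{-s^2/(4t)}\Big|_{s=z-z_0}.$$ Here $\sqrt t=|t|^{1/2}e^{i\arg t/2}$ is the standard function on $W$. -/

import Mathlib

open Filter Topology MeasureTheory Set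

/-!
Conventions. The universal covering space of `ℂ ∖ {0}` is parametrized by the logarithm: a point
`τ : ℂ` stands for `t = exp τ` with `|t| = exp (re τ)` and `arg t = im τ`, and complex powers are
`t ^ c = exp (c * τ)`. This is a biholomorphic parametrization, and `t → 0` means `re τ → -∞`.
The disc `D_ρ` is `Metric.ball 0 ρ`. A function `u (t, z)` is a map `u : ℂ → ℂ → ℂ` in `(τ, z)`.
A formal power series `∑ û_n(z) t ^ n` is the sequence `û : ℕ → ℂ → ℂ` of its coefficients.
-/

namespace Stokes

noncomputable section

/-! ### Sectors -/

/-- The sector `S(d, α, R)` in the universal covering space; `R = ⊤` gives the unbounded sector. -/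
def sector (d α : ℝ) (R : EReal) : Set ℂ :=
  {τ : ℂ | ((Real.exp τ.re : ℝ) : EReal) < R ∧ |τ.im - d| < α / 2}

/-- `T` is a proper subsector of `S`. The point `0` does not belong to the covering space, so the
closure in the logarithmic coordinate is the closure without `0`. -/
def IsProperSubsector (T S : Set ℂ) : Prop :=
  ∃ (d α : ℝ) (R : EReal), 0 < α ∧ 0 < R ∧ T = sector d α R ∧ closure T ⊆ S

/-- The sector of direction `d`, opening `α` and radius `R` on the Riemann surface of `t ^ (1/q)`,
which is the quotient of the universal covering space by `arg t ↦ arg t + 2 π q`. Subsets of that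
surface are given by their full preimages in the covering space. -/
def surfaceSector (q : ℚ) (d α : ℝ) (R : EReal) : Set ℂ :=
  {τ : ℂ | ∃ m : ℤ, τ + (2 * Real.pi * q * m : ℝ) * Complex.I ∈ sector d α R}

/-- `V` is a sector with an opening greater than `β` on the Riemann surface of `t ^ (1/q)`. -/
def IsSurfaceSector (q : ℚ) (β : ℝ) (V : Set ℂ) : Prop :=
  ∃ (d α : ℝ) (R : EReal), β < α ∧ 0 < R ∧ V = surfaceSector q d α R

/-- The part `0 < |t| < r` of the Riemann surface of `t ^ (1/q)` (any `q`). -/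
def puncturedDisc (r : ℝ) : Set ℂ := {τ : ℂ | Real.exp τ.re < r}

/-! ### Holomorphic functions and growth -/

/-- `u ∈ 𝓞(U × D_ρ)`, jointly holomorphic. -/
def HolomorphicOn (u : ℂ → ℂ → ℂ) (U : Set ℂ) (ρ : ℝ) : Prop :=
  DifferentiableOn ℂ (fun p : ℂ × ℂ => u p.1 p.2) (U ×ˢ Metric.ball (0 : ℂ) ρ)

/-- Entire functions of exponential growth of order at most `k`. -/
def IsEntireOfGrowth (k : ℝ) (f : ℂ → ℂ) : Prop :=
  Differentiable ℂ f ∧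
    ∃ C₁ C₂ : ℝ, 0 < C₁ ∧ 0 < C₂ ∧ ∀ x : ℂ, ‖f x‖ ≤ C₁ * Real.exp (C₂ * ‖x‖ ^ k)

/-- `g ∈ 𝓞^k(S)` with a parameter `z ∈ D_ρ`: holomorphic in `S × D_ρ` and of exponential growth of
order at most `k` on proper subsectors, uniformly in `z`. -/
def HasGrowthOn (k : ℝ) (g : ℂ → ℂ → ℂ) (S : Set ℂ) (ρ : ℝ) : Prop :=
  HolomorphicOn g S ρ ∧
    ∀ T : Set ℂ, IsProperSubsector T S →
      ∃ C₁ C₂ : ℝ, 0 < C₁ ∧ 0 < C₂ ∧ ∀ σ ∈ T, ∀ z ∈ Metric.ball (0 : ℂ) ρ,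
        ‖g σ z‖ ≤ C₁ * Real.exp (C₂ * Real.exp σ.re ^ k)

/-! ### Summability -/

/-- `û` is a formal power series of Gevrey order `s` over the disc `D_ρ`. -/
def IsGevrey (s : ℝ) (û : ℕ → ℂ → ℂ) (ρ : ℝ) : Prop :=
  ∃ A B : ℝ, 0 < A ∧ 0 < B ∧ ∀ n : ℕ, ∀ z ∈ Metric.ball (0 : ℂ) ρ,
    ‖û n z‖ ≤ A * B ^ n * (n.factorial : ℝ) ^ s

/-- Coefficients of the modified Borel transform of order `k`. -/
def borelCoeff (k : ℝ) (û : ℕ → ℂ → ℂ) (n : ℕ) (z : ℂ) : ℂ :=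
  û n z * (n.factorial : ℂ) / (Real.Gamma (1 + n * (1 + 1 / k)) : ℂ)

/-- The function `C_α(x) = ∑ (-x)^n / (n! Γ(1 - (n+1)/α))`, for `α > 1`. At the poles of `Γ` the
coefficient `1/Γ` is `0`, which is what `Real.Gamma = 0` and division by zero give. -/
def ecalleKernel (α : ℝ) (x : ℂ) : ℂ :=
  ∑' n : ℕ, (-x) ^ n / ((n.factorial : ℂ) * (Real.Gamma (1 - (n + 1) / α) : ℂ))

/-- The integrand of the Ecalle operator of order `k` on the ray `arg s = θ`, `s = exp (ξ + iθ)`: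
with `κ = k/(1+k)` it is `g(s) C_{(k+1)/k}((s/t)^κ) d(s^κ)/dξ`. -/
def ecalleIntegrand (k θ : ℝ) (g : ℂ → ℂ → ℂ) (τ z : ℂ) (ξ : ℝ) : ℂ :=
  g (ξ + θ * Complex.I) z *
    ecalleKernel ((k + 1) / k) (Complex.exp ((k / (1 + k) : ℝ) * (ξ + θ * Complex.I - τ))) *
    ((k / (1 + k) : ℝ) * Complex.exp ((k / (1 + k) : ℝ) * (ξ + θ * Complex.I)))

/-- The Ecalle operator of order `k`, with integration over the ray `arg s = θ`. -/
def ecalle (k θ : ℝ) (g : ℂ → ℂ → ℂ) (τ z : ℂ) : ℂ :=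
  Complex.exp (-((k / (1 + k) : ℝ) * τ)) * ∫ ξ : ℝ, ecalleIntegrand k θ g τ z ξ

/-- `û` is of Gevrey order `1/k` over `D_ρ` and `g ∈ 𝓞^k(S(d, ε))` is the analytic continuation of
its modified Borel transform, which converges near `0`. -/
def IsBorelContinuation (k d : ℝ) (û : ℕ → ℂ → ℂ) (ε ρ : ℝ) (g : ℂ → ℂ → ℂ) : Prop :=
  IsGevrey (1 / k) û ρ ∧ HasGrowthOn k g (sector d ε ⊤) ρ ∧
    ∃ r₀ : ℝ, 0 < r₀ ∧ ∀ σ ∈ sector d ε (r₀ : EReal), ∀ z ∈ Metric.ball (0 : ℂ) ρ,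
      HasSum (fun n : ℕ => borelCoeff k û n z * Complex.exp (n * σ)) (g σ z)

/-- `û` is `k`-summable in the direction `d` (over some sufficiently small disc `D_ρ`). -/
def SummableInDir (k d : ℝ) (û : ℕ → ℂ → ℂ) : Prop :=
  ∃ ε ρ : ℝ, 0 < ε ∧ 0 < ρ ∧ ∃ g : ℂ → ℂ → ℂ, IsBorelContinuation k d û ε ρ g

/-- `û` is `k`-summable: in all directions but finitely many modulo `2π`. -/
def IsKSummable (k : ℝ) (û : ℕ → ℂ → ℂ) : Prop :=
  ∃ F : Finset ℝ, ∀ d : ℝ, ¬ SummableInDir k d û → ∃ φ ∈ F, ∃ m : ℤ, d = φ + 2 * Real.pi * m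

/-- On `U`, the function `f` is the `k`-sum of `û` in the direction `d`: on the points of `U` in the
sectors where the Ecalle integral of the continued Borel transform converges, over some disc `D_ρ`,
`f` is given by that integral, taken over any ray with `θ ∈ (d - ε/2, d + ε/2)`. -/
def IsKSum (k d : ℝ) (û : ℕ → ℂ → ℂ) (f : ℂ → ℂ → ℂ) (U : Set ℂ) : Prop :=
  ∃ ε ρ : ℝ, 0 < ε ∧ 0 < ρ ∧ ∃ g : ℂ → ℂ → ℂ, IsBorelContinuation k d û ε ρ g ∧
    ∀ θ : ℝ, |θ - d| < ε / 2 → ∀ α : ℝ, 0 < α → α < Real.pi / k →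
      ∃ r : ℝ, 0 < r ∧ ∀ τ ∈ sector θ α (r : EReal), ∀ z ∈ Metric.ball (0 : ℂ) ρ,
        Integrable (ecalleIntegrand k θ g τ z) ∧ (τ ∈ U → f τ z = ecalle k θ g τ z)

/-! ### The Stokes phenomenon -/

/-- The line `arg t = φ` is a Stokes line for `û`. -/
def IsStokesLine (k : ℝ) (û : ℕ → ℂ → ℂ) (φ : ℝ) : Prop :=
  (∃ ε : ℝ, 0 < ε ∧ ∀ d ∈ Ioo (φ - ε) (φ + ε), d ≠ φ → SummableInDir k d û) ∧
    ¬ SummableInDir k φ û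

/-- The line `arg t = ψ` is an anti-Stokes line for `û`. -/
def IsAntiStokesLine (k : ℝ) (û : ℕ → ℂ → ℂ) (ψ : ℝ) : Prop :=
  ∃ φ : ℝ, IsStokesLine k û φ ∧
    (ψ = φ + Real.pi / (2 * k) ∨ ψ = φ - Real.pi / (2 * k))

/-- `f⁺ - f⁻` is the jump for `û` across the Stokes line `arg t = φ`, on `U × D_ρ`: `f⁺` (resp. `f⁻`)
is the `k`-sum in the directions close to `φ` and greater (resp. less) than `φ`. -/
def IsJump (k φ : ℝ) (û : ℕ → ℂ → ℂ) (fp fm : ℂ → ℂ → ℂ) (U : Set ℂ) (ρ : ℝ) : Prop :=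
  IsStokesLine k û φ ∧ HolomorphicOn fp U ρ ∧ HolomorphicOn fm U ρ ∧
    ∃ η : ℝ, 0 < η ∧ (∀ d ∈ Ioo φ (φ + η), IsKSum k d û fp U) ∧
      (∀ d ∈ Ioo (φ - η) φ, IsKSum k d û fm U)

/-! ### The heat equation `∂_t u = ∂_z² u`, `u(0, z) = φ(z)` -/

/-- `∑ û_n(z) t ^ n`, with coefficients holomorphic in `D_ρ`, is a formal solution. -/
def IsFormalSolution (φ : ℂ → ℂ) (û : ℕ → ℂ → ℂ) (ρ : ℝ) : Prop :=
  (∀ n : ℕ, DifferentiableOn ℂ (û n) (Metric.ball 0 ρ)) ∧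
    (∀ z ∈ Metric.ball (0 : ℂ) ρ, û 0 z = φ z) ∧
    ∀ n : ℕ, ∀ z ∈ Metric.ball (0 : ℂ) ρ,
      ((n : ℂ) + 1) * û (n + 1) z = iteratedDeriv 2 (û n) z

/-- `u ∈ 𝓞(U × D_ρ)` is an actual solution, for `U` a subset of the Riemann surface of `t ^ (1/q)`.
In the coordinate `τ = log t` one has `∂_τ = t ∂_t`. -/
structure IsActualSolution (q : ℚ) (φ : ℂ → ℂ) (u : ℂ → ℂ → ℂ) (U : Set ℂ) (ρ : ℝ) : Prop where
  holo : HolomorphicOn u U ρ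
  periodic : ∀ τ ∈ U, ∀ z ∈ Metric.ball (0 : ℂ) ρ,
    u (τ + (2 * Real.pi * q : ℝ) * Complex.I) z = u τ z
  heat : ∀ τ ∈ U, ∀ z ∈ Metric.ball (0 : ℂ) ρ,
    deriv (fun τ' => u τ' z) τ = Complex.exp τ * iteratedDeriv 2 (fun z' => u τ z') z
  datum_holo : DifferentiableOn ℂ φ (Metric.ball 0 ρ)
  initial : ∀ z ∈ Metric.ball (0 : ℂ) ρ,
    Tendsto (fun τ => u τ z) (comap Complex.re atBot ⊓ 𝓟 U) (𝓝 (φ z))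

/-- `{u_i}`, `u_i ∈ 𝓞(V_i × D_ρ)`, is a maximal family of solutions of the heat equation on
`V × D_ρ`, for `V` a sector on the Riemann surface of `t ^ (1/q)` and `û` the formal solution. -/
structure IsMaximalFamily (k : ℝ) (q : ℚ) (φ : ℂ → ℂ) (û : ℕ → ℂ → ℂ) {ι : Type} [Finite ι]
    (V : Set ℂ) (ρ : ℝ) (W : ι → Set ℂ) (u : ι → ℂ → ℂ → ℂ) : Prop where
  q_pos : 0 < q
  formal : IsFormalSolution φ û ρ
  summable : IsKSummable k û
  sector_base : IsSurfaceSector q (Real.pi / k) V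
  sector_piece : ∀ i, W i ⊆ V ∧ IsSurfaceSector q (Real.pi / k) (W i)
  cover : V ⊆ ⋃ i, W i
  solution : ∀ i, IsActualSolution q φ (u i) (W i) ρ
  distinct : ∀ i j, i ≠ j → (W i ∩ W j).Nonempty →
    ∃ τ ∈ W i ∩ W j, ∃ z ∈ Metric.ball (0 : ℂ) ρ, u i τ z ≠ u j τ z
  maximal : ∀ (V' : Set ℂ) (v : ℂ → ℂ → ℂ) (d : ℝ),
    IsSurfaceSector q 0 V' → V' ⊆ V → IsActualSolution q φ v V' ρ →
    SummableInDir k d û → (∃ τ ∈ V', τ.im = d) → IsKSum k d û v V' →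
    ∃ i, (V' ∩ W i).Nonempty ∧ ∀ τ ∈ V' ∩ W i, ∀ z ∈ Metric.ball (0 : ℂ) ρ, v τ z = u i τ z

/-- The integrand `(φ(z + s) + φ(z - s)) e^{-s²/(4t)} ds/dx` on the ray `s = x e^{iθ/2}`, `x > 0`. -/
def heatIntegrand (φ : ℂ → ℂ) (θ : ℝ) (τ z : ℂ) (x : ℝ) : ℂ :=
  (φ (z + x * Complex.exp (θ / 2 * Complex.I)) + φ (z - x * Complex.exp (θ / 2 * Complex.I))) *
    Complex.exp (-(x * Complex.exp (θ / 2 * Complex.I)) ^ 2 / (4 * Complex.exp τ)) *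
    Complex.exp (θ / 2 * Complex.I)

/-- The integral `u^θ(t, z)`; here `√(4πt) = √(4π) e^{τ/2}`. -/
def heatIntegral (φ : ℂ → ℂ) (θ : ℝ) (τ z : ℂ) : ℂ :=
  1 / ((Real.sqrt (4 * Real.pi) : ℂ) * Complex.exp (τ / 2)) *
    ∫ x in Ioi (0 : ℝ), heatIntegrand φ θ τ z x

/-- `u = u^θ`: over some disc `D_ρ`, the function `u` is given by the (convergent) integral on every
`S(θ, α, r)` with `α < π` and suitable `r`. -/
def IsHeatIntegral (φ : ℂ → ℂ) (θ : ℝ) (u : ℂ → ℂ → ℂ) : Prop :=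
  ∃ ρ : ℝ, 0 < ρ ∧ ∀ α : ℝ, 0 < α → α < Real.pi →
    ∃ r : ℝ, 0 < r ∧ ∀ τ ∈ sector θ α (r : EReal), ∀ z ∈ Metric.ball (0 : ℂ) ρ,
      IntegrableOn (heatIntegrand φ θ τ z) (Ioi 0) ∧ u τ z = heatIntegral φ θ τ z

/-- `θ ∈ (a, b)` modulo `4π`. -/
def InIooMod (θ a b : ℝ) : Prop := ∃ m : ℤ, θ + 4 * Real.pi * m ∈ Ioo a b

/-- `√(π/t)` for `t = exp τ`. -/
def sqrtPiDiv (τ : ℂ) : ℂ := (Real.sqrt Real.pi : ℂ) / Complex.exp (τ / 2)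

/-- `d^j/ds^j e^{-s²/(4t)}` at `s = s₀`, for `t = exp τ`. -/
def gaussDeriv (j : ℕ) (τ s₀ : ℂ) : ℂ :=
  iteratedDeriv j (fun s : ℂ => Complex.exp (-s ^ 2 / (4 * Complex.exp τ))) s₀

end

end Stokes

open Stokes

/-! The recursion gives `û m = φ^{(2m)} / m!`, so the modified Borel transform of order one is the
even part of the Taylor series of `φ` at `z`, namely `(φ(z + √s) + φ(z - √s)) / 2`
(`hasSum_borelCoeff`). It is singular only at `s = (z₀ - z)²`. For `z` near `0` this point has
argument close to `δ` modulo `2π`. In any closed range of directions avoiding `δ + 2πℤ` it is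
holomorphic over a small disc, and growth of order `2` in `√s` is growth of order `1` in `s`; this
gives summability. In a direction `δ + 2πm` a continuation would stay bounded near `s = z₀²`,
whereas `φ` blows up at `z₀` (`IsPolar.not_summableInDir`).

The Ecalle kernel of order one is `e^{-x²/4} / √π`, so the `1`-sum in the direction `θ` is the heat
integral `u^θ` (`ecalle_borelFn`). By Cauchy's theorem `u^θ(t, z)` does not change while `θ` stays
between two consecutive singular directions `c` and `c + 2π` and within `π/2` of `arg t`. Letting
`θ` follow `arg t` produces a single function `branch φ c` on a sector of opening `3π - ε`. It has
period `4π` both in `arg t` and in `c`, so there are exactly two branches, for `c = δ` and `c = δ +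
2π`; these are `u₁` and `u₂`. Integration by parts in the integral gives the heat equation, and
concentration of the Gaussian gives the initial value (`HasConeBounds.isSectorSolution`).

Two rays on either side of the direction `δ/2` enclose the pole `z₀ - z` of `s ↦ φ(z + s)`, while
`φ(z - s)` is regular between them. The jump is therefore a residue (`rayIntegral_sub_of_pole`,
`IsPolar.heatIntegral_sub`). The reflection `z ↦ -z` exchanges the two Stokes lines and yields the
other jump.

Maximality rests on the size of the jump `J`. It is entire in `log t`, and it is bounded away from
`0` as `t → 0` wherever `cos(c - arg t) ≤ 0`, because there `|e^{-z₀²/(4t)}| ≥ 1` and the leading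
coefficient is a multiple of `a_{-n} ≠ 0` (`IsPolar.jumpFn_lower_bound`). Suppose that an actual
solution is the sum in a direction between `c` and `c + 2π`, and that its sector passes an outer
anti-Stokes line, `c - π/2` or `c + 5π/2`. By the identity theorem it equals the neighbouring branch
plus or minus `J` there. Both it and that branch tend to `φ`, so `J → 0`, a contradiction. A lift of
its sector thus has width at most `3π < 4π`: it cannot wrap around the surface and meet `branch φ c`
on another sheet, and the identity theorem gives equality on the whole intersection
(`IsPolar.eq_branch`). -/

namespace Stokes

/-! ### Integrals over rays -/

/-- The point `x e^{iθ/2}`. -/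
noncomputable def ray (θ x : ℝ) : ℂ := x * Complex.exp (θ / 2 * Complex.I)

/-- The integral of `f` over the ray `arg s = θ/2`. -/
noncomputable def rayIntegral (f : ℂ → ℂ) (θ : ℝ) : ℂ :=
  ∫ x in Ioi (0 : ℝ), f (ray θ x) * Complex.exp (θ / 2 * Complex.I)

theorem norm_exp_half_mul_I (θ : ℝ) : ‖Complex.exp (θ / 2 * Complex.I)‖ = 1 := by
  have := Complex.norm_exp_ofReal_mul_I (θ / 2)
  push_cast at this
  exact this

theorem norm_ray {θ x : ℝ} (hx : 0 ≤ x) : ‖ray θ x‖ = x := by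
  rw [ray, norm_mul, norm_exp_half_mul_I, Complex.norm_real, Real.norm_of_nonneg hx, mul_one]

theorem continuous_ray : Continuous fun p : ℝ × ℝ => ray p.1 p.2 := by
  unfold ray; fun_prop

theorem ray_exp_half (θ ξ : ℝ) :
    ray θ (Real.exp (ξ / 2)) = Complex.exp ((ξ + θ * Complex.I) / 2) := by
  rw [ray, Complex.ofReal_exp, ← Complex.exp_add]
  congr 1
  push_cast
  ring

theorem image_exp_half : (fun ξ : ℝ => Real.exp (ξ / 2)) '' univ = Ioi (0 : ℝ) := by
  ext x
  simp only [image_univ, mem_range, mem_Ioi]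
  constructor
  · rintro ⟨y, rfl⟩; exact Real.exp_pos _
  · intro hx
    exact ⟨2 * Real.log x, by rw [mul_div_cancel_left₀ _ two_ne_zero, Real.exp_log hx]⟩

theorem hasDerivAt_exp_half (ξ : ℝ) :
    HasDerivAt (fun ξ : ℝ => Real.exp (ξ / 2)) (Real.exp (ξ / 2) / 2) ξ := by
  have := ((hasDerivAt_id ξ).div_const 2).exp
  simpa [div_eq_mul_inv] using this

theorem injective_exp_half : Function.Injective fun ξ : ℝ => Real.exp (ξ / 2) := by
  intro a b h
  have := Real.exp_injective h
  linarith

theorem integral_Ioi_eq_integral_exp_half (h : ℝ → ℂ) :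
    ∫ x in Ioi (0 : ℝ), h x = ∫ ξ : ℝ, (Real.exp (ξ / 2) / 2) • h (Real.exp (ξ / 2)) := by
  rw [← image_exp_half, integral_image_eq_integral_abs_deriv_smul MeasurableSet.univ
    (fun x _ => (hasDerivAt_exp_half x).hasDerivWithinAt) injective_exp_half.injOn,
    Measure.restrict_univ]
  refine integral_congr_ae (Eventually.of_forall fun ξ => ?_)
  simp only
  rw [abs_of_pos (by positivity)]

theorem integrableOn_Ioi_iff_integrable_exp_half (h : ℝ → ℂ) :
    IntegrableOn h (Ioi (0 : ℝ)) ↔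
      Integrable fun ξ : ℝ => (Real.exp (ξ / 2) / 2) • h (Real.exp (ξ / 2)) := by
  rw [← image_exp_half, integrableOn_image_iff_integrableOn_abs_deriv_smul MeasurableSet.univ
    (fun x _ => (hasDerivAt_exp_half x).hasDerivWithinAt) injective_exp_half.injOn,
    integrableOn_univ]
  refine integrable_congr (Eventually.of_forall fun ξ => ?_)
  simp only
  rw [abs_of_pos (by positivity)]

/-- The function `f(s) ds` in the coordinate `σ = 2 log s`. -/
noncomputable def logForm (f : ℂ → ℂ) (σ : ℂ) : ℂ :=
  f (Complex.exp (σ / 2)) * (Complex.exp (σ / 2) / 2)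

theorem logForm_eq (f : ℂ → ℂ) (θ ξ : ℝ) :
    (Real.exp (ξ / 2) / 2) • (f (ray θ (Real.exp (ξ / 2))) * Complex.exp (θ / 2 * Complex.I)) =
      logForm f (ξ + θ * Complex.I) := by
  rw [logForm, ← ray_exp_half, ray]
  simp only [Complex.real_smul]
  push_cast
  ring

/-- In the coordinate `σ = 2 log s` the rays become the horizontal lines of height `θ`. This is the
form in which the Ecalle integral is written, and Cauchy's theorem then needs only rectangles. -/
theorem rayIntegral_eq_integral_logForm (f : ℂ → ℂ) (θ : ℝ) :
    rayIntegral f θ = ∫ ξ : ℝ, logForm f (ξ + θ * Complex.I) := by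
  rw [rayIntegral, integral_Ioi_eq_integral_exp_half]
  simp_rw [logForm_eq]

theorem integrableOn_ray_iff (f : ℂ → ℂ) (θ : ℝ) :
    IntegrableOn (fun x : ℝ => f (ray θ x) * Complex.exp (θ / 2 * Complex.I)) (Ioi 0) ↔
      Integrable fun ξ : ℝ => logForm f (ξ + θ * Complex.I) := by
  rw [integrableOn_Ioi_iff_integrable_exp_half]
  simp_rw [logForm_eq]

/-- Compactness of the remaining set of pairs `(θ, x)` turns a bound at infinity into an integrable
majorant on the whole ray, uniform in `θ`. -/
theorem exists_decay_bound {f : ℂ → ℂ} {θ₁ θ₂ : ℝ}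
    (hf : ∀ x ≥ 0, ∀ θ ∈ Icc θ₁ θ₂, ContinuousAt f (ray θ x)) {C X : ℝ}
    (hC : ∀ x ≥ X, ∀ θ ∈ Icc θ₁ θ₂, ‖f (ray θ x)‖ ≤ C / x ^ 2) :
    ∃ C' : ℝ, 0 ≤ C' ∧ ∀ x ≥ 0, ∀ θ ∈ Icc θ₁ θ₂, ‖f (ray θ x)‖ ≤ C' * (1 + x ^ 2)⁻¹ := by
  set Y := max X 1 with hY
  have hcomp : IsCompact (Icc θ₁ θ₂ ×ˢ Icc (0 : ℝ) Y) := isCompact_Icc.prod isCompact_Icc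
  have hcont : ContinuousOn (fun p : ℝ × ℝ => f (ray p.1 p.2)) (Icc θ₁ θ₂ ×ˢ Icc (0 : ℝ) Y) := by
    rintro ⟨θ, x⟩ ⟨h1, h2⟩
    exact (ContinuousAt.comp (f := fun p : ℝ × ℝ => ray p.1 p.2) (hf x h2.1 θ h1)
      continuous_ray.continuousAt).continuousWithinAt
  obtain ⟨M, hM⟩ := hcomp.exists_bound_of_continuousOn hcont
  refine ⟨|M| * (1 + Y ^ 2) + |C| * 2, by positivity, fun x hx θ hθ => ?_⟩
  rw [← div_eq_mul_inv, le_div_iff₀ (by positivity)]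
  rcases le_total x Y with h | h
  · have h1 := hM ⟨θ, x⟩ ⟨hθ, hx, h⟩
    have h2 : 1 + x ^ 2 ≤ 1 + Y ^ 2 := by gcongr
    calc ‖f (ray θ x)‖ * (1 + x ^ 2) ≤ |M| * (1 + Y ^ 2) := by
          gcongr
          exact h1.trans (le_abs_self _)
      _ ≤ _ := by nlinarith [abs_nonneg C]
  · have hx1 : 1 ≤ x := (le_max_right _ _).trans h
    have h1 := hC x ((le_max_left _ _).trans h) θ hθ
    have h2 : 1 + x ^ 2 ≤ 2 * x ^ 2 := by nlinarith
    calc ‖f (ray θ x)‖ * (1 + x ^ 2) ≤ |C| / x ^ 2 * (2 * x ^ 2) := by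
          gcongr
          exact h1.trans (by gcongr; exact le_abs_self _)
      _ = |C| * 2 := by field_simp
      _ ≤ _ := by nlinarith [abs_nonneg M, sq_nonneg Y, mul_nonneg (abs_nonneg M) (sq_nonneg Y)]

theorem integrableOn_ray_of_decay {f : ℂ → ℂ} {θ : ℝ}
    (hf : ∀ x ≥ 0, ContinuousAt f (ray θ x)) {C : ℝ}
    (hC : ∀ x ≥ 0, ‖f (ray θ x)‖ ≤ C * (1 + x ^ 2)⁻¹) :
    IntegrableOn (fun x : ℝ => f (ray θ x) * Complex.exp (θ / 2 * Complex.I)) (Ioi 0) := by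
  have hi : IntegrableOn (fun x : ℝ => C * (1 + x ^ 2)⁻¹) (Ioi 0) :=
    (integrable_inv_one_add_sq.const_mul C).integrableOn
  refine Integrable.mono' hi ?_ ?_
  · refine ContinuousOn.aestronglyMeasurable ?_ measurableSet_Ioi
    intro x hx
    refine ContinuousAt.continuousWithinAt ?_
    refine ContinuousAt.mul ?_ continuousAt_const
    exact ContinuousAt.comp (f := fun x : ℝ => ray θ x) (hf x (le_of_lt hx))
      (continuous_ray.comp (by fun_prop : Continuous fun x : ℝ => (θ, x))).continuousAt
  · refine (ae_restrict_mem measurableSet_Ioi).mono fun x hx => ?_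
    rw [norm_mul, norm_exp_half_mul_I, mul_one]
    exact hC x (le_of_lt hx)

/-- The integral of a function holomorphic in a closed cone and decaying quadratically does not
depend on the ray. -/
theorem rayIntegral_eq_of_holomorphic {f : ℂ → ℂ} {θ₁ θ₂ : ℝ} (h12 : θ₁ ≤ θ₂)
    (hf : ∀ x ≥ 0, ∀ θ ∈ Icc θ₁ θ₂, DifferentiableAt ℂ f (ray θ x)) {C X : ℝ}
    (hC : ∀ x ≥ X, ∀ θ ∈ Icc θ₁ θ₂, ‖f (ray θ x)‖ ≤ C / x ^ 2) :
    rayIntegral f θ₁ = rayIntegral f θ₂ := by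
  obtain ⟨K, hK0, hK⟩ := exists_decay_bound (fun x hx θ hθ => (hf x hx θ hθ).continuousAt) hC
  have hint : ∀ θ ∈ Icc θ₁ θ₂, Integrable fun ξ : ℝ => logForm f (ξ + θ * Complex.I) := fun θ hθ =>
    (integrableOn_ray_iff f θ).1 (integrableOn_ray_of_decay
      (fun x hx => (hf x hx θ hθ).continuousAt) fun x hx => hK x hx θ hθ)
  have hdiff : ∀ ξ : ℝ, ∀ θ ∈ Icc θ₁ θ₂, DifferentiableAt ℂ (logForm f) (ξ + θ * Complex.I) := by
    intro ξ θ hθ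
    have h1 := hf (Real.exp (ξ / 2)) (Real.exp_pos _).le θ hθ
    rw [ray_exp_half] at h1
    have h2 : DifferentiableAt ℂ (fun σ : ℂ => Complex.exp (σ / 2)) (ξ + θ * Complex.I) := by
      fun_prop
    exact (DifferentiableAt.comp (ξ + θ * Complex.I : ℂ) h1 h2).mul (h2.div_const 2)
  -- Decay at both ends of the line: for `ξ → -∞` it comes from `ds = e^{σ/2} dσ / 2`, for `ξ → +∞`
  -- from the quadratic decay of `f`.
  have hbound : ∀ ξ : ℝ, ∀ θ ∈ Icc θ₁ θ₂,
      ‖logForm f (ξ + θ * Complex.I)‖ ≤ K * Real.exp (-|ξ| / 2) := by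
    intro ξ θ hθ
    have h1 := hK (Real.exp (ξ / 2)) (Real.exp_pos _).le θ hθ
    have h3 : ‖Complex.exp ((ξ + θ * Complex.I) / 2)‖ = Real.exp (ξ / 2) := by
      rw [← ray_exp_half, norm_ray (Real.exp_pos _).le]
    rw [logForm, ← ray_exp_half, norm_mul, norm_div, ray_exp_half, h3, ← ray_exp_half]
    have h4 : (1 + Real.exp (ξ / 2) ^ 2)⁻¹ * Real.exp (ξ / 2) ≤ Real.exp (-|ξ| / 2) := by
      rw [inv_mul_le_iff₀ (by positivity)]
      have e1 : Real.exp (ξ / 2) * Real.exp (-(ξ / 2)) = 1 := by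
        rw [← Real.exp_add]; simp
      have p1 := Real.exp_pos (ξ / 2)
      have p2 := Real.exp_pos (-(ξ / 2))
      rcases abs_cases ξ with ⟨h, h'⟩ | ⟨h, h'⟩
      · rw [h, neg_div]
        nlinarith
      · rw [h, neg_neg]
        nlinarith
    calc _ ≤ (K * (1 + Real.exp (ξ / 2) ^ 2)⁻¹) * (Real.exp (ξ / 2) / 1) := by
          gcongr
          norm_num
      _ = K * ((1 + Real.exp (ξ / 2) ^ 2)⁻¹ * Real.exp (ξ / 2)) := by ring
      _ ≤ _ := by gcongr
  rw [rayIntegral_eq_integral_logForm, rayIntegral_eq_integral_logForm]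
  -- Cauchy's theorem on the rectangle `[-T, T] × [θ₁, θ₂]`; the vertical sides vanish as `T → ∞`.
  have hrect : ∀ T : ℝ, (∫ x : ℝ in -T..T, logForm f (x + θ₁ * Complex.I)) -
      (∫ x : ℝ in -T..T, logForm f (x + θ₂ * Complex.I)) =
      Complex.I • (∫ y : ℝ in θ₁..θ₂, logForm f ((-T : ℝ) + y * Complex.I)) -
        Complex.I • ∫ y : ℝ in θ₁..θ₂, logForm f (T + y * Complex.I) := by
    intro T
    have := Complex.integral_boundary_rect_eq_zero_of_differentiableOn (logForm f)
      (⟨-T, θ₁⟩ : ℂ) (⟨T, θ₂⟩ : ℂ) (by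
        intro σ hσ
        have hσ2 := hσ.2
        simp only [mem_preimage, uIcc_of_le h12] at hσ2
        have := hdiff σ.re σ.im hσ2
        rw [Complex.re_add_im] at this
        exact this.differentiableWithinAt)
    simp only at this
    linear_combination this
  have hvert : ∀ S : ℝ, ‖∫ y : ℝ in θ₁..θ₂, logForm f (S + y * Complex.I)‖ ≤
      K * Real.exp (-|S| / 2) * |θ₂ - θ₁| := by
    intro S
    refine intervalIntegral.norm_integral_le_of_norm_le_const fun y hy => ?_
    rw [uIoc_of_le h12] at hy
    exact hbound S y ⟨hy.1.le, hy.2⟩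
  have hzero : Tendsto (fun T : ℝ => K * Real.exp (-|T| / 2) * |θ₂ - θ₁|) atTop (𝓝 0) := by
    have : Tendsto (fun T : ℝ => Real.exp (-|T| / 2)) atTop (𝓝 0) := by
      refine Real.tendsto_exp_atBot.comp ?_
      refine Tendsto.atBot_div_const (by norm_num) ?_
      exact tendsto_neg_atTop_atBot.comp tendsto_abs_atTop_atTop
    simpa using (this.const_mul K).mul_const |θ₂ - θ₁|
  have t1 : Tendsto (fun T : ℝ => Complex.I • (∫ y : ℝ in θ₁..θ₂, logForm f ((-T : ℝ) + y * Complex.I)) -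
        Complex.I • ∫ y : ℝ in θ₁..θ₂, logForm f (T + y * Complex.I)) atTop (𝓝 0) := by
    rw [← sub_zero (0 : ℂ)]
    refine Tendsto.sub ?_ ?_
    · refine squeeze_zero_norm (fun T => ?_) hzero
      rw [norm_smul, Complex.norm_I, one_mul]
      simpa using hvert (-T)
    · refine squeeze_zero_norm (fun T => ?_) hzero
      rw [norm_smul, Complex.norm_I, one_mul]
      exact hvert T
  have t2 := (intervalIntegral_tendsto_integral (hint θ₁ ⟨le_rfl, h12⟩) tendsto_neg_atTop_atBot
    tendsto_id).sub (intervalIntegral_tendsto_integral (hint θ₂ ⟨h12, le_rfl⟩)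
      tendsto_neg_atTop_atBot tendsto_id)
  simp only [id, hrect] at t2
  exact sub_eq_zero.1 (tendsto_nhds_unique t2 t1)

/-! ### Holomorphic dependence on parameters -/

section Parametric

variable {α : Type*} [MeasurableSpace α] {μ : Measure α}

/-- The derivative is an a.e. limit of difference quotients; the increments `R / (n + 2)` tend to
`0` and keep the points in the ball. -/
theorem aestronglyMeasurable_deriv_of_holomorphic {f : ℂ → α → ℂ} {z₀ : ℂ} {R : ℝ} (hR : 0 < R)
    (hmeas : ∀ z ∈ Metric.ball z₀ R, AEStronglyMeasurable (f z) μ)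
    (hdiff : ∀ᵐ a ∂μ, DifferentiableOn ℂ (fun z => f z a) (Metric.ball z₀ R)) :
    AEStronglyMeasurable (fun a => deriv (fun z => f z a) z₀) μ := by
  let h : ℕ → ℂ := fun n => ((R / (n + 2) : ℝ) : ℂ)
  have hpos : ∀ n : ℕ, 0 < R / ((n : ℝ) + 2) := fun n => by positivity
  have hlt : ∀ n : ℕ, R / ((n : ℝ) + 2) < R := fun n => by
    rw [div_lt_iff₀ (by positivity)]
    have : (0 : ℝ) ≤ n := n.cast_nonneg
    nlinarith
  have hh : Tendsto h atTop (𝓝[≠] 0) := by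
    refine tendsto_nhdsWithin_iff.2 ⟨?_, Eventually.of_forall fun n => ?_⟩
    · have : Tendsto (fun n : ℕ => R / ((n : ℝ) + 2)) atTop (𝓝 0) :=
        Tendsto.div_atTop tendsto_const_nhds
          (tendsto_natCast_atTop_atTop.atTop_add tendsto_const_nhds)
      have := (Complex.continuous_ofReal.tendsto 0).comp this
      simpa [h, Function.comp_def] using this
    · exact Complex.ofReal_ne_zero.2 (hpos n).ne'
  refine aestronglyMeasurable_of_tendsto_ae atTop
    (f := fun n a => (h n)⁻¹ • (f (z₀ + h n) a - f z₀ a)) (fun n => ?_) ?_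
  · suffices h' : AEStronglyMeasurable (fun a => f (z₀ + h n) a - f z₀ a) μ from
      h'.const_smul (h n)⁻¹
    refine (hmeas _ ?_).sub (hmeas _ (Metric.mem_ball_self hR))
    rw [Metric.mem_ball, dist_eq_norm, add_sub_cancel_left, Complex.norm_real,
      Real.norm_of_nonneg (hpos n).le]
    exact hlt n
  · filter_upwards [hdiff] with a ha
    have := (ha.differentiableAt (Metric.ball_mem_nhds z₀ hR)).hasDerivAt.tendsto_slope_zero
    exact this.comp hh

theorem norm_deriv_le_of_ball {f : ℂ → ℂ} {z₀ z : ℂ} {R M : ℝ} (hR : 0 < R)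
    (hd : DifferentiableOn ℂ f (Metric.ball z₀ R)) (hM : ∀ w ∈ Metric.ball z₀ R, ‖f w‖ ≤ M)
    (hz : z ∈ Metric.ball z₀ (R / 2)) : ‖deriv f z‖ ≤ M / (R / 4) := by
  have hsub : Metric.closedBall z (R / 4) ⊆ Metric.ball z₀ R := by
    intro w hw
    rw [Metric.mem_closedBall] at hw
    rw [Metric.mem_ball] at hz ⊢
    linarith [dist_triangle w z z₀]
  refine Complex.norm_deriv_le_of_forall_mem_sphere_norm_le (by positivity) ?_
    fun w hw => hM w (hsub (Metric.sphere_subset_closedBall hw))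
  exact (hd.mono hsub).diffContOnCl_ball (Subset.rfl)

/-- For holomorphic integrands a majorant of the integrand alone suffices: Cauchy's estimate on
circles of radius `R / 4` bounds the derivative on the half ball. -/
theorem hasDerivAt_integral_of_holomorphic {f : ℂ → α → ℂ} {z₀ : ℂ} {R : ℝ} {b : α → ℝ}
    (hR : 0 < R) (hmeas : ∀ z ∈ Metric.ball z₀ R, AEStronglyMeasurable (f z) μ)
    (hdiff : ∀ᵐ a ∂μ, DifferentiableOn ℂ (fun z => f z a) (Metric.ball z₀ R))
    (hb : ∀ᵐ a ∂μ, ∀ z ∈ Metric.ball z₀ R, ‖f z a‖ ≤ b a) (hbi : Integrable b μ) :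
    Integrable (fun a => deriv (fun z => f z a) z₀) μ ∧
      HasDerivAt (fun z => ∫ a, f z a ∂μ) (∫ a, deriv (fun z => f z a) z₀ ∂μ) z₀ := by
  refine hasDerivAt_integral_of_dominated_loc_of_deriv_le
    (F' := fun z a => deriv (fun z => f z a) z) (bound := fun a => b a / (R / 4))
    (Metric.ball_mem_nhds z₀ (half_pos hR)) ?_ ?_
    (aestronglyMeasurable_deriv_of_holomorphic hR hmeas hdiff) ?_ (hbi.div_const _) ?_
  · exact eventually_of_mem (Metric.ball_mem_nhds z₀ hR) hmeas
  · refine Integrable.mono' hbi (hmeas _ (Metric.mem_ball_self hR)) ?_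
    filter_upwards [hb] with a ha using ha _ (Metric.mem_ball_self hR)
  · filter_upwards [hdiff, hb] with a h1 h2 z hz
    exact norm_deriv_le_of_ball hR h1 h2 hz
  · filter_upwards [hdiff] with a h1 z hz
    exact (h1.differentiableAt (Metric.isOpen_ball.mem_nhds
      (Metric.ball_subset_ball (by linarith) hz))).hasDerivAt

/-- Cauchy's estimate in one variable, applied on the complex line `t ↦ p + t • v`. -/
theorem norm_fderiv_le_of_ball {f : ℂ × ℂ → ℂ} {p₀ p : ℂ × ℂ} {R M : ℝ} (hR : 0 < R)
    (hM0 : 0 ≤ M)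
    (hd : DifferentiableOn ℂ f (Metric.ball p₀ R)) (hM : ∀ w ∈ Metric.ball p₀ R, ‖f w‖ ≤ M)
    (hp : p ∈ Metric.ball p₀ (R / 2)) : ‖fderiv ℂ f p‖ ≤ M / (R / 4) := by
  refine ContinuousLinearMap.opNorm_le_bound _ (by positivity) fun v => ?_
  rcases eq_or_ne v 0 with rfl | hv
  · simp
  have hv' : 0 < ‖v‖ := norm_pos_iff.2 hv
  have hmem : ∀ t : ℂ, t ∈ Metric.closedBall (0 : ℂ) (R / 4 / ‖v‖) →
      p + t • v ∈ Metric.ball p₀ R := by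
    intro t ht
    rw [mem_closedBall_zero_iff, le_div_iff₀ hv'] at ht
    rw [Metric.mem_ball] at hp ⊢
    have : dist (p + t • v) p = ‖t‖ * ‖v‖ := by
      rw [dist_eq_norm, add_sub_cancel_left, norm_smul]
    linarith [dist_triangle (p + t • v) p p₀]
  have hline : ∀ t : ℂ, HasDerivAt (fun t : ℂ => p + t • v) v t := fun t => by
    simpa using ((hasDerivAt_id t).smul_const v).const_add p
  have hf : DifferentiableAt ℂ f p := hd.differentiableAt (Metric.isOpen_ball.mem_nhds
      (Metric.ball_subset_ball (by linarith) hp))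
  have hder : deriv (fun t : ℂ => f (p + t • v)) 0 = fderiv ℂ f p v := by
    have h0 : HasFDerivAt f (fderiv ℂ f p) (p + (0 : ℂ) • v) := by simpa using hf.hasFDerivAt
    exact (h0.comp_hasDerivAt (0 : ℂ) (hline 0)).deriv
  rw [← hder]
  have hb := Complex.norm_deriv_le_of_forall_mem_sphere_norm_le
    (f := fun t : ℂ => f (p + t • v)) (c := 0) (R := R / 4 / ‖v‖) (C := M) (by positivity) ?_
    fun t ht => hM _ (hmem t (Metric.sphere_subset_closedBall ht))
  · calc _ ≤ _ := hb
      _ = _ := by field_simp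
  · refine DifferentiableOn.diffContOnCl_ball (U := Metric.closedBall 0 (R / 4 / ‖v‖)) ?_ Subset.rfl
    intro t ht
    refine (DifferentiableAt.comp t (hd.differentiableAt (Metric.isOpen_ball.mem_nhds (hmem t ht)))
      (hline t).differentiableAt).differentiableWithinAt

theorem differentiableAt_integral_of_holomorphic {f : ℂ × ℂ → α → ℂ} {p₀ : ℂ × ℂ} {R : ℝ}
    {b : α → ℝ} (hR : 0 < R) (hmeas : ∀ p ∈ Metric.ball p₀ R, AEStronglyMeasurable (f p) μ)
    (hdiff : ∀ᵐ a ∂μ, DifferentiableOn ℂ (fun p => f p a) (Metric.ball p₀ R))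
    (hb : ∀ᵐ a ∂μ, ∀ p ∈ Metric.ball p₀ R, ‖f p a‖ ≤ b a) (hbi : Integrable b μ) :
    DifferentiableAt ℂ (fun p => ∫ a, f p a ∂μ) p₀ := by
  have hpart : ∀ v : ℂ × ℂ, ‖v‖ ≤ 1 →
      AEStronglyMeasurable (fun a => fderiv ℂ (fun p => f p a) p₀ v) μ := by
    intro v hv
    have hline : ∀ t : ℂ, HasDerivAt (fun t : ℂ => p₀ + t • v) v t := fun t => by
      simpa using ((hasDerivAt_id t).smul_const v).const_add p₀
    have hmem : ∀ t ∈ Metric.ball (0 : ℂ) R, p₀ + t • v ∈ Metric.ball p₀ R := by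
      intro t ht
      rw [Metric.mem_ball, dist_eq_norm, add_sub_cancel_left, norm_smul]
      rw [mem_ball_zero_iff] at ht
      nlinarith [norm_nonneg t, norm_nonneg v]
    have := aestronglyMeasurable_deriv_of_holomorphic (μ := μ)
      (f := fun t a => f (p₀ + t • v) a) (z₀ := 0) hR (fun t ht => hmeas _ (hmem t ht)) (by
        filter_upwards [hdiff] with a ha t ht
        exact (DifferentiableAt.comp t (ha.differentiableAt (Metric.isOpen_ball.mem_nhds
          (hmem t ht))) (hline t).differentiableAt).differentiableWithinAt)
    refine this.congr ?_
    filter_upwards [hdiff] with a ha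
    have h0 : HasFDerivAt (fun p => f p a) (fderiv ℂ (fun p => f p a) p₀) (p₀ + (0 : ℂ) • v) := by
      simpa using (ha.differentiableAt (Metric.ball_mem_nhds p₀ hR)).hasFDerivAt
    exact (h0.comp_hasDerivAt (0 : ℂ) (hline 0)).deriv
  refine (hasFDerivAt_integral_of_dominated_of_fderiv_le (𝕜 := ℂ)
    (F' := fun p a => fderiv ℂ (fun p => f p a) p) (bound := fun a => b a / (R / 4))
    (Metric.ball_mem_nhds p₀ (half_pos hR)) ?_ ?_ ?_ ?_ (hbi.div_const _) ?_).differentiableAt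
  · exact eventually_of_mem (Metric.ball_mem_nhds p₀ hR) hmeas
  · refine Integrable.mono' hbi (hmeas _ (Metric.mem_ball_self hR)) ?_
    filter_upwards [hb] with a ha using ha _ (Metric.mem_ball_self hR)
  -- Measurability of the total derivative is reduced to that of the two partial derivatives.
  · have : (fun a => fderiv ℂ (fun p => f p a) p₀) = fun a =>
        (fderiv ℂ (fun p => f p a) p₀ (1, 0)) • ContinuousLinearMap.fst ℂ ℂ ℂ +
          (fderiv ℂ (fun p => f p a) p₀ (0, 1)) • ContinuousLinearMap.snd ℂ ℂ ℂ := by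
      funext a
      ext <;> simp
    rw [this]
    exact ((hpart (1, 0) (by simp)).smul_const _).add ((hpart (0, 1) (by simp)).smul_const _)
  · filter_upwards [hdiff, hb] with a h1 h2 p hp
    exact norm_fderiv_le_of_ball hR ((norm_nonneg _).trans (h2 p₀ (Metric.mem_ball_self hR))) h1 h2 hp
  · filter_upwards [hdiff] with a h1 p hp
    exact (h1.differentiableAt (Metric.isOpen_ball.mem_nhds
      (Metric.ball_subset_ball (by linarith) hp))).hasFDerivAt

end Parametric


/-! ### Functions with one polar singularity -/

/-- `φ` is the sum of a principal part of order exactly `n` at `z₀`, where `δ = 2 arg z₀`, and of an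
entire function of growth of order `2`. -/
structure IsPolar (n : ℕ) (a : ℤ → ℂ) (z₀ : ℂ) (δ : ℝ) (ψ φ : ℂ → ℂ) : Prop where
  one_le : 1 ≤ n
  lead : a (-(n : ℤ)) ≠ 0
  ne_zero : z₀ ≠ 0
  polar : z₀ = (‖z₀‖ : ℂ) * Complex.exp ((δ / 2 : ℝ) * Complex.I)
  growth : IsEntireOfGrowth 2 ψ
  eq : ∀ z : ℂ, φ z = ∑ j ∈ Finset.Icc 1 n, a (-(j : ℤ)) / (z - z₀) ^ j + ψ z

theorem ray_neg (θ x : ℝ) : ray θ (-x) = -ray θ x := by simp [ray]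

theorem norm_ray_sq (θ x : ℝ) : ‖ray θ x‖ ^ 2 = x ^ 2 := by
  rw [ray, norm_mul, norm_exp_half_mul_I, Complex.norm_real, mul_one, Real.norm_eq_abs, sq_abs]

/-- Bounds for `φ` on the double cone of directions `θ/2`, `θ ∈ [c + η, c + 2π - η]`, uniform with
respect to translations by small `z`. -/
def ConeBound (φ : ℂ → ℂ) (c η ρ A B : ℝ) : Prop :=
  ∀ z ∈ Metric.ball (0 : ℂ) ρ, ∀ θ ∈ Icc (c + η) (c + 2 * Real.pi - η), ∀ x : ℝ,
    DifferentiableAt ℂ φ (z + ray θ x) ∧ ‖φ (z + ray θ x)‖ ≤ A * Real.exp (B * x ^ 2)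

def HasConeBounds (φ : ℂ → ℂ) (c : ℝ) : Prop :=
  ∀ η R : ℝ, 0 < η → η < Real.pi → 0 < R →
    ∃ ρ A B : ℝ, 0 < ρ ∧ ρ ≤ R ∧ 0 < A ∧ 0 < B ∧ ConeBound φ c η ρ A B

theorem ConeBound.mono {φ : ℂ → ℂ} {c η ρ A B η' ρ' : ℝ} (h : ConeBound φ c η ρ A B)
    (hη : η ≤ η') (hρ : ρ' ≤ ρ) : ConeBound φ c η' ρ' A B := fun z hz θ hθ x =>
  h z (Metric.ball_subset_ball hρ hz) θ ⟨by linarith [hθ.1], by linarith [hθ.2]⟩ x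

theorem sin_half_le_abs_sin {u η : ℝ} {m : ℤ} (hη : 0 < η) (h1 : Real.pi * m + η / 2 ≤ u)
    (h2 : u ≤ Real.pi * m + Real.pi - η / 2) : Real.sin (η / 2) ≤ |Real.sin u| := by
  have h3 : |Real.sin u| = |Real.sin (u - m * Real.pi)| := by
    rw [Real.sin_sub_int_mul_pi, abs_mul, abs_zpow, abs_neg, abs_one, one_zpow, one_mul]
  rw [h3]
  refine le_trans ?_ (le_abs_self _)
  rw [← Real.cos_pi_div_two_sub (η / 2), ← Real.cos_pi_div_two_sub (u - _),
    ← Real.cos_abs (Real.pi / 2 - (u - _))]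
  refine Real.cos_le_cos_of_nonneg_of_le_pi (abs_nonneg _) (by linarith [Real.pi_pos]) ?_
  rw [abs_le]
  constructor <;> linarith

/-! ### Distance to the pole, growth away from it, blow-up at it. -/

namespace IsPolar

variable {n : ℕ} {a : ℤ → ℂ} {z₀ : ℂ} {δ : ℝ} {ψ φ : ℂ → ℂ}

/-- The reflection `z ↦ -z` exchanges the two Stokes lines, so that everything proved for the
direction `δ` transfers to `δ + 2π`. -/
theorem neg (h : IsPolar n a z₀ δ ψ φ) :
    IsPolar n (fun j => (-1) ^ j * a j) (-z₀) (δ + 2 * Real.pi) (fun z => ψ (-z))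
      (fun z => φ (-z)) where
  one_le := h.one_le
  lead := mul_ne_zero (zpow_ne_zero _ (by norm_num)) h.lead
  ne_zero := neg_ne_zero.2 h.ne_zero
  polar := by
    have e : Complex.exp (((δ + 2 * Real.pi) / 2 : ℝ) * Complex.I) =
        -Complex.exp ((δ / 2 : ℝ) * Complex.I) := by
      rw [← Complex.exp_add_pi_mul_I]
      congr 1
      push_cast
      ring
    rw [e, norm_neg, mul_neg, ← h.polar]
  growth := by
    obtain ⟨h1, C₁, C₂, h2, h3, h4⟩ := h.growth
    exact ⟨h1.comp differentiable_neg, C₁, C₂, h2, h3, fun x => by simpa using h4 (-x)⟩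
  eq z := by
    rw [h.eq]
    congr 1
    refine Finset.sum_congr rfl fun j _ => ?_
    have : (-z - z₀) ^ j = (-1) ^ j * (z - -z₀) ^ j := by rw [← mul_pow]; congr 1; ring
    rw [this, zpow_neg, zpow_natCast, div_mul_eq_div_div, mul_div_assoc, div_right_comm,
      div_eq_inv_mul]

theorem norm_pos (h : IsPolar n a z₀ δ ψ φ) : 0 < ‖z₀‖ := norm_pos_iff.2 h.ne_zero

/-- The left side is the distance from `z₀` to the whole line of direction `θ/2`: after rotation by
`e^{-iθ/2}` this line is the real axis, and the distance is an imaginary part. -/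
theorem mul_abs_sin_le (h : IsPolar n a z₀ δ ψ φ) (θ x : ℝ) :
    ‖z₀‖ * |Real.sin ((θ - δ) / 2)| ≤ ‖ray θ x - z₀‖ := by
  have e : (ray θ x - z₀) * Complex.exp ((-(θ / 2) : ℝ) * Complex.I) =
      x - ‖z₀‖ * Complex.exp ((-((θ - δ) / 2) : ℝ) * Complex.I) := by
    rw [sub_mul, ray, mul_assoc, ← Complex.exp_add]
    conv_lhs => rw [h.polar]
    rw [mul_assoc, ← Complex.exp_add]
    have e1 : (θ / 2 * Complex.I + ((-(θ / 2) : ℝ) : ℂ) * Complex.I : ℂ) = 0 := by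
      push_cast; ring
    have e2 : ((δ / 2 : ℝ) * Complex.I + ((-(θ / 2) : ℝ) : ℂ) * Complex.I : ℂ) =
        (-((θ - δ) / 2) : ℝ) * Complex.I := by
      push_cast; ring
    rw [e1, e2, Complex.exp_zero, mul_one]
  have e2 : ‖ray θ x - z₀‖ = ‖(ray θ x - z₀) * Complex.exp ((-(θ / 2) : ℝ) * Complex.I)‖ := by
    rw [norm_mul, Complex.norm_exp_ofReal_mul_I, mul_one]
  rw [e2, e]
  refine le_trans (le_of_eq ?_) (Complex.abs_im_le_norm _)
  rw [Complex.sub_im, Complex.ofReal_im, Complex.im_ofReal_mul, Complex.exp_ofReal_mul_I_im,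
    Real.sin_neg, zero_sub, mul_neg, neg_neg, abs_mul, abs_of_nonneg (norm_nonneg _)]

theorem differentiableAt (h : IsPolar n a z₀ δ ψ φ) {z : ℂ} (hz : z ≠ z₀) :
    DifferentiableAt ℂ φ z := by
  have : φ = fun z => ∑ j ∈ Finset.Icc 1 n, a (-(j : ℤ)) / (z - z₀) ^ j + ψ z := funext h.eq
  rw [this]
  refine DifferentiableAt.add (DifferentiableAt.fun_sum fun j _ => ?_) h.growth.1.differentiableAt
  exact (differentiableAt_const _).div (by fun_prop) (pow_ne_zero _ (sub_ne_zero.2 hz))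

/-- Away from the pole the principal part is bounded, and the entire part has growth of order `2`.
-/
theorem exists_bound (h : IsPolar n a z₀ δ ψ φ) {κ : ℝ} (hκ : 0 < κ) :
    ∃ A B : ℝ, 0 < A ∧ 0 < B ∧ ∀ w : ℂ, κ ≤ ‖w - z₀‖ → ‖φ w‖ ≤ A * Real.exp (B * ‖w‖ ^ 2) := by
  obtain ⟨-, C₁, C₂, h2, h3, h4⟩ := h.growth
  set S := ∑ j ∈ Finset.Icc 1 n, ‖a (-(j : ℤ))‖ / κ ^ j
  have hS : 0 ≤ S := Finset.sum_nonneg fun j _ => by positivity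
  refine ⟨S + C₁, C₂, by positivity, h3, fun w hw => ?_⟩
  rw [h.eq, add_mul]
  refine (norm_add_le _ _).trans (add_le_add ?_ ?_)
  · have h5 : ‖∑ j ∈ Finset.Icc 1 n, a (-(j : ℤ)) / (w - z₀) ^ j‖ ≤ S := by
      refine (norm_sum_le _ _).trans (Finset.sum_le_sum fun j _ => ?_)
      rw [norm_div, norm_pow]
      gcongr
    have h6 : (1 : ℝ) ≤ Real.exp (C₂ * ‖w‖ ^ 2) := Real.one_le_exp (by positivity)
    nlinarith
  · have := h4 w
    rwa [Real.rpow_two] at this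

theorem hasConeBounds (h : IsPolar n a z₀ δ ψ φ) {c : ℝ} {m : ℤ} (hc : c = δ + 2 * Real.pi * m) :
    HasConeBounds φ c := by
  intro η R hη hηπ hR
  -- A lower bound for the distance from `z₀` to the double cone. Translations by `z` may use half
  -- of it, hence `ρ ≤ κ / 2`.
  set κ := ‖z₀‖ * Real.sin (η / 2) with hκ_def
  have hκ : 0 < κ := mul_pos h.norm_pos
    (Real.sin_pos_of_pos_of_lt_pi (by linarith) (by linarith))
  obtain ⟨A, B, hA, hB, hAB⟩ := h.exists_bound (half_pos hκ)
  set ρ := min R (κ / 2) with hρ_def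
  have hρ : 0 < ρ := lt_min hR (half_pos hκ)
  -- The constants come from `‖z + s‖² ≤ 2ρ² + 2‖s‖²`.
  refine ⟨ρ, A * Real.exp (2 * B * ρ ^ 2), 2 * B, hρ, min_le_left _ _, by positivity,
    by positivity, fun z hz θ hθ x => ?_⟩
  rw [mem_ball_zero_iff] at hz
  have h1 : κ ≤ ‖ray θ x - z₀‖ := by
    refine le_trans ?_ (h.mul_abs_sin_le θ x)
    refine mul_le_mul_of_nonneg_left ?_ (norm_nonneg _)
    refine sin_half_le_abs_sin (m := m) hη ?_ ?_ <;> rw [hc] at hθ <;>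
      linarith [hθ.1, hθ.2]
  have h2 : κ / 2 ≤ ‖z + ray θ x - z₀‖ := by
    have e : ray θ x - z₀ = (z + ray θ x - z₀) - z := by ring
    have := norm_sub_le (z + ray θ x - z₀) z
    rw [← e] at this
    linarith [min_le_right R (κ / 2)]
  refine ⟨h.differentiableAt fun hz => ?_, (hAB _ h2).trans ?_⟩
  · rw [hz, sub_self, norm_zero] at h2
    linarith
  · rw [mul_assoc A, ← Real.exp_add]
    gcongr
    have h3 : ‖z + ray θ x‖ ≤ ‖z‖ + ‖ray θ x‖ := norm_add_le _ _
    have h4 : ‖z + ray θ x‖ ^ 2 ≤ (‖z‖ + ‖ray θ x‖) ^ 2 := by gcongr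
    have h5 : (‖z‖ + ‖ray θ x‖) ^ 2 ≤ 2 * ‖z‖ ^ 2 + 2 * ‖ray θ x‖ ^ 2 := by
      nlinarith [sq_nonneg (‖z‖ - ‖ray θ x‖)]
    have h6 : ‖z‖ ^ 2 ≤ ρ ^ 2 := by gcongr
    rw [norm_ray_sq] at h5
    nlinarith

theorem differentiableOn_ball (h : IsPolar n a z₀ δ ψ φ) :
    DifferentiableOn ℂ φ (Metric.ball 0 ‖z₀‖) := fun z hz =>
  (h.differentiableAt fun e => by simp [e] at hz).differentiableWithinAt

/-- `Q(z) = (z - z₀)^n φ(z)` extends continuously to `z₀` with the value `a (-n) ≠ 0`. -/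
theorem tendsto_norm (h : IsPolar n a z₀ δ ψ φ) :
    Tendsto (fun z => ‖φ z‖) (𝓝[≠] z₀) atTop := by
  let Q : ℂ → ℂ := fun z => ∑ j ∈ Finset.Icc 1 n, a (-(j : ℤ)) * (z - z₀) ^ (n - j) +
    ψ z * (z - z₀) ^ n
  have hQc : Continuous Q := by
    have := h.growth.1.continuous
    fun_prop
  have hQ0 : Q z₀ = a (-(n : ℤ)) := by
    simp only [Q, sub_self]
    rw [Finset.sum_eq_single n]
    · simp [(Nat.one_le_iff_ne_zero.1 h.one_le)]
    · intro j hj hjn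
      have := Finset.mem_Icc.1 hj
      rw [zero_pow (by omega), mul_zero]
    · intro hn
      exact absurd (Finset.mem_Icc.2 ⟨h.one_le, le_rfl⟩) hn
  have hlim : Tendsto (fun z => ‖Q z‖ * (‖z - z₀‖ ^ n)⁻¹) (𝓝[≠] z₀) atTop := by
    refine Tendsto.pos_mul_atTop (C := ‖a (-(n : ℤ))‖) (norm_pos_iff.2 h.lead) ?_ ?_
    · rw [← hQ0]
      exact (hQc.norm.tendsto z₀).mono_left nhdsWithin_le_nhds
    · refine Tendsto.inv_tendsto_nhdsGT_zero (tendsto_nhdsWithin_iff.2 ⟨?_, ?_⟩)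
      · have : Tendsto (fun z : ℂ => ‖z - z₀‖ ^ n) (𝓝 z₀) (𝓝 (‖z₀ - z₀‖ ^ n)) :=
          Continuous.tendsto (by fun_prop) z₀
        rw [sub_self, norm_zero, zero_pow (Nat.one_le_iff_ne_zero.1 h.one_le)] at this
        exact this.mono_left nhdsWithin_le_nhds
      · filter_upwards [self_mem_nhdsWithin] with z hz
        exact pow_pos (norm_pos_iff.2 (sub_ne_zero.2 hz)) n
  refine hlim.congr' ?_
  filter_upwards [self_mem_nhdsWithin] with z hz
  have hz' : z - z₀ ≠ 0 := sub_ne_zero.2 hz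
  have : φ z = Q z * ((z - z₀) ^ n)⁻¹ := by
    rw [h.eq, add_mul, Finset.sum_mul, mul_assoc, mul_inv_cancel₀ (pow_ne_zero _ hz'), mul_one]
    congr 1
    refine Finset.sum_congr rfl fun j hj => ?_
    have hj' := Finset.mem_Icc.1 hj
    rw [mul_assoc, pow_sub₀ _ hz' hj'.2, div_eq_mul_inv]
    field_simp
  rw [this, norm_mul, norm_inv, norm_pow]

end IsPolar


/-! ### The Ecalle kernel of order one -/

/-- The values of `Γ` that enter the coefficients of even index of `ecalleKernel 2`. -/
theorem factorial_mul_Gamma_half_sub (m : ℕ) :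
    ((2 * m).factorial : ℝ) * Real.Gamma (1 / 2 - m) =
      (-4) ^ m * m.factorial * Real.sqrt Real.pi := by
  induction m with
  | zero => simpa using Real.Gamma_one_half_eq
  | succ m ih =>
    have hne : (1 / 2 - (m + 1 : ℕ) : ℝ) ≠ 0 := by
      push_cast
      have : (0 : ℝ) ≤ m := m.cast_nonneg
      linarith
    have h1 := Real.Gamma_add_one hne
    have e : (1 / 2 - (m + 1 : ℕ) + 1 : ℝ) = 1 / 2 - m := by push_cast; ring
    rw [e] at h1
    rw [h1] at ih
    have e2 : 2 * (m + 1) = 2 * m + 1 + 1 := by ring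
    rw [e2, Nat.factorial_succ, Nat.factorial_succ, Nat.factorial_succ m, pow_succ]
    push_cast at ih ⊢
    linear_combination (-4 * ((m : ℝ) + 1)) * ih

/-- The terms of odd index vanish, being at poles of `Γ`, and those of even index form an
exponential series. -/
theorem ecalleKernel_one (x : ℂ) :
    ecalleKernel ((1 + 1) / 1) x = Complex.exp (-x ^ 2 / 4) / (Real.sqrt Real.pi : ℂ) := by
  have hpi : (Real.sqrt Real.pi : ℂ) ≠ 0 :=
    Complex.ofReal_ne_zero.2 (Real.sqrt_pos.2 Real.pi_pos).ne'
  have h1 : HasSum (fun m : ℕ => (-x ^ 2 / 4) ^ m / (m.factorial : ℂ))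
      (Complex.exp (-x ^ 2 / 4)) := by
    rw [Complex.exp_eq_exp_ℂ]
    exact NormedSpace.expSeries_div_hasSum_exp _
  have h2 := h1.div_const (Real.sqrt Real.pi : ℂ)
  rw [ecalleKernel, ← h2.tsum_eq]
  have hinj : Function.Injective fun m : ℕ => 2 * m := fun p q h => by
    simp only at h; omega
  rw [← hinj.tsum_eq (f := fun n : ℕ => (-x) ^ n / ((n.factorial : ℂ) *
    (Real.Gamma (1 - (n + 1) / ((1 + 1) / 1)) : ℂ)))]
  · refine tsum_congr fun m => ?_
    have e1 : (1 - ((2 * m : ℕ) + 1) / ((1 + 1) / 1) : ℝ) = 1 / 2 - m := by push_cast; ring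
    have e2 := congrArg (fun r : ℝ => (r : ℂ)) (factorial_mul_Gamma_half_sub m)
    push_cast at e2
    rw [e1, e2, pow_mul, neg_sq, div_pow, neg_pow (x ^ 2), neg_pow (4 : ℂ)]
    have h3 : ((-1 : ℂ) ^ m) ≠ 0 := pow_ne_zero _ (by norm_num)
    have h4 : (m.factorial : ℂ) ≠ 0 := Nat.cast_ne_zero.2 m.factorial_ne_zero
    have h5 : ((-1 : ℂ) ^ m) * (-1) ^ m = 1 := by rw [← mul_pow]; simp
    field_simp
    linear_combination (-(x ^ 2) ^ m) * h5
  · intro k hk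
    rw [Function.mem_support] at hk
    rcases Nat.even_or_odd' k with ⟨l, rfl | rfl⟩
    · exact ⟨l, rfl⟩
    · refine absurd ?_ hk
      have e1 : (1 - ((2 * l + 1 : ℕ) + 1) / ((1 + 1) / 1) : ℝ) = -(l : ℝ) := by push_cast; ring
      rw [e1, Real.Gamma_neg_nat_eq_zero]
      simp

/-! ### The Ecalle integral as a heat integral -/

/-- `(φ(z + s) + φ(z - s)) e^{-s²/(4t)}`. -/
noncomputable def heatForm (φ : ℂ → ℂ) (τ z s : ℂ) : ℂ :=
  (φ (z + s) + φ (z - s)) * Complex.exp (-s ^ 2 / (4 * Complex.exp τ))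

theorem heatIntegrand_eq (φ : ℂ → ℂ) (θ : ℝ) (τ z : ℂ) (x : ℝ) :
    heatIntegrand φ θ τ z x = heatForm φ τ z (ray θ x) * Complex.exp (θ / 2 * Complex.I) := rfl

theorem heatIntegral_eq (φ : ℂ → ℂ) (θ : ℝ) (τ z : ℂ) :
    heatIntegral φ θ τ z = 1 / ((Real.sqrt (4 * Real.pi) : ℂ) * Complex.exp (τ / 2)) *
      rayIntegral (heatForm φ τ z) θ := rfl

/-- The continuation of the modified Borel transform of the formal solution. -/
noncomputable def borelFn (φ : ℂ → ℂ) (σ z : ℂ) : ℂ :=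
  (φ (z + Complex.exp (σ / 2)) + φ (z - Complex.exp (σ / 2))) / 2

/-- With `κ = 1/2` the argument of the kernel is `√(s/t)`, so the kernel is the Gaussian of the heat
integral in the variable `√s`. The constant collects the factor `1/2` of the even part and the
`1/√π` of the kernel. -/
theorem ecalleIntegrand_borelFn (φ : ℂ → ℂ) (θ : ℝ) (τ z : ℂ) (ξ : ℝ) :
    ecalleIntegrand 1 θ (borelFn φ) τ z ξ =
      logForm (heatForm φ τ z) (ξ + θ * Complex.I) * (1 / (2 * Real.sqrt Real.pi : ℂ)) := by
  have hk : ((1 / (1 + 1) : ℝ) : ℂ) = 1 / 2 := by push_cast; norm_num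
  rw [ecalleIntegrand, ecalleKernel_one, hk, logForm, heatForm, borelFn]
  have e1 : (1 / 2 : ℂ) * (ξ + θ * Complex.I) = (ξ + θ * Complex.I) / 2 := by ring
  have e2 : -Complex.exp (1 / 2 * (ξ + θ * Complex.I - τ)) ^ 2 / 4 =
      -Complex.exp ((ξ + θ * Complex.I) / 2) ^ 2 / (4 * Complex.exp τ) := by
    have h : Complex.exp ((ξ + θ * Complex.I) / 2) ^ 2 =
        Complex.exp (1 / 2 * (ξ + θ * Complex.I - τ)) ^ 2 * Complex.exp τ := by
      rw [← Complex.exp_nat_mul, ← Complex.exp_nat_mul, ← Complex.exp_add]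
      congr 1
      push_cast
      ring
    rw [h]
    have := Complex.exp_ne_zero τ
    field_simp
  rw [e1, e2]
  ring

theorem sqrt_four_mul_pi : Real.sqrt (4 * Real.pi) = 2 * Real.sqrt Real.pi := by
  rw [Real.sqrt_mul (by norm_num), show (4 : ℝ) = 2 ^ 2 by norm_num, Real.sqrt_sq (by norm_num)]

theorem ecalle_borelFn (φ : ℂ → ℂ) (θ : ℝ) (τ z : ℂ) :
    ecalle 1 θ (borelFn φ) τ z = heatIntegral φ θ τ z := by
  have hk : ((1 / (1 + 1) : ℝ) : ℂ) = 1 / 2 := by push_cast; norm_num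
  rw [ecalle, heatIntegral_eq, rayIntegral_eq_integral_logForm]
  simp_rw [ecalleIntegrand_borelFn]
  rw [integral_mul_const, hk, sqrt_four_mul_pi, Complex.exp_neg,
    show (1 / 2 : ℂ) * τ = τ / 2 by ring, Complex.ofReal_mul, Complex.ofReal_ofNat]
  have := Complex.exp_ne_zero (τ / 2)
  field_simp

theorem integrable_ecalleIntegrand_iff (φ : ℂ → ℂ) (θ : ℝ) (τ z : ℂ) :
    Integrable (ecalleIntegrand 1 θ (borelFn φ) τ z) ↔
      IntegrableOn (heatIntegrand φ θ τ z) (Ioi 0) := by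
  have h : ecalleIntegrand 1 θ (borelFn φ) τ z = fun ξ : ℝ =>
      logForm (heatForm φ τ z) (ξ + θ * Complex.I) * (1 / (2 * Real.sqrt Real.pi : ℂ)) :=
    funext (ecalleIntegrand_borelFn φ θ τ z)
  have h' : heatIntegrand φ θ τ z = fun x : ℝ =>
      heatForm φ τ z (ray θ x) * Complex.exp (θ / 2 * Complex.I) := rfl
  rw [h, h', integrableOn_ray_iff]
  refine ⟨fun hi => ?_, fun hi => hi.mul_const _⟩
  have hpi : (Real.sqrt Real.pi : ℂ) ≠ 0 :=
    Complex.ofReal_ne_zero.2 (Real.sqrt_pos.2 Real.pi_pos).ne'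
  have := hi.mul_const (2 * Real.sqrt Real.pi : ℂ)
  refine this.congr (Eventually.of_forall fun ξ => ?_)
  simp only
  field_simp

/-! ### The formal solution and its Borel transform -/

theorem IsFormalSolution.mono {φ : ℂ → ℂ} {û : ℕ → ℂ → ℂ} {ρ ρ' : ℝ}
    (h : IsFormalSolution φ û ρ) (hρ : ρ' ≤ ρ) : IsFormalSolution φ û ρ' :=
  ⟨fun n => (h.1 n).mono (Metric.ball_subset_ball hρ),
    fun z hz => h.2.1 z (Metric.ball_subset_ball hρ hz),
    fun n z hz => h.2.2 n z (Metric.ball_subset_ball hρ hz)⟩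

theorem IsFormalSolution.eq {φ : ℂ → ℂ} {û : ℕ → ℂ → ℂ} {ρ : ℝ} (h : IsFormalSolution φ û ρ)
    (n : ℕ) : ∀ z ∈ Metric.ball (0 : ℂ) ρ,
      û n z = iteratedDeriv (2 * n) φ z / (n.factorial : ℂ) := by
  induction n with
  | zero => intro z hz; simpa using h.2.1 z hz
  | succ n ih =>
    intro z hz
    have h1 := h.2.2 n z hz
    have h2 : û n =ᶠ[𝓝 z] fun w => (n.factorial : ℂ)⁻¹ * iteratedDeriv (2 * n) φ w := by
      filter_upwards [Metric.isOpen_ball.mem_nhds hz] with w hw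
      rw [ih w hw, div_eq_inv_mul]
    have h3 : iteratedDeriv 2 (û n) z =
        (n.factorial : ℂ)⁻¹ * iteratedDeriv (2 * (n + 1)) φ z := by
      rw [h2.iteratedDeriv_eq, iteratedDeriv_succ, iteratedDeriv_one]
      simp_rw [deriv_const_mul_field']
      rw [show 2 * (n + 1) = 2 * n + 1 + 1 by ring, iteratedDeriv_succ,
        iteratedDeriv_succ]
    rw [h3] at h1
    have h4 : ((n : ℂ) + 1) ≠ 0 := Nat.cast_add_one_ne_zero n
    have h5 : (n.factorial : ℂ) ≠ 0 := Nat.cast_ne_zero.2 n.factorial_ne_zero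
    rw [Nat.factorial_succ, eq_div_iff (by push_cast; positivity)]
    push_cast
    calc û (n + 1) z * ((n + 1) * n.factorial) = ((n + 1) * û (n + 1) z) * n.factorial := by ring
      _ = _ := by rw [h1]; field_simp

theorem borelCoeff_one {φ : ℂ → ℂ} {û : ℕ → ℂ → ℂ} {ρ : ℝ} (h : IsFormalSolution φ û ρ)
    (n : ℕ) {z : ℂ} (hz : z ∈ Metric.ball (0 : ℂ) ρ) :
    borelCoeff 1 û n z = iteratedDeriv (2 * n) φ z / ((2 * n).factorial : ℂ) := by
  have h5 : (n.factorial : ℂ) ≠ 0 := Nat.cast_ne_zero.2 n.factorial_ne_zero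
  have e : (1 + n * (1 + 1 / 1) : ℝ) = ((2 * n : ℕ) : ℝ) + 1 := by push_cast; ring
  rw [borelCoeff, h.eq n z hz, e, Real.Gamma_nat_eq_factorial, div_mul_cancel₀ _ h5]
  norm_cast

/-- Averaging the Taylor series at `z` evaluated at `z + s` and `z - s`, with `s = e^{σ/2}`, cancels
the odd powers; the even ones are powers of `s² = e^σ`. -/
theorem hasSum_borelCoeff {φ : ℂ → ℂ} {û : ℕ → ℂ → ℂ} {ρ : ℝ} (h : IsFormalSolution φ û ρ)
    {z : ℂ} (hz : z ∈ Metric.ball (0 : ℂ) ρ) {R : ℝ} (hd : DifferentiableOn ℂ φ (Metric.ball z R))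
    {σ : ℂ} (hσ : Real.exp (σ.re / 2) < R) :
    HasSum (fun n : ℕ => borelCoeff 1 û n z * Complex.exp (n * σ)) (borelFn φ σ z) := by
  set s := Complex.exp (σ / 2) with hs
  have hsn : ‖s‖ < R := by
    rw [hs, Complex.norm_exp]
    simpa using hσ
  have h1 := Complex.hasSum_taylorSeries_on_ball hd (z := z + s) (by simpa [dist_eq_norm] using hsn)
  have h2 := Complex.hasSum_taylorSeries_on_ball hd (z := z - s) (by simpa [dist_eq_norm] using hsn)
  have h3 := (h1.add h2).div_const 2
  have hinj : Function.Injective fun m : ℕ => 2 * m := fun p q h => by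
    simp only at h; omega
  rw [← hinj.hasSum_iff] at h3
  · rw [borelFn, ← hs]
    refine h3.congr_fun ?_ |> fun h => h
    intro m
    simp only [Function.comp, smul_eq_mul]
    rw [borelCoeff_one h m hz]
    have e : Complex.exp (m * σ) = s ^ (2 * m) := by
      rw [hs, ← Complex.exp_nat_mul]
      congr 1
      push_cast
      ring
    have e1 : z + s - z = s := by ring
    have e2 : z - s - z = -s := by ring
    rw [e, e1, e2, Even.neg_pow (even_two_mul m)]
    ring
  · intro k hk
    rcases Nat.even_or_odd' k with ⟨l, rfl | rfl⟩
    · exact absurd ⟨l, rfl⟩ hk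
    · have e1 : z + s - z = s := by ring
      have e2 : z - s - z = -s := by ring
      simp only [e1, e2, smul_eq_mul]
      rw [Odd.neg_pow (odd_two_mul_add_one l)]
      ring

/-- Cauchy's estimate on circles of radius `ρ` bounds `φ^{(2n)}` by `(2n)! M / ρ^{2n}`, and one of
the two factorials in `(2n)! ≤ 4^n n! n!` is divided out. -/
theorem isGevrey_one {φ : ℂ → ℂ} {û : ℕ → ℂ → ℂ} {ρ : ℝ} (h : IsFormalSolution φ û ρ)
    (hρ : 0 < ρ) (hd : DifferentiableOn ℂ φ (Metric.ball 0 (3 * ρ))) : IsGevrey (1 / 1) û ρ := by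
  have hcont : ContinuousOn φ (Metric.closedBall 0 (2 * ρ)) :=
    hd.continuousOn.mono (Metric.closedBall_subset_ball (by linarith))
  obtain ⟨M, hM⟩ := (isCompact_closedBall (0 : ℂ) (2 * ρ)).exists_bound_of_continuousOn hcont
  have hM0 : 0 ≤ M := (norm_nonneg _).trans (hM 0 (Metric.mem_closedBall_self (by linarith)))
  refine ⟨M + 1, 4 / ρ ^ 2, by linarith, by positivity, fun n z hz => ?_⟩
  have hsub : Metric.closedBall z ρ ⊆ Metric.closedBall 0 (2 * ρ) := by
    intro w hw
    rw [Metric.mem_ball] at hz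
    rw [Metric.mem_closedBall] at hw ⊢
    linarith [dist_triangle w z 0]
  have h1 := Complex.norm_iteratedDeriv_le_of_forall_mem_sphere_norm_le (f := φ) (c := z)
    (2 * n) hρ ((hd.mono (hsub.trans (Metric.closedBall_subset_ball
      (by linarith)))).diffContOnCl_ball Subset.rfl)
    fun w hw => hM w (hsub (Metric.sphere_subset_closedBall hw))
  rw [h.eq n z hz, norm_div, Complex.norm_natCast, div_one, Real.rpow_one,
    div_le_iff₀ (by positivity)]
  -- From `(2n)! = C(2n, n) (n!)²` and `C(2n, n) ≤ 2^{2n}`.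
  have h2 : ((2 * n).factorial : ℝ) ≤ 4 ^ n * n.factorial * n.factorial := by
    have h3 := Nat.choose_mul_factorial_mul_factorial (n := 2 * n) (k := n) (by omega)
    have h4 : (2 * n).choose n ≤ 4 ^ n := by
      have := Nat.choose_le_two_pow (2 * n) n
      rwa [pow_mul] at this
    rw [show 2 * n - n = n by omega] at h3
    rw [← h3]
    push_cast
    gcongr
    exact_mod_cast h4
  refine h1.trans ?_
  rw [div_pow, ← pow_mul]
  calc ((2 * n).factorial : ℝ) * M / ρ ^ (2 * n)
      ≤ (4 ^ n * n.factorial * n.factorial) * (M + 1) / ρ ^ (2 * n) := by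
        gcongr
        linarith
    _ = _ := by ring

/-! ### Sectors -/

theorem mem_sector_coe {d α r : ℝ} {τ : ℂ} :
    τ ∈ sector d α (r : EReal) ↔ Real.exp τ.re < r ∧ |τ.im - d| < α / 2 := by
  simp [sector]

theorem mem_sector_top {d α : ℝ} {τ : ℂ} : τ ∈ sector d α ⊤ ↔ |τ.im - d| < α / 2 := by
  simp [sector, EReal.coe_lt_top]

theorem isOpen_sector (d α : ℝ) (R : EReal) : IsOpen (sector d α R) := by
  have h1 : Continuous fun τ : ℂ => ((Real.exp τ.re : ℝ) : EReal) :=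
    continuous_coe_real_ereal.comp (Real.continuous_exp.comp Complex.continuous_re)
  have h2 : Continuous fun τ : ℂ => |τ.im - d| := (Complex.continuous_im.sub continuous_const).abs
  exact (isOpen_Iio.preimage h1).inter (isOpen_Iio.preimage h2)

/-- In the logarithmic coordinate a nonempty sector is a strip or a half-strip. Intersections of
sectors are then convex, hence connected, as the identity theorem requires. -/
theorem convex_sector (d α : ℝ) (R : EReal) : Convex ℝ (sector d α R) := by
  intro x hx y hy s t hs ht hst
  have hre : (s • x + t • y).re = s * x.re + t * y.re := by simp
  have him : (s • x + t • y).im = s * x.im + t * y.im := by simp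
  constructor
  · rw [hre]
    have h1 : s * x.re + t * y.re ≤ max x.re y.re := by
      have := mul_le_mul_of_nonneg_left (le_max_left x.re y.re) hs
      have := mul_le_mul_of_nonneg_left (le_max_right x.re y.re) ht
      have e : max x.re y.re = s * max x.re y.re + t * max x.re y.re := by
        rw [← add_mul, hst, one_mul]
      linarith
    rcases le_total x.re y.re with h | h
    · rw [max_eq_right h] at h1
      exact lt_of_le_of_lt (EReal.coe_le_coe_iff.2 (Real.exp_le_exp.2 h1)) hy.1
    · rw [max_eq_left h] at h1
      exact lt_of_le_of_lt (EReal.coe_le_coe_iff.2 (Real.exp_le_exp.2 h1)) hx.1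
  · rw [him]
    have h1 := abs_lt.1 hx.2
    have h2 := abs_lt.1 hy.2
    rw [abs_lt]
    have e : s * x.im + t * y.im - d = s * (x.im - d) + t * (y.im - d) := by
      linear_combination d * hst
    rw [e]
    have e2 : α / 2 = s * (α / 2) + t * (α / 2) := by rw [← add_mul, hst, one_mul]
    rcases hs.eq_or_lt with rfl | hs'
    · have : t = 1 := by linarith
      subst this
      constructor <;> linarith
    · constructor
      · nlinarith [mul_lt_mul_of_pos_left h1.1 hs', mul_le_mul_of_nonneg_left h2.1.le ht]
      · nlinarith [mul_lt_mul_of_pos_left h1.2 hs', mul_le_mul_of_nonneg_left h2.2.le ht]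

theorem sector_mono {d α α' : ℝ} {R R' : EReal} (hα : α ≤ α') (hR : R ≤ R') :
    sector d α R ⊆ sector d α' R' := fun _ h => ⟨h.1.trans_le hR, h.2.trans_le (by linarith)⟩

theorem exp_half_eq_ray (σ : ℂ) : Complex.exp (σ / 2) = ray σ.im (Real.exp (σ.re / 2)) := by
  rw [ray_exp_half, Complex.re_add_im]

theorem borelFn_differentiableAt {φ : ℂ → ℂ} {σ z : ℂ}
    (h1 : DifferentiableAt ℂ φ (z + Complex.exp (σ / 2)))
    (h2 : DifferentiableAt ℂ φ (z - Complex.exp (σ / 2))) :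
    DifferentiableAt ℂ (fun p : ℂ × ℂ => borelFn φ p.1 p.2) (σ, z) := by
  unfold borelFn
  refine DifferentiableAt.fun_mul (DifferentiableAt.add ?_ ?_) (differentiableAt_const (2 : ℂ)⁻¹)
  · exact DifferentiableAt.comp (σ, z) (f := fun p : ℂ × ℂ => p.2 + Complex.exp (p.1 / 2)) h1
      (by fun_prop)
  · exact DifferentiableAt.comp (σ, z) (f := fun p : ℂ × ℂ => p.2 - Complex.exp (p.1 / 2)) h2
      (by fun_prop)

theorem ConeBound.sub {φ : ℂ → ℂ} {c η ρ A B : ℝ} (h : ConeBound φ c η ρ A B) {z : ℂ}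
    (hz : z ∈ Metric.ball (0 : ℂ) ρ) {θ : ℝ} (hθ : θ ∈ Icc (c + η) (c + 2 * Real.pi - η)) (x : ℝ) :
    DifferentiableAt ℂ φ (z - ray θ x) ∧ ‖φ (z - ray θ x)‖ ≤ A * Real.exp (B * x ^ 2) := by
  have := h z hz θ hθ (-x)
  rwa [ray_neg, neg_sq, ← sub_eq_add_neg] at this

theorem isBorelContinuation_borelFn {φ : ℂ → ℂ} {û : ℕ → ℂ → ℂ} {c η ρ A B d ε : ℝ}
    (hû : IsFormalSolution φ û ρ) (hρ : 0 < ρ) (hA : 0 < A) (hB : 0 < B)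
    (hd : DifferentiableOn ℂ φ (Metric.ball 0 (3 * ρ))) (hcone : ConeBound φ c η ρ A B)
    (h1 : c + η ≤ d - ε / 2) (h2 : d + ε / 2 ≤ c + 2 * Real.pi - η) :
    IsBorelContinuation 1 d û ε ρ (borelFn φ) := by
  have hθ : ∀ σ ∈ sector d ε ⊤, σ.im ∈ Icc (c + η) (c + 2 * Real.pi - η) := by
    intro σ hσ
    have := abs_lt.1 (mem_sector_top.1 hσ)
    constructor <;> linarith
  refine ⟨isGevrey_one hû hρ hd, ⟨?_, fun T hT => ⟨A, B, hA, hB, fun σ hσ z hz => ?_⟩⟩,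
    -- `φ` is holomorphic in the disc of radius `ρ` about `z`, so the Borel transform converges for
    -- `|√s| < ρ`.
    ρ ^ 2, by positivity, fun σ hσ z hz => ?_⟩
  · rintro ⟨σ, z⟩ ⟨hσ, hz⟩
    refine (borelFn_differentiableAt ?_ ?_).differentiableWithinAt
    · rw [exp_half_eq_ray]
      exact (hcone z hz _ (hθ σ hσ) _).1
    · rw [exp_half_eq_ray]
      exact (hcone.sub hz (hθ σ hσ) _).1
  · obtain ⟨_, _, _, _, _, _, hcl⟩ := hT
    have hσ' := hθ σ (hcl (subset_closure hσ))
    have h3 := (hcone z hz _ hσ' (Real.exp (σ.re / 2))).2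
    have h4 := (hcone.sub hz hσ' (Real.exp (σ.re / 2))).2
    have e : Real.exp (σ.re / 2) ^ 2 = Real.exp σ.re := by
      rw [← Real.exp_nat_mul]; congr 1; push_cast; ring
    -- Growth of order `2` in `√s` becomes growth of order `1` in `s`.
    rw [e] at h3 h4
    rw [borelFn, exp_half_eq_ray, norm_div, Real.rpow_one, Complex.norm_ofNat]
    linarith [norm_add_le (φ (z + ray σ.im (Real.exp (σ.re / 2))))
      (φ (z - ray σ.im (Real.exp (σ.re / 2))))]
  · have h3 := (mem_sector_coe.1 hσ).1
    refine hasSum_borelCoeff hû hz (R := ρ) (hd.mono ?_) ?_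
    · intro w hw
      rw [Metric.mem_ball] at hw hz ⊢
      linarith [dist_triangle w z 0]
    · rw [← abs_of_pos (Real.exp_pos (σ.re / 2)), ← abs_of_pos hρ, ← sq_lt_sq,
        ← Real.exp_nat_mul, show ((2 : ℕ) : ℝ) * (σ.re / 2) = σ.re by push_cast; ring]
      exact h3

theorem HolomorphicOn.slice {u : ℂ → ℂ → ℂ} {U : Set ℂ} {ρ : ℝ} (h : HolomorphicOn u U ρ)
    {z : ℂ} (hz : z ∈ Metric.ball (0 : ℂ) ρ) : DifferentiableOn ℂ (fun τ => u τ z) U := by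
  have : DifferentiableOn ℂ (fun τ : ℂ => (τ, z)) U := by fun_prop
  exact DifferentiableOn.comp h this fun τ hτ => ⟨hτ, hz⟩

theorem HolomorphicOn.slice_right {u : ℂ → ℂ → ℂ} {U : Set ℂ} {ρ : ℝ} (h : HolomorphicOn u U ρ)
    {τ : ℂ} (hτ : τ ∈ U) : DifferentiableOn ℂ (fun z => u τ z) (Metric.ball 0 ρ) := by
  have : DifferentiableOn ℂ (fun z : ℂ => (τ, z)) (Metric.ball 0 ρ) := by fun_prop
  exact DifferentiableOn.comp (g := fun p : ℂ × ℂ => u p.1 p.2) h this fun z hz => ⟨hτ, hz⟩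

theorem HolomorphicOn.mono {u : ℂ → ℂ → ℂ} {U U' : Set ℂ} {ρ ρ' : ℝ} (h : HolomorphicOn u U ρ)
    (hU : U' ⊆ U) (hρ : ρ' ≤ ρ) : HolomorphicOn u U' ρ' :=
  DifferentiableOn.mono h (prod_mono hU (Metric.ball_subset_ball hρ))

/-- The identity theorem on convex open sets. -/
theorem eqOn_of_eqOn_open {f g : ℂ → ℂ} {U O : Set ℂ} (hU : IsOpen U) (hUc : Convex ℝ U)
    (hf : DifferentiableOn ℂ f U) (hg : DifferentiableOn ℂ g U) (hO : IsOpen O)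
    (hne : (O ∩ U).Nonempty) (h : ∀ w ∈ O ∩ U, f w = g w) : EqOn f g U := by
  obtain ⟨w, hw⟩ := hne
  refine (hf.analyticOnNhd hU).eqOn_of_preconnected_of_eventuallyEq (hg.analyticOnNhd hU)
    hUc.isPreconnected hw.2 ?_
  filter_upwards [(hO.inter hU).mem_nhds hw] with v hv using h v hv

theorem exists_mem_sector {d α : ℝ} (x : ℝ) {y : ℝ} (hy : |y - d| < α / 2) {R : ℝ}
    (hR : 0 < R) : ∃ τ ∈ sector d α (R : EReal), τ.re < x ∧ τ.im = y := by
  refine ⟨⟨min (x - 1) (Real.log R - 1), y⟩, mem_sector_coe.2 ⟨?_, hy⟩, ?_, rfl⟩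
  · rw [← Real.lt_log_iff_exp_lt hR]
    exact lt_of_le_of_lt (min_le_right _ _) (by linarith)
  · exact lt_of_le_of_lt (min_le_left _ _) (by linarith)

/-- Uniqueness of the continuation of the Borel transform. -/
theorem IsBorelContinuation.eqOn {û : ℕ → ℂ → ℂ} {k d ε ε' ρ ρ' : ℝ} {g g' : ℂ → ℂ → ℂ}
    (h : IsBorelContinuation k d û ε ρ g) (h' : IsBorelContinuation k d û ε' ρ' g')
    (hε : 0 < ε) (hε' : 0 < ε') {z : ℂ} (hz : z ∈ Metric.ball (0 : ℂ) ρ)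
    (hz' : z ∈ Metric.ball (0 : ℂ) ρ') :
    ∀ σ ∈ sector d (min ε ε') ⊤, g σ z = g' σ z := by
  obtain ⟨-, ⟨h1, -⟩, r₀, hr₀, h2⟩ := h
  obtain ⟨-, ⟨h1', -⟩, r₀', hr₀', h2'⟩ := h'
  have hm : 0 < min ε ε' := lt_min hε hε'
  refine eqOn_of_eqOn_open (O := sector d (min ε ε') ((min r₀ r₀' : ℝ) : EReal))
    (isOpen_sector _ _ _) (convex_sector _ _ _)
    ((h1.slice hz).mono (sector_mono (min_le_left _ _) le_rfl))
    ((h1'.slice hz').mono (sector_mono (min_le_right _ _) le_rfl)) (isOpen_sector _ _ _) ?_ ?_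
  · obtain ⟨τ, hτ, -⟩ := exists_mem_sector (d := d) (α := min ε ε') 0 (y := d) (by rw [sub_self, abs_zero]; linarith)
      (lt_min hr₀ hr₀')
    exact ⟨τ, hτ, sector_mono le_rfl le_top hτ⟩
  · rintro σ ⟨hσ, -⟩
    have e1 := h2 σ (sector_mono (min_le_left _ _) (EReal.coe_le_coe_iff.2 (min_le_left _ _)) hσ)
      z hz
    have e2 := h2' σ (sector_mono (min_le_right _ _) (EReal.coe_le_coe_iff.2 (min_le_right _ _)) hσ)
      z hz'
    exact e1.unique e2


/-! ### Singular directions -/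

namespace IsPolar

variable {n : ℕ} {a : ℤ → ℂ} {z₀ : ℂ} {δ : ℝ} {ψ φ : ℂ → ℂ} {û : ℕ → ℂ → ℂ} {ρ₀ : ℝ}

theorem summableInDir_of_mem_Ioo (h : IsPolar n a z₀ δ ψ φ) (hρ₀ : 0 < ρ₀)
    (hû : IsFormalSolution φ û ρ₀) {c d : ℝ} {m : ℤ} (hc : c = δ + 2 * Real.pi * m)
    (hd : d ∈ Ioo c (c + 2 * Real.pi)) : SummableInDir 1 d û := by
  -- The distance from `d` to the nearest singular direction. The sector of opening `l` about `d`
  -- uses half of it and leaves the margin `l / 2`.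
  set l := min (d - c) (c + 2 * Real.pi - d) with hl_def
  have hl1 : l ≤ d - c := min_le_left _ _
  have hl2 : l ≤ c + 2 * Real.pi - d := min_le_right _ _
  have hl : 0 < l := lt_min (by linarith [hd.1]) (by linarith [hd.2])
  obtain ⟨ρ, A, B, hρ, hρR, hA, hB, hcone⟩ := h.hasConeBounds hc (l / 2) (min ρ₀ (‖z₀‖ / 3))
    (by linarith) (by linarith [Real.pi_pos]) (lt_min hρ₀ (by linarith [h.norm_pos]))
  refine ⟨l, ρ, hl, hρ, borelFn φ, isBorelContinuation_borelFn
    (hû.mono (hρR.trans (min_le_left _ _))) hρ hA hB (h.differentiableOn_ball.mono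
      (Metric.ball_subset_ball ?_)) hcone (by linarith) (by linarith)⟩
  linarith [hρR.trans (min_le_right _ _)]

theorem exp_half_mul_I (m : ℤ) :
    Complex.exp (((δ + 2 * Real.pi * m : ℝ) : ℂ) / 2 * Complex.I) =
      (-1) ^ m * Complex.exp ((δ / 2 : ℝ) * Complex.I) := by
  rw [← Complex.exp_pi_mul_I, ← Complex.exp_int_mul, ← Complex.exp_add]
  congr 1
  push_cast
  ring

theorem ray_eq (h : IsPolar n a z₀ δ ψ φ) (m : ℤ) (t : ℝ) :
    ray (δ + 2 * Real.pi * m) (t * ‖z₀‖) = (-1) ^ m * (t * z₀) := by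
  rw [ray, exp_half_mul_I]
  conv_rhs => rw [h.polar]
  push_cast
  ring

/-- Over `z = 0` a continuation `g` must agree with the explicit transform for `|s| < |z₀|²`, by the
identity theorem. As `s → z₀²` along the singular ray, `g` converges and one of the two values
`φ(±√s)` converges to `φ(-z₀)`, so the other would have to stay bounded. But its argument tends to
the pole `z₀`. -/
theorem not_summableInDir (h : IsPolar n a z₀ δ ψ φ) (hρ₀ : 0 < ρ₀)
    (hû : IsFormalSolution φ û ρ₀) (m : ℤ) : ¬ SummableInDir 1 (δ + 2 * Real.pi * m) û := by
  rintro ⟨ε, ρ, hε, hρ, g, -, ⟨hg, -⟩, r₀, hr₀, hsum⟩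
  set d := δ + 2 * Real.pi * m with hd
  have hz := h.norm_pos
  have hexp : ∀ σ ∈ sector d ε ((‖z₀‖ ^ 2 : ℝ) : EReal), Real.exp (σ.re / 2) < ‖z₀‖ := by
    intro σ hσ
    have := (mem_sector_coe.1 hσ).1
    rw [← abs_of_pos (Real.exp_pos (σ.re / 2)), ← abs_of_pos hz, ← sq_lt_sq,
        ← Real.exp_nat_mul, show ((2 : ℕ) : ℝ) * (σ.re / 2) = σ.re by push_cast; ring]
    exact this
  have hEq : EqOn (fun σ => g σ 0) (fun σ => borelFn φ σ 0)
      (sector d ε ((‖z₀‖ ^ 2 : ℝ) : EReal)) := by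
    refine eqOn_of_eqOn_open (O := sector d ε (r₀ : EReal)) (isOpen_sector _ _ _)
      (convex_sector _ _ _) ((hg.slice (Metric.mem_ball_self hρ)).mono (sector_mono le_rfl le_top))
      ?_ (isOpen_sector _ _ _) ?_ ?_
    · intro σ hσ
      have h1 : ‖Complex.exp (σ / 2)‖ < ‖z₀‖ := by
        rw [Complex.norm_exp]
        simpa using hexp σ hσ
      refine (DifferentiableAt.comp σ (f := fun σ : ℂ => (σ, (0 : ℂ)))
        (borelFn_differentiableAt (h.differentiableAt ?_) (h.differentiableAt ?_))
        (by fun_prop)).differentiableWithinAt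
      · intro e
        rw [← e] at h1
        simp at h1
      · intro e
        rw [← e] at h1
        simp at h1
    · obtain ⟨τ, hτ, -⟩ := exists_mem_sector (d := d) (α := ε) 0 (y := d)
        (by rw [sub_self, abs_zero]; linarith) (lt_min hr₀ (pow_pos hz 2))
      exact ⟨τ, sector_mono le_rfl (EReal.coe_le_coe_iff.2 (min_le_left _ _)) hτ,
        sector_mono le_rfl (EReal.coe_le_coe_iff.2 (min_le_right _ _)) hτ⟩
    · rintro σ ⟨h1, h2⟩
      refine (hsum σ h1 0 (Metric.mem_ball_self hρ)).unique (hasSum_borelCoeff hû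
        (Metric.mem_ball_self hρ₀) h.differentiableOn_ball (hexp σ h2))
  -- The logarithmic coordinate of `s = (t‖z₀‖)² e^{id}`, whose square root is `t z₀` or `-t z₀`.
  let S : ℝ → ℂ := fun t => ((2 * Real.log (t * ‖z₀‖) : ℝ) : ℂ) + d * Complex.I
  have hSre : ∀ t, (S t).re = 2 * Real.log (t * ‖z₀‖) := fun t => by simp [S]
  have hSim : ∀ t, (S t).im = d := fun t => by simp [S]
  have hlim1 : Tendsto (fun t => g (S t) 0) (𝓝[<] 1) (𝓝 (g (S 1) 0)) := by
    have h1 : ContinuousAt (fun σ => g σ 0) (S 1) := by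
      refine ((hg.slice (Metric.mem_ball_self hρ)).differentiableAt
        ((isOpen_sector _ _ _).mem_nhds ?_)).continuousAt
      rw [mem_sector_top, hSim, sub_self, abs_zero]
      linarith
    have h2 : ContinuousAt S 1 := by
      have : ContinuousAt (fun t : ℝ => 2 * Real.log (t * ‖z₀‖)) 1 := by
        refine ContinuousAt.mul continuousAt_const (ContinuousAt.log (by fun_prop) ?_)
        rw [one_mul]; exact hz.ne'
      exact (Complex.continuous_ofReal.continuousAt.comp this).add continuousAt_const
    exact (ContinuousAt.comp h1 h2).tendsto.mono_left nhdsWithin_le_nhds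
  have hlim2 : Tendsto (fun t : ℝ => φ (-(t * z₀))) (𝓝[<] 1) (𝓝 (φ (-((1 : ℝ) * z₀)))) := by
    have h1 : ContinuousAt φ (-((1 : ℝ) * z₀)) := by
      refine (h.differentiableAt fun e => h.ne_zero ?_).continuousAt
      rw [Complex.ofReal_one, one_mul] at e
      exact self_eq_neg.1 e.symm
    have h2 : ContinuousAt (fun t : ℝ => -((t : ℂ) * z₀)) 1 := by fun_prop
    exact (ContinuousAt.comp (f := fun t : ℝ => -((t : ℂ) * z₀)) h1 h2).tendsto.mono_left
      nhdsWithin_le_nhds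
  have hlim3 : Tendsto (fun t : ℝ => ‖φ (t * z₀)‖) (𝓝[<] 1) atTop := by
    refine h.tendsto_norm.comp (tendsto_nhdsWithin_iff.2 ⟨?_, ?_⟩)
    · have : Tendsto (fun t : ℝ => (t : ℂ) * z₀) (𝓝 1) (𝓝 ((1 : ℝ) * z₀)) :=
        Continuous.tendsto (by fun_prop) 1
      rw [Complex.ofReal_one, one_mul] at this
      exact this.mono_left nhdsWithin_le_nhds
    · filter_upwards [self_mem_nhdsWithin] with t ht
      intro e
      have : ((t : ℂ) - 1) * z₀ = 0 := by rw [sub_mul, one_mul, sub_eq_zero]; exact e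
      rcases mul_eq_zero.1 this with h1 | h1
      · have : (t : ℂ) = (1 : ℝ) := by rw [Complex.ofReal_one]; exact sub_eq_zero.1 h1
        exact (ne_of_lt ht) (Complex.ofReal_injective this)
      · exact h.ne_zero h1
  -- For `t < 1` one has `2 g(S t) - φ(-t z₀) = φ(t z₀)`; the left side converges and the right side
  -- is unbounded.
  refine not_tendsto_nhds_of_tendsto_atTop hlim3 _ (((hlim1.const_mul 2).sub hlim2).norm.congr' ?_)
  have hIoo : Ioo (0 : ℝ) 1 ∈ 𝓝[<] (1 : ℝ) := Ioo_mem_nhdsLT zero_lt_one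
  filter_upwards [hIoo] with t ht
  congr 1
  have htz : 0 < t * ‖z₀‖ := mul_pos ht.1 hz
  have hmem : S t ∈ sector d ε ((‖z₀‖ ^ 2 : ℝ) : EReal) := by
    rw [mem_sector_coe, hSim, hSre, sub_self, abs_zero]
    refine ⟨?_, by linarith⟩
    rw [two_mul, Real.exp_add, Real.exp_log htz, sq]
    have : t * ‖z₀‖ < ‖z₀‖ := by nlinarith [ht.2]
    exact mul_lt_mul this this.le htz hz.le
  have e := hEq hmem
  simp only at e
  rw [e, borelFn, exp_half_eq_ray, hSim, hSre, mul_div_cancel_left₀ _ (two_ne_zero),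
    Real.exp_log htz, hd, h.ray_eq]
  -- The parity of `m` decides which of `± t z₀` is the chosen root; the transform is symmetric in
  -- the two.
  rcases Int.even_or_odd m with hm | hm
  · rw [hm.neg_one_zpow]
    simp only [one_mul, zero_add, zero_sub]
    ring
  · rw [hm.neg_one_zpow]
    simp only [neg_mul, one_mul, zero_add, zero_sub, neg_neg]
    ring

theorem exists_mem_Ioo {d : ℝ} (hd : ∀ m : ℤ, d ≠ δ + 2 * Real.pi * m) :
    ∃ m : ℤ, d ∈ Ioo (δ + 2 * Real.pi * m) (δ + 2 * Real.pi * m + 2 * Real.pi) := by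
  have hpi := Real.pi_pos
  set m := ⌊(d - δ) / (2 * Real.pi)⌋ with hm
  have h1 : (m : ℝ) * (2 * Real.pi) ≤ d - δ := (le_div_iff₀ (by positivity)).1 (Int.floor_le _)
  have h2 : d - δ < (m + 1) * (2 * Real.pi) :=
    (div_lt_iff₀ (by positivity)).1 (Int.lt_floor_add_one _)
  exact ⟨m, lt_of_le_of_ne (by linarith) (hd m).symm, by linarith⟩

theorem summableInDir_iff (h : IsPolar n a z₀ δ ψ φ) (hρ₀ : 0 < ρ₀)
    (hû : IsFormalSolution φ û ρ₀) {d : ℝ} :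
    SummableInDir 1 d û ↔ ∀ m : ℤ, d ≠ δ + 2 * Real.pi * m := by
  constructor
  · rintro hs m rfl
    exact h.not_summableInDir hρ₀ hû m hs
  · intro hd
    obtain ⟨m, hm⟩ := exists_mem_Ioo hd
    exact h.summableInDir_of_mem_Ioo hρ₀ hû rfl hm

theorem isKSummable (h : IsPolar n a z₀ δ ψ φ) (hρ₀ : 0 < ρ₀)
    (hû : IsFormalSolution φ û ρ₀) : IsKSummable 1 û := by
  refine ⟨{δ}, fun d hd => ⟨δ, Finset.mem_singleton_self _, ?_⟩⟩
  rw [h.summableInDir_iff hρ₀ hû] at hd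
  push Not at hd
  exact hd

theorem isStokesLine_iff (h : IsPolar n a z₀ δ ψ φ) (hρ₀ : 0 < ρ₀)
    (hû : IsFormalSolution φ û ρ₀) {d : ℝ} :
    IsStokesLine 1 û d ↔ ∃ m : ℤ, d = δ + 2 * Real.pi * m := by
  constructor
  · rintro ⟨-, hd⟩
    rw [h.summableInDir_iff hρ₀ hû] at hd
    push Not at hd
    exact hd
  · rintro ⟨m, rfl⟩
    have hpi := Real.pi_pos
    -- The singular directions are spaced by `2π`, so the open interval of radius `2π` contains no
    -- other one.
    refine ⟨⟨2 * Real.pi, by positivity, fun d hd hne => ?_⟩, h.not_summableInDir hρ₀ hû m⟩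
    rw [h.summableInDir_iff hρ₀ hû]
    rintro l rfl
    have h1 : (m : ℝ) - 1 < l := by nlinarith [hd.1]
    have h2 : (l : ℝ) < m + 1 := by nlinarith [hd.2]
    have h3 : m - 1 < l := by exact_mod_cast h1
    have h4 : l < m + 1 := by exact_mod_cast h2
    have : l = m := by omega
    exact hne (by rw [this])

theorem exists_two_pi_iff (d δ : ℝ) : (∃ m : ℤ, d = δ + 2 * Real.pi * m) ↔
    ∃ m : ℤ, d = δ + 4 * Real.pi * m ∨ d = δ + 2 * Real.pi + 4 * Real.pi * m := by
  constructor
  · rintro ⟨m, rfl⟩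
    rcases Int.even_or_odd' m with ⟨k, rfl | rfl⟩
    · exact ⟨k, Or.inl (by push_cast; ring)⟩
    · exact ⟨k, Or.inr (by push_cast; ring)⟩
  · rintro ⟨m, rfl | rfl⟩
    · exact ⟨2 * m, by push_cast; ring⟩
    · exact ⟨2 * m + 1, by push_cast; ring⟩

theorem isAntiStokesLine_iff (h : IsPolar n a z₀ δ ψ φ) (hρ₀ : 0 < ρ₀)
    (hû : IsFormalSolution φ û ρ₀) {d : ℝ} : IsAntiStokesLine 1 û d ↔
      ∃ m : ℤ, (d = δ + Real.pi / 2 + 4 * Real.pi * m ∨ d = δ - Real.pi / 2 + 4 * Real.pi * m) ∨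
        (d = δ + 2 * Real.pi + Real.pi / 2 + 4 * Real.pi * m ∨
          d = δ + 2 * Real.pi - Real.pi / 2 + 4 * Real.pi * m) := by
  unfold IsAntiStokesLine
  simp_rw [h.isStokesLine_iff hρ₀ hû, exists_two_pi_iff]
  constructor
  · rintro ⟨_, ⟨m, rfl | rfl⟩, rfl | rfl⟩
    · exact ⟨m, Or.inl (Or.inl (by ring))⟩
    · exact ⟨m, Or.inl (Or.inr (by ring))⟩
    · exact ⟨m, Or.inr (Or.inl (by ring))⟩
    · exact ⟨m, Or.inr (Or.inr (by ring))⟩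
  · rintro ⟨m, (rfl | rfl) | (rfl | rfl)⟩
    · exact ⟨_, ⟨m, Or.inl rfl⟩, Or.inl (by ring)⟩
    · exact ⟨_, ⟨m, Or.inl rfl⟩, Or.inr (by ring)⟩
    · exact ⟨_, ⟨m, Or.inr rfl⟩, Or.inl (by ring)⟩
    · exact ⟨_, ⟨m, Or.inr rfl⟩, Or.inr (by ring)⟩

end IsPolar


/-! ### Gaussian bounds on rays -/

/-- A radius below which `e^{-s²/(4t)}` compensates `e^{B|s|²}` on rays within `π/2 - μ` of `t`. -/
noncomputable def kernelRadius (B μ : ℝ) : ℝ := Real.sin μ / (4 * (B + 1))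

/-- The ray `arg s = θ/2` is admissible for the point `t = exp τ`. -/
structure Admissible (c η μ B θ : ℝ) (τ : ℂ) : Prop where
  radius : Real.exp τ.re < kernelRadius B μ
  direction : θ ∈ Icc (c + η) (c + 2 * Real.pi - η)
  angle : |θ - τ.im| ≤ Real.pi / 2 - μ

theorem kernelRadius_pos {B μ : ℝ} (hB : 0 < B) (hμ : 0 < μ) (hμ' : μ < Real.pi) :
    0 < kernelRadius B μ :=
  div_pos (Real.sin_pos_of_pos_of_lt_pi hμ hμ') (by positivity)

/-- On the ray, `s²/t` has argument `θ - arg t`, so the Gaussian decays at a rate proportional to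
`cos(θ - arg t) / |t|`. -/
theorem gaussian_exponent (θ x : ℝ) (τ : ℂ) :
    -(ray θ x) ^ 2 / (4 * Complex.exp τ) = -(Complex.exp (θ * Complex.I - τ) / 4) * x ^ 2 := by
  have h : (ray θ x) ^ 2 = x ^ 2 * (Complex.exp (θ * Complex.I - τ) * Complex.exp τ) := by
    rw [ray, mul_pow, ← Complex.exp_nat_mul, ← Complex.exp_add]
    congr 2
    push_cast
    ring
  rw [h]
  have := Complex.exp_ne_zero τ
  field_simp

theorem re_exp_sub (θ : ℝ) (τ : ℂ) : (Complex.exp (θ * Complex.I - τ) / 4).re =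
    Real.exp (-τ.re) * Real.cos (θ - τ.im) / 4 := by
  rw [show (4 : ℂ) = ((4 : ℝ) : ℂ) by norm_num, Complex.div_ofReal_re, Complex.exp_re]
  simp

theorem sin_le_cos_of_abs_le {μ y : ℝ} (hμ : 0 < μ) (h : |y| ≤ Real.pi / 2 - μ) :
    Real.sin μ ≤ Real.cos y := by
  rw [← Real.cos_pi_div_two_sub, ← Real.cos_abs y]
  exact Real.cos_le_cos_of_nonneg_of_le_pi (abs_nonneg _) (by linarith [Real.pi_pos]) h

theorem norm_gaussian_le {θ μ : ℝ} {τ : ℂ} (hμ : 0 < μ) (h : |θ - τ.im| ≤ Real.pi / 2 - μ) (x : ℝ) :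
    ‖Complex.exp (-(ray θ x) ^ 2 / (4 * Complex.exp τ))‖ ≤
      Real.exp (-(Real.sin μ * Real.exp (-τ.re) / 4) * x ^ 2) := by
  rw [Complex.norm_exp, gaussian_exponent, ← Complex.ofReal_pow, Complex.re_mul_ofReal,
    Complex.neg_re, re_exp_sub]
  have h1 := sin_le_cos_of_abs_le hμ h
  have h2 := mul_le_mul_of_nonneg_left h1 (Real.exp_pos (-τ.re)).le
  refine Real.exp_le_exp.2 (mul_le_mul_of_nonneg_right ?_ (sq_nonneg x))
  linarith

/-- The right side is the guaranteed rate of decay of the Gaussian. It exceeds the growth rate `B`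
of `φ` by at least `1`, which leaves the majorant `e^{-x²}` in all later estimates. -/
theorem Admissible.le {c η μ B θ : ℝ} {τ : ℂ} (h : Admissible c η μ B θ τ) (hB : 0 < B) :
    B + 1 ≤ Real.sin μ * Real.exp (-τ.re) / 4 := by
  have h1 := h.radius
  rw [kernelRadius, lt_div_iff₀ (by positivity)] at h1
  have h2 := Real.exp_pos (-τ.re)
  have h3 : Real.exp τ.re * Real.exp (-τ.re) = 1 := by rw [← Real.exp_add]; simp
  nlinarith

theorem Admissible.norm_gaussian_le {c η μ B θ : ℝ} {τ : ℂ} (h : Admissible c η μ B θ τ)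
    (hB : 0 < B) (hμ : 0 < μ) (x : ℝ) :
    ‖Complex.exp (-(ray θ x) ^ 2 / (4 * Complex.exp τ))‖ ≤ Real.exp (-(B + 1) * x ^ 2) := by
  refine (Stokes.norm_gaussian_le hμ h.angle x).trans ?_
  have := h.le hB
  gcongr

theorem Admissible.norm_mul_gaussian_le {c η μ B θ : ℝ} {τ : ℂ} (h : Admissible c η μ B θ τ)
    (hB : 0 < B) (hμ : 0 < μ) {x A : ℝ} {w : ℂ} (hw : ‖w‖ ≤ A * Real.exp (B * x ^ 2)) :
    ‖w * Complex.exp (-(ray θ x) ^ 2 / (4 * Complex.exp τ))‖ ≤ A * Real.exp (-x ^ 2) := by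
  rw [norm_mul]
  calc _ ≤ (A * Real.exp (B * x ^ 2)) * Real.exp (-(B + 1) * x ^ 2) :=
        mul_le_mul hw (h.norm_gaussian_le hB hμ x) (norm_nonneg _) ((norm_nonneg _).trans hw)
    _ = _ := by
        rw [mul_assoc, ← Real.exp_add]
        congr 2
        ring

theorem exp_neg_sq_le (x : ℝ) : Real.exp (-x ^ 2) ≤ (1 + x ^ 2)⁻¹ := by
  rw [Real.exp_neg]
  gcongr
  linarith [Real.add_one_le_exp (x ^ 2)]

theorem ConeBound.add_bound {φ : ℂ → ℂ} {c η ρ A B : ℝ} (h : ConeBound φ c η ρ A B) {z : ℂ}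
    (hz : z ∈ Metric.ball (0 : ℂ) ρ) {θ : ℝ} (hθ : θ ∈ Icc (c + η) (c + 2 * Real.pi - η)) (x : ℝ) :
    ‖φ (z + ray θ x) + φ (z - ray θ x)‖ ≤ 2 * A * Real.exp (B * x ^ 2) := by
  have h1 := (h z hz θ hθ x).2
  have h2 := (h.sub hz hθ x).2
  linarith [norm_add_le (φ (z + ray θ x)) (φ (z - ray θ x))]

theorem norm_heatForm_le {φ : ℂ → ℂ} {c η ρ A B μ θ : ℝ} (hcone : ConeBound φ c η ρ A B)
    (hB : 0 < B) (hμ : 0 < μ) {τ z : ℂ} (h : Admissible c η μ B θ τ)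
    (hz : z ∈ Metric.ball (0 : ℂ) ρ) (x : ℝ) :
    ‖heatForm φ τ z (ray θ x)‖ ≤ 2 * A * Real.exp (-x ^ 2) :=
  h.norm_mul_gaussian_le hB hμ (hcone.add_bound hz h.direction x)

theorem differentiableAt_heatForm {φ : ℂ → ℂ} {τ z s : ℂ} (h1 : DifferentiableAt ℂ φ (z + s))
    (h2 : DifferentiableAt ℂ φ (z - s)) : DifferentiableAt ℂ (heatForm φ τ z) s := by
  unfold heatForm
  refine DifferentiableAt.fun_mul (DifferentiableAt.add ?_ ?_) (by fun_prop)
  · exact DifferentiableAt.comp s (f := fun s : ℂ => z + s) h1 (by fun_prop)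
  · exact DifferentiableAt.comp s (f := fun s : ℂ => z - s) h2 (by fun_prop)

theorem differentiableAt_heatForm_param {φ : ℂ → ℂ} {τ z s : ℂ}
    (h1 : DifferentiableAt ℂ φ (z + s)) (h2 : DifferentiableAt ℂ φ (z - s)) :
    DifferentiableAt ℂ (fun p : ℂ × ℂ => heatForm φ p.1 p.2 s) (τ, z) := by
  unfold heatForm
  refine DifferentiableAt.fun_mul (DifferentiableAt.add ?_ ?_) ?_
  · exact DifferentiableAt.comp (τ, z) (f := fun p : ℂ × ℂ => p.2 + s) h1 (by fun_prop)
  · exact DifferentiableAt.comp (τ, z) (f := fun p : ℂ × ℂ => p.2 - s) h2 (by fun_prop)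
  · have : ∀ p : ℂ × ℂ, 4 * Complex.exp p.1 ≠ 0 := fun p =>
      mul_ne_zero (by norm_num) (Complex.exp_ne_zero _)
    fun_prop (disch := exact this _)

theorem ConeBound.differentiableAt_heatForm {φ : ℂ → ℂ} {c η ρ A B θ : ℝ}
    (hcone : ConeBound φ c η ρ A B) {τ z : ℂ} (hz : z ∈ Metric.ball (0 : ℂ) ρ)
    (hθ : θ ∈ Icc (c + η) (c + 2 * Real.pi - η)) (x : ℝ) :
    DifferentiableAt ℂ (heatForm φ τ z) (ray θ x) :=
  Stokes.differentiableAt_heatForm (hcone z hz θ hθ x).1 (hcone.sub hz hθ x).1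

theorem integrableOn_heatIntegrand {φ : ℂ → ℂ} {c η ρ A B μ θ : ℝ}
    (hcone : ConeBound φ c η ρ A B) (hA : 0 < A) (hB : 0 < B) (hμ : 0 < μ) {τ z : ℂ}
    (h : Admissible c η μ B θ τ) (hz : z ∈ Metric.ball (0 : ℂ) ρ) :
    IntegrableOn (heatIntegrand φ θ τ z) (Ioi 0) := by
  refine integrableOn_ray_of_decay (f := heatForm φ τ z) (C := 2 * A)
    (fun x _ => (hcone.differentiableAt_heatForm hz h.direction x).continuousAt) fun x _ =>
      (norm_heatForm_le hcone hB hμ h hz x).trans ?_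
  exact mul_le_mul_of_nonneg_left (exp_neg_sq_le x) (by positivity)

/-- The directions admissible for a given `t` form an interval, so the contour can be rotated
through admissible rays only. -/
theorem heatIntegral_eq_of_le {φ : ℂ → ℂ} {c η ρ A B μ θ θ' : ℝ}
    (hcone : ConeBound φ c η ρ A B) (hA : 0 < A) (hB : 0 < B) (hμ : 0 < μ) {τ z : ℂ}
    (h : Admissible c η μ B θ τ) (h' : Admissible c η μ B θ' τ)
    (hz : z ∈ Metric.ball (0 : ℂ) ρ) (hle : θ ≤ θ') :
    heatIntegral φ θ τ z = heatIntegral φ θ' τ z := by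
  have hadm : ∀ β ∈ Icc θ θ', Admissible c η μ B β τ := fun β hβ =>
    ⟨h.radius, ⟨h.direction.1.trans hβ.1, hβ.2.trans h'.direction.2⟩, by
      have h1 := abs_le.1 h.angle
      have h2 := abs_le.1 h'.angle
      rw [abs_le]
      constructor <;> linarith [hβ.1, hβ.2]⟩
  rw [heatIntegral_eq, heatIntegral_eq, rayIntegral_eq_of_holomorphic hle (f := heatForm φ τ z)
    (C := 2 * A) (X := 1) (fun x _ β hβ => hcone.differentiableAt_heatForm hz (hadm β hβ).direction x)
    fun x hx β hβ => (norm_heatForm_le hcone hB hμ (hadm β hβ) hz x).trans ?_]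
  rw [div_eq_mul_inv]
  refine mul_le_mul_of_nonneg_left ((exp_neg_sq_le x).trans ?_) (by positivity)
  gcongr
  linarith

theorem heatIntegral_eq_of_admissible {φ : ℂ → ℂ} {c η ρ A B μ θ θ' : ℝ}
    (hcone : ConeBound φ c η ρ A B) (hA : 0 < A) (hB : 0 < B) (hμ : 0 < μ) {τ z : ℂ}
    (h : Admissible c η μ B θ τ) (h' : Admissible c η μ B θ' τ)
    (hz : z ∈ Metric.ball (0 : ℂ) ρ) :
    heatIntegral φ θ τ z = heatIntegral φ θ' τ z := by
  rcases le_total θ θ' with hle | hle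
  · exact heatIntegral_eq_of_le hcone hA hB hμ h h' hz hle
  · exact (heatIntegral_eq_of_le hcone hA hB hμ h' h hz hle).symm

/-! ### Holomorphy of the heat integral -/

/-- Differentiation in `t` is carried out with the ray frozen; the strict inequalities make this ray
admissible for all nearby `t`. -/
theorem isOpen_admissible (c η μ B θ : ℝ) (hθ : θ ∈ Icc (c + η) (c + 2 * Real.pi - η)) :
    ∃ O : Set ℂ, IsOpen O ∧ (∀ τ ∈ O, Admissible c η μ B θ τ) ∧
      ∀ τ : ℂ, Real.exp τ.re < kernelRadius B μ → |θ - τ.im| < Real.pi / 2 - μ → τ ∈ O := by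
  refine ⟨{τ : ℂ | Real.exp τ.re < kernelRadius B μ} ∩ {τ : ℂ | |θ - τ.im| < Real.pi / 2 - μ},
    IsOpen.inter ?_ ?_, fun τ h => ⟨h.1, hθ, le_of_lt h.2⟩, fun τ h1 h2 => ⟨h1, h2⟩⟩
  · exact isOpen_lt (Real.continuous_exp.comp Complex.continuous_re) continuous_const
  · exact isOpen_lt (continuous_const.sub Complex.continuous_im).abs continuous_const

theorem aestronglyMeasurable_heatIntegrand {φ : ℂ → ℂ} {c η ρ A B θ : ℝ}
    (hcone : ConeBound φ c η ρ A B) {τ z : ℂ} (hz : z ∈ Metric.ball (0 : ℂ) ρ)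
    (hθ : θ ∈ Icc (c + η) (c + 2 * Real.pi - η)) :
    AEStronglyMeasurable (heatIntegrand φ θ τ z) (volume.restrict (Ioi 0)) := by
  refine Continuous.aestronglyMeasurable ?_
  have h : Continuous fun x : ℝ => heatForm φ τ z (ray θ x) :=
    continuous_iff_continuousAt.2 fun x => ContinuousAt.comp (f := fun x : ℝ => ray θ x)
      (hcone.differentiableAt_heatForm hz hθ x).continuousAt
      (continuous_ray.comp (by fun_prop : Continuous fun x : ℝ => (θ, x))).continuousAt
  exact h.mul continuous_const

theorem integrable_exp_neg_sq (C : ℝ) :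
    Integrable (fun x : ℝ => C * Real.exp (-x ^ 2)) (volume.restrict (Ioi 0)) := by
  have := (integrable_exp_neg_mul_sq zero_lt_one).const_mul C
  refine (this.congr (Eventually.of_forall fun x => ?_)).integrableOn
  simp only
  congr 2
  ring

theorem norm_heatIntegrand_le {φ : ℂ → ℂ} {c η ρ A B μ θ : ℝ} (hcone : ConeBound φ c η ρ A B)
    (hB : 0 < B) (hμ : 0 < μ) {τ z : ℂ} (h : Admissible c η μ B θ τ)
    (hz : z ∈ Metric.ball (0 : ℂ) ρ) (x : ℝ) :
    ‖heatIntegrand φ θ τ z x‖ ≤ 2 * A * Real.exp (-x ^ 2) := by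
  rw [heatIntegrand_eq, norm_mul, norm_exp_half_mul_I, mul_one]
  exact norm_heatForm_le hcone hB hμ h hz x

theorem differentiableAt_heatIntegral {φ : ℂ → ℂ} {c η ρ A B μ θ : ℝ}
    (hcone : ConeBound φ c η ρ A B) (hB : 0 < B) (hμ : 0 < μ) {τ z : ℂ}
    (hθ : θ ∈ Icc (c + η) (c + 2 * Real.pi - η)) (hr : Real.exp τ.re < kernelRadius B μ)
    (ha : |θ - τ.im| < Real.pi / 2 - μ) (hz : z ∈ Metric.ball (0 : ℂ) ρ) :
    DifferentiableAt ℂ (fun p : ℂ × ℂ => heatIntegral φ θ p.1 p.2) (τ, z) := by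
  obtain ⟨O, hO, hadm, hmem⟩ := isOpen_admissible c η μ B θ hθ
  have hnhds : O ×ˢ Metric.ball (0 : ℂ) ρ ∈ 𝓝 (τ, z) :=
    (hO.prod Metric.isOpen_ball).mem_nhds ⟨hmem τ hr ha, hz⟩
  obtain ⟨R, hR, hsub⟩ := Metric.mem_nhds_iff.1 hnhds
  unfold heatIntegral
  refine DifferentiableAt.fun_mul ?_ ?_
  · have : ∀ p : ℂ × ℂ, (Real.sqrt (4 * Real.pi) : ℂ) * Complex.exp (p.1 / 2) ≠ 0 := fun p =>
      mul_ne_zero (Complex.ofReal_ne_zero.2 (Real.sqrt_pos.2 (by positivity)).ne')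
        (Complex.exp_ne_zero _)
    fun_prop (disch := exact this _)
  · refine differentiableAt_integral_of_holomorphic (b := fun x => 2 * A * Real.exp (-x ^ 2)) hR
      (fun p hp => aestronglyMeasurable_heatIntegrand hcone (hsub hp).2 hθ)
      (Eventually.of_forall fun x p hp => ?_)
      (Eventually.of_forall fun x p hp =>
        norm_heatIntegrand_le hcone hB hμ (hadm _ (hsub hp).1) (hsub hp).2 x)
      (integrable_exp_neg_sq _)
    have hp' := hsub hp
    have h1 : DifferentiableAt ℂ (fun p : ℂ × ℂ => heatForm φ p.1 p.2 (ray θ x)) p :=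
      differentiableAt_heatForm_param (hcone p.2 hp'.2 θ hθ x).1 (hcone.sub hp'.2 hθ x).1
    exact (h1.fun_mul (differentiableAt_const _)).differentiableWithinAt

/-! ### The heat equation -/

/-- A cone bound is uniform under translations by small `z`, so Cauchy's estimate in `z` passes it
on to the derivative, over half the disc and with the same exponent. -/
theorem ConeBound.deriv {φ : ℂ → ℂ} {c η ρ A B : ℝ} (hcone : ConeBound φ c η ρ A B) (hρ : 0 < ρ) :
    ConeBound (deriv φ) c η (ρ / 2) (A / (ρ / 4)) B := by
  intro z hz θ hθ x
  have hd : DifferentiableOn ℂ φ ((fun w => w - ray θ x) ⁻¹' Metric.ball (0 : ℂ) ρ) := by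
    intro w hw
    have := (hcone _ hw θ hθ x).1
    rw [sub_add_cancel] at this
    exact this.differentiableWithinAt
  have hopen : IsOpen ((fun w => w - ray θ x) ⁻¹' Metric.ball (0 : ℂ) ρ) :=
    Metric.isOpen_ball.preimage (by fun_prop)
  constructor
  · refine (hd.deriv hopen).differentiableAt (hopen.mem_nhds ?_)
    rw [mem_preimage, add_sub_cancel_right]
    exact Metric.ball_subset_ball (by linarith) hz
  · have h1 := norm_deriv_le_of_ball (f := fun w => φ (w + ray θ x)) (z₀ := 0) (z := z) (R := ρ)
      (M := A * Real.exp (B * x ^ 2)) hρ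
      (fun w hw => (DifferentiableAt.comp w (f := fun w => w + ray θ x) (hcone w hw θ hθ x).1
        (by fun_prop)).differentiableWithinAt) (fun w hw => (hcone w hw θ hθ x).2) hz
    rw [deriv_comp_add_const] at h1
    refine h1.trans (le_of_eq ?_)
    ring

theorem hasDerivAt_heatForm_param {φ : ℂ → ℂ} {τ z s : ℂ}
    (h1 : DifferentiableAt ℂ φ (z + s)) (h2 : DifferentiableAt ℂ φ (z - s)) :
    HasDerivAt (fun w => heatForm φ τ w s) (heatForm (deriv φ) τ z s) z := by
  unfold heatForm
  refine HasDerivAt.mul_const (HasDerivAt.add ?_ ?_) _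
  · exact h1.hasDerivAt.comp_add_const z s
  · exact h2.hasDerivAt.comp_sub_const z s

theorem hasDerivAt_heatIntegral_right {φ : ℂ → ℂ} {c η ρ A B μ θ : ℝ}
    (hcone : ConeBound φ c η ρ A B) (hB : 0 < B) (hμ : 0 < μ) {τ z : ℂ}
    (h : Admissible c η μ B θ τ) (hz : z ∈ Metric.ball (0 : ℂ) ρ) :
    HasDerivAt (heatIntegral φ θ τ) (heatIntegral (deriv φ) θ τ z) z := by
  obtain ⟨R, hR, hsub⟩ := Metric.mem_nhds_iff.1 (Metric.isOpen_ball.mem_nhds hz)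
  have hder : ∀ x, ∀ w ∈ Metric.ball z R, HasDerivAt (fun w => heatIntegrand φ θ τ w x)
      (heatIntegrand (deriv φ) θ τ w x) w := fun x w hw =>
    (hasDerivAt_heatForm_param (hcone w (hsub hw) θ h.direction x).1
      (hcone.sub (hsub hw) h.direction x).1).mul_const _
  have := (hasDerivAt_integral_of_holomorphic (μ := volume.restrict (Ioi (0 : ℝ)))
    (f := fun w x => heatIntegrand φ θ τ w x)
    (b := fun x => 2 * A * Real.exp (-x ^ 2)) hR
      (fun w hw => aestronglyMeasurable_heatIntegrand hcone (hsub hw) h.direction)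
      (Eventually.of_forall fun x w hw => (hder x w hw).differentiableAt.differentiableWithinAt)
      (Eventually.of_forall fun x w hw => norm_heatIntegrand_le hcone hB hμ h (hsub hw) x)
      (integrable_exp_neg_sq _)).2.const_mul
        (1 / ((Real.sqrt (4 * Real.pi) : ℂ) * Complex.exp (τ / 2)))
  refine this.congr_deriv ?_
  rw [heatIntegral]
  congr 1
  exact integral_congr_ae (Eventually.of_forall fun x =>
    (hder x z (Metric.mem_ball_self hR)).deriv)

theorem iteratedDeriv_two_heatIntegral {φ : ℂ → ℂ} {c η ρ A B μ θ : ℝ}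
    (hcone : ConeBound φ c η ρ A B) (hρ : 0 < ρ) (hB : 0 < B) (hμ : 0 < μ) {τ z : ℂ}
    (h : Admissible c η μ B θ τ) (hz : z ∈ Metric.ball (0 : ℂ) (ρ / 2)) :
    iteratedDeriv 2 (heatIntegral φ θ τ) z = heatIntegral (deriv (deriv φ)) θ τ z := by
  rw [iteratedDeriv_succ, iteratedDeriv_one]
  have h1 : deriv (heatIntegral φ θ τ) =ᶠ[𝓝 z] heatIntegral (deriv φ) θ τ := by
    filter_upwards [Metric.isOpen_ball.mem_nhds hz] with w hw
    exact (hasDerivAt_heatIntegral_right hcone hB hμ h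
      (Metric.ball_subset_ball (by linarith) hw)).deriv
  rw [h1.deriv_eq]
  exact (hasDerivAt_heatIntegral_right (hcone.deriv hρ) hB hμ h hz).deriv

theorem hasDerivAt_gaussian (q s : ℂ) :
    HasDerivAt (fun s : ℂ => Complex.exp (-s ^ 2 * q)) (-(2 * s * q) * Complex.exp (-s ^ 2 * q)) s := by
  have h1 : HasDerivAt (fun s : ℂ => -s ^ 2 * q) (-(2 * s) * q) s := by
    simpa using (((hasDerivAt_id s).pow 2).neg).mul_const q
  exact h1.cexp.congr_deriv (by ring)

theorem hasDerivAt_heatForm_left (φ : ℂ → ℂ) (τ z s : ℂ) :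
    HasDerivAt (fun τ' => heatForm φ τ' z s)
      (heatForm φ τ z s * (s ^ 2 / (4 * Complex.exp τ))) τ := by
  have h0 := Complex.exp_ne_zero τ
  have h1 : HasDerivAt (fun τ' : ℂ => -s ^ 2 / (4 * Complex.exp τ'))
      (s ^ 2 / (4 * Complex.exp τ)) τ := by
    have := ((Complex.hasDerivAt_exp τ).const_mul (4 : ℂ)).inv (mul_ne_zero (by norm_num) h0)
    refine (this.const_mul (-s ^ 2)).congr_deriv ?_
    field_simp
  have := h1.cexp.const_mul (φ (z + s) + φ (z - s))
  refine this.congr_deriv ?_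
  rw [heatForm]
  ring

theorem hasDerivAt_rayIntegral_left {φ : ℂ → ℂ} {c η ρ A B μ θ : ℝ}
    (hcone : ConeBound φ c η ρ A B) (hB : 0 < B) (hμ : 0 < μ) {τ z : ℂ}
    (hθ : θ ∈ Icc (c + η) (c + 2 * Real.pi - η)) (hr : Real.exp τ.re < kernelRadius B μ)
    (ha : |θ - τ.im| < Real.pi / 2 - μ) (hz : z ∈ Metric.ball (0 : ℂ) ρ) :
    Integrable (fun x => heatIntegrand φ θ τ z x * (ray θ x ^ 2 / (4 * Complex.exp τ)))
        (volume.restrict (Ioi 0)) ∧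
      HasDerivAt (fun τ' => rayIntegral (heatForm φ τ' z) θ)
        (∫ x in Ioi 0, heatIntegrand φ θ τ z x * (ray θ x ^ 2 / (4 * Complex.exp τ))) τ := by
  obtain ⟨O, hO, hadm, hmem⟩ := isOpen_admissible c η μ B θ hθ
  obtain ⟨R, hR, hsub⟩ := Metric.mem_nhds_iff.1 (hO.mem_nhds (hmem τ hr ha))
  have hder : ∀ x, ∀ w : ℂ, HasDerivAt (fun w => heatIntegrand φ θ w z x)
      (heatIntegrand φ θ w z x * (ray θ x ^ 2 / (4 * Complex.exp w))) w := fun x w => by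
    refine ((hasDerivAt_heatForm_left φ w z (ray θ x)).mul_const _).congr_deriv ?_
    rw [heatIntegrand_eq]
    ring
  have key := hasDerivAt_integral_of_holomorphic (μ := volume.restrict (Ioi (0 : ℝ)))
    (f := fun w x => heatIntegrand φ θ w z x) (z₀ := τ)
    (b := fun x => 2 * A * Real.exp (-x ^ 2)) hR
      (fun w hw => aestronglyMeasurable_heatIntegrand hcone hz hθ)
      (Eventually.of_forall fun x w hw => (hder x w).differentiableAt.differentiableWithinAt)
      (Eventually.of_forall fun x w hw => norm_heatIntegrand_le hcone hB hμ (hadm w (hsub hw)) hz x)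
      (integrable_exp_neg_sq _)
  have e : ∀ x, deriv (fun w => heatIntegrand φ θ w z x) τ =
      heatIntegrand φ θ τ z x * (ray θ x ^ 2 / (4 * Complex.exp τ)) := fun x => (hder x τ).deriv
  simp only [e] at key
  exact key

theorem hasDerivAt_ray (θ x : ℝ) : HasDerivAt (ray θ) (Complex.exp (θ / 2 * Complex.I)) x := by
  exact ((Complex.ofRealCLM.hasDerivAt (x := x)).mul_const
    (Complex.exp (θ / 2 * Complex.I))).congr_deriv (by simp)

theorem mul_exp_neg_sq_le {x : ℝ} : x * Real.exp (-x ^ 2) ≤ (1 + x ^ 2)⁻¹ := by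
  rw [Real.exp_neg, ← div_eq_mul_inv, ← one_div, div_le_div_iff₀ (Real.exp_pos _) (by positivity)]
  have := Real.quadratic_le_exp_of_nonneg (sq_nonneg x)
  nlinarith [sq_nonneg (x - 1), mul_nonneg (sq_nonneg x) (sq_nonneg (x - 1))]

/-- Integration by parts on a ray. -/
theorem integral_heat_by_parts {φ : ℂ → ℂ} {c η ρ A B μ θ : ℝ}
    (hcone : ConeBound φ c η ρ A B) (hρ : 0 < ρ) (hA : 0 < A) (hB : 0 < B) (hμ : 0 < μ) {τ z : ℂ}
    (hθ : θ ∈ Icc (c + η) (c + 2 * Real.pi - η)) (hr : Real.exp τ.re < kernelRadius B μ)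
    (ha : |θ - τ.im| < Real.pi / 2 - μ) (hz : z ∈ Metric.ball (0 : ℂ) (ρ / 4)) :
    (∫ x in Ioi 0, heatIntegrand φ θ τ z x * (ray θ x ^ 2 / (4 * Complex.exp τ))) -
        1 / 2 * ∫ x in Ioi 0, heatIntegrand φ θ τ z x =
      Complex.exp τ * ∫ x in Ioi 0, heatIntegrand (deriv (deriv φ)) θ τ z x := by
  have hadm : Admissible c η μ B θ τ := ⟨hr, hθ, ha.le⟩
  have hz2 : z ∈ Metric.ball (0 : ℂ) (ρ / 2) := Metric.ball_subset_ball (by linarith) hz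
  have hz1 : z ∈ Metric.ball (0 : ℂ) ρ := Metric.ball_subset_ball (by linarith) hz
  have hc1 := hcone.deriv hρ
  have hc2 := hc1.deriv (half_pos hρ)
  have hz3 : z ∈ Metric.ball (0 : ℂ) (ρ / 2 / 2) := by convert hz using 2; ring
  obtain ⟨hi1, -⟩ := hasDerivAt_rayIntegral_left hcone hB hμ hθ hr ha hz1
  have hi0 : Integrable (heatIntegrand φ θ τ z) (volume.restrict (Ioi 0)) :=
    integrableOn_heatIntegrand hcone hA hB hμ hadm hz1
  have hi2 : Integrable (heatIntegrand (deriv (deriv φ)) θ τ z) (volume.restrict (Ioi 0)) :=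
    integrableOn_heatIntegrand hc2 (by positivity) hB hμ hadm hz3
  have h0 := Complex.exp_ne_zero τ
  set q : ℂ := (4 * Complex.exp τ)⁻¹ with hq
  set e := Complex.exp (θ / 2 * Complex.I) with he
  let K : ℂ → ℂ := fun s => Complex.exp (-s ^ 2 * q)
  -- With `F(s) = φ(z + s) + φ(z - s)` and `K(s) = e^{-qs²}`, this is `F K' - F' K`. Its derivative
  -- is `F K'' - F'' K`, and `K'' = 4q (q s² - 1/2) K`, where `4q = 1/t`.
  let N : ℂ → ℂ := fun s => (φ (z + s) + φ (z - s)) * (-(2 * s * q) * K s) -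
    (deriv φ (z + s) - deriv φ (z - s)) * K s
  have hN : ∀ x : ℝ, HasDerivAt N (4 * q * ((φ (z + ray θ x) + φ (z - ray θ x)) * K (ray θ x) *
      (ray θ x ^ 2 * q - 1 / 2)) -
        (deriv (deriv φ) (z + ray θ x) + deriv (deriv φ) (z - ray θ x)) * K (ray θ x))
      (ray θ x) := by
    intro x
    set s := ray θ x
    have a1 := (hcone z hz1 θ hθ x).1.hasDerivAt.comp_const_add z s
    have a2 := (hcone.sub hz1 hθ x).1.hasDerivAt.comp_const_sub z s
    have b1 := (hc1 z hz2 θ hθ x).1.hasDerivAt.comp_const_add z s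
    have b2 := (hc1.sub hz2 hθ x).1.hasDerivAt.comp_const_sub z s
    have hK : HasDerivAt K (-(2 * s * q) * K s) s := hasDerivAt_gaussian q s
    have hl : HasDerivAt (fun s : ℂ => -(2 * s * q)) (-(2 * q)) s := by
      exact (((hasDerivAt_id s).const_mul 2).mul_const q).neg.congr_deriv (by simp)
    refine (((a1.add a2).mul (hl.mul hK)).sub ((b1.sub b2).mul hK)).congr_deriv ?_
    simp only [Pi.add_apply, Pi.sub_apply, Pi.mul_apply]
    ring
  have hKe : ∀ s : ℂ, K s = Complex.exp (-s ^ 2 / (4 * Complex.exp τ)) := fun s => rfl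
  have hdq : ∀ w : ℂ, w / (4 * Complex.exp τ) = w * q := fun w => div_eq_mul_inv _ _
  have hNx : ∀ x : ℝ, HasDerivAt (fun x => N (ray θ x))
      (4 * q * (heatIntegrand φ θ τ z x * (ray θ x ^ 2 / (4 * Complex.exp τ)) -
        1 / 2 * heatIntegrand φ θ τ z x) - heatIntegrand (deriv (deriv φ)) θ τ z x) x := by
    intro x
    refine ((hN x).comp x (hasDerivAt_ray θ x)).congr_deriv ?_
    rw [heatIntegrand_eq, heatIntegrand_eq, heatForm, heatForm, ← hKe, hdq]
    ring
  have hNb : ∀ x ≥ (0 : ℝ), ‖N (ray θ x)‖ ≤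
      (2 * A * (2 * ‖q‖) + 2 * (A / (ρ / 4))) * (1 + x ^ 2)⁻¹ := by
    intro x hx
    have hk : ‖K (ray θ x)‖ = ‖Complex.exp (-(ray θ x) ^ 2 / (4 * Complex.exp τ))‖ := rfl
    have h1 := hadm.norm_mul_gaussian_le hB hμ (hcone.add_bound hz1 hθ x)
    have h2 : ‖deriv φ (z + ray θ x) - deriv φ (z - ray θ x)‖ ≤
        2 * (A / (ρ / 4)) * Real.exp (B * x ^ 2) := by
      have g1 := (hc1 z hz2 θ hθ x).2
      have g2 := (hc1.sub hz2 hθ x).2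
      linarith [norm_sub_le (deriv φ (z + ray θ x)) (deriv φ (z - ray θ x))]
    have h3 := hadm.norm_mul_gaussian_le hB hμ h2
    rw [norm_mul] at h1
    have h4 : ‖(φ (z + ray θ x) + φ (z - ray θ x)) * (-(2 * ray θ x * q) * K (ray θ x))‖ ≤
        2 * A * (2 * ‖q‖) * (1 + x ^ 2)⁻¹ := by
      rw [norm_mul, norm_mul, norm_neg, norm_mul, norm_mul, norm_ray hx, Complex.norm_ofNat, hk]
      calc _ = (2 * ‖q‖) * x * (‖φ (z + ray θ x) + φ (z - ray θ x)‖ *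
            ‖Complex.exp (-(ray θ x) ^ 2 / (4 * Complex.exp τ))‖) := by ring
        _ ≤ (2 * ‖q‖) * x * (2 * A * Real.exp (-x ^ 2)) := by gcongr
        _ = 2 * A * (2 * ‖q‖) * (x * Real.exp (-x ^ 2)) := by ring
        _ ≤ _ := by
          gcongr
          exact mul_exp_neg_sq_le
    have h5 : ‖(deriv φ (z + ray θ x) - deriv φ (z - ray θ x)) * K (ray θ x)‖ ≤
        2 * (A / (ρ / 4)) * (1 + x ^ 2)⁻¹ :=
      h3.trans (by gcongr; exact exp_neg_sq_le x)
    rw [add_mul]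
    exact (norm_sub_le _ _).trans (add_le_add h4 h5)
  have hlim : Tendsto (fun x => N (ray θ x)) atTop (𝓝 0) := by
    refine squeeze_zero_norm' ((eventually_ge_atTop 0).mono hNb) ?_
    have : Tendsto (fun x : ℝ => (1 + x ^ 2)⁻¹) atTop (𝓝 0) :=
      tendsto_inv_atTop_zero.comp (tendsto_const_nhds.add_atTop (tendsto_pow_atTop two_ne_zero))
    simpa using this.const_mul (2 * A * (2 * ‖q‖) + 2 * (A / (ρ / 4)))
  have hi3 : Integrable (fun x => heatIntegrand φ θ τ z x * (ray θ x ^ 2 / (4 * Complex.exp τ)) -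
      1 / 2 * heatIntegrand φ θ τ z x) (volume.restrict (Ioi 0)) := hi1.sub (hi0.const_mul (1 / 2))
  have hi4 := hi3.const_mul (4 * q)
  have hftc := integral_Ioi_of_hasDerivAt_of_tendsto (a := 0) (hNx 0).continuousAt.continuousWithinAt
    (fun x _ => hNx x) (hi4.sub hi2) hlim
  -- Both boundary terms vanish at `0` because `K` and `F` are even.
  have hN0 : N (ray θ 0) = 0 := by simp [N, ray]
  rw [hN0, sub_zero, integral_sub hi4 hi2,
    integral_const_mul, integral_sub hi1 (hi0.const_mul (1 / 2)), integral_const_mul,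
    sub_eq_zero] at hftc
  rw [← hftc, hq]
  field_simp

/-- The operator `t ∂_t` brings down `s²/(4t)` from the Gaussian and `-1/2` from the prefactor
`t^{-1/2}`, which is exactly the combination in the integration by parts. -/
theorem deriv_heatIntegral_left {φ : ℂ → ℂ} {c η ρ A B μ θ : ℝ}
    (hcone : ConeBound φ c η ρ A B) (hρ : 0 < ρ) (hA : 0 < A) (hB : 0 < B) (hμ : 0 < μ) {τ z : ℂ}
    (hθ : θ ∈ Icc (c + η) (c + 2 * Real.pi - η)) (hr : Real.exp τ.re < kernelRadius B μ)
    (ha : |θ - τ.im| < Real.pi / 2 - μ) (hz : z ∈ Metric.ball (0 : ℂ) (ρ / 4)) :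
    deriv (fun τ' => heatIntegral φ θ τ' z) τ =
      Complex.exp τ * iteratedDeriv 2 (heatIntegral φ θ τ) z := by
  have hadm : Admissible c η μ B θ τ := ⟨hr, hθ, ha.le⟩
  have hz2 : z ∈ Metric.ball (0 : ℂ) (ρ / 2) := Metric.ball_subset_ball (by linarith) hz
  have hz1 : z ∈ Metric.ball (0 : ℂ) ρ := Metric.ball_subset_ball (by linarith) hz
  rw [iteratedDeriv_two_heatIntegral hcone hρ hB hμ hadm hz2]
  obtain ⟨-, hd⟩ := hasDerivAt_rayIntegral_left hcone hB hμ hθ hr ha hz1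
  have hpi : (Real.sqrt (4 * Real.pi) : ℂ) ≠ 0 :=
    Complex.ofReal_ne_zero.2 (Real.sqrt_pos.2 (by positivity)).ne'
  have h0 := Complex.exp_ne_zero (τ / 2)
  have hP : HasDerivAt (fun τ' : ℂ => 1 / ((Real.sqrt (4 * Real.pi) : ℂ) * Complex.exp (τ' / 2)))
      (-(1 / 2) * (1 / ((Real.sqrt (4 * Real.pi) : ℂ) * Complex.exp (τ / 2)))) τ := by
    have h1 := (((hasDerivAt_id τ).div_const 2).cexp.const_mul
      (Real.sqrt (4 * Real.pi) : ℂ)).inv (mul_ne_zero hpi h0)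
    simp only [one_div]
    refine h1.congr_deriv ?_
    simp only [id]
    field_simp
  have hfun : (fun τ' => heatIntegral φ θ τ' z) = fun τ' =>
      1 / ((Real.sqrt (4 * Real.pi) : ℂ) * Complex.exp (τ' / 2)) *
        rayIntegral (heatForm φ τ' z) θ := rfl
  rw [hfun, (hP.fun_mul hd).deriv, heatIntegral]
  have hibp := integral_heat_by_parts hcone hρ hA hB hμ hθ hr ha hz
  have hray : rayIntegral (heatForm φ τ z) θ = ∫ x in Ioi 0, heatIntegrand φ θ τ z x := rfl
  rw [hray]
  linear_combination (1 / ((Real.sqrt (4 * Real.pi) : ℂ) * Complex.exp (τ / 2))) * hibp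


/-! ### The initial condition -/

/-- The mean value inequality along the ray. First order in `x` is enough, since it yields an error
of size `√|t|`. -/
theorem ConeBound.norm_sub_le {φ : ℂ → ℂ} {c η ρ A B : ℝ} (hcone : ConeBound φ c η ρ A B)
    (hρ : 0 < ρ) (hA : 0 < A) (hB : 0 < B) {z : ℂ} (hz : z ∈ Metric.ball (0 : ℂ) (ρ / 2)) {θ : ℝ}
    (hθ : θ ∈ Icc (c + η) (c + 2 * Real.pi - η)) {x : ℝ} (hx : 0 ≤ x) :
    ‖φ (z + ray θ x) + φ (z - ray θ x) - 2 * φ z‖ ≤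
      2 * (A / (ρ / 4)) * Real.exp (B * x ^ 2) * x := by
  have hz1 : z ∈ Metric.ball (0 : ℂ) ρ := Metric.ball_subset_ball (by linarith) hz
  have hc1 := hcone.deriv hρ
  have h := norm_image_sub_le_of_norm_deriv_le_segment' (a := 0) (b := x)
    (f := fun y => φ (z + ray θ y) + φ (z - ray θ y))
    (f' := fun y => (_root_.deriv φ (z + ray θ y) - _root_.deriv φ (z - ray θ y)) *
      Complex.exp (θ / 2 * Complex.I)) (C := 2 * (A / (ρ / 4)) * Real.exp (B * x ^ 2))
    (fun y hy => ?_) (fun y hy => ?_) x ⟨hx, le_rfl⟩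
  · have e : φ (z + ray θ 0) + φ (z - ray θ 0) = 2 * φ z := by simp [ray, two_mul]
    simp only [e, sub_zero] at h
    exact h
  · have h1 := (hcone z hz1 θ hθ y).1.hasDerivAt.comp_const_add z (ray θ y)
    have h2 := (hcone.sub hz1 hθ y).1.hasDerivAt.comp_const_sub z (ray θ y)
    refine (((h1.add h2).comp y (hasDerivAt_ray θ y)).congr_deriv ?_).hasDerivWithinAt
    ring
  · rw [norm_mul, norm_exp_half_mul_I, mul_one]
    have h1 := (hc1 z hz θ hθ y).2
    have h2 := (hc1.sub hz hθ y).2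
    have h3 : Real.exp (B * y ^ 2) ≤ Real.exp (B * x ^ 2) := by
      have := hy.1
      have := hy.2.le
      gcongr
    have h4 : A / (ρ / 4) * Real.exp (B * y ^ 2) ≤ A / (ρ / 4) * Real.exp (B * x ^ 2) := by gcongr
    linarith [_root_.norm_sub_le (_root_.deriv φ (z + ray θ y)) (_root_.deriv φ (z - ray θ y))]

theorem integral_gaussian_ray {θ : ℝ} {τ : ℂ} (h : |θ - τ.im| < Real.pi / 2) :
    ∫ x in Ioi (0 : ℝ), Complex.exp (-(ray θ x) ^ 2 / (4 * Complex.exp τ)) *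
      Complex.exp (θ / 2 * Complex.I) = (Real.sqrt (4 * Real.pi) : ℂ) * Complex.exp (τ / 2) / 2 := by
  have hpi := Real.pi_pos
  simp_rw [gaussian_exponent]
  rw [integral_mul_const]
  have hcos : 0 < Real.cos (θ - τ.im) := Real.cos_pos_of_mem_Ioo (abs_lt.1 h)
  have hre : 0 < (Complex.exp (θ * Complex.I - τ) / 4).re := by
    rw [re_exp_sub]
    positivity
  rw [integral_gaussian_complex_Ioi hre]
  set w : ℂ := (Real.sqrt (4 * Real.pi) : ℂ) * Complex.exp ((τ - θ * Complex.I) / 2) with hw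
  have hw2 : (Real.pi : ℂ) / (Complex.exp (θ * Complex.I - τ) / 4) = w ^ 2 := by
    rw [hw, mul_pow, ← Complex.ofReal_pow, Real.sq_sqrt (by positivity), ← Complex.exp_nat_mul,
      show ((2 : ℕ) : ℂ) * ((τ - θ * Complex.I) / 2) = -(θ * Complex.I - τ) by push_cast; ring,
      Complex.exp_neg]
    have := Complex.exp_ne_zero (θ * Complex.I - τ)
    push_cast
    field_simp
  -- This selects the branch: as `|θ - arg t| / 2 < π/4`, the number `w` is the principal square
  -- root in the Gaussian formula.
  have hwre : 0 < w.re := by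
    have e : ((τ - θ * Complex.I) / 2).im = (τ.im - θ) / 2 := by
      rw [show (2 : ℂ) = ((2 : ℝ) : ℂ) by norm_num, Complex.div_ofReal_im]
      simp
    rw [hw, Complex.re_ofReal_mul, Complex.exp_re, e]
    have h1 := abs_lt.1 h
    have : 0 < Real.cos ((τ.im - θ) / 2) :=
      Real.cos_pos_of_mem_Ioo ⟨by linarith, by linarith⟩
    have h2 : 0 < Real.sqrt (4 * Real.pi) := Real.sqrt_pos.2 (by positivity)
    positivity
  rw [hw2, show (1 / 2 : ℂ) = 2⁻¹ by norm_num, Complex.sq_cpow_two_inv hwre, hw]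
  have e : Complex.exp (τ / 2) = Complex.exp ((τ - θ * Complex.I) / 2) *
      Complex.exp (θ / 2 * Complex.I) := by
    rw [← Complex.exp_add]
    congr 1
    ring
  rw [e]
  ring

/-- `φ(z)` is itself the heat integral of the constant `2 φ(z)`. What remains is `O(x)` against a
Gaussian of rate comparable to `1/|t|`, hence `O(|t|)`, and the prefactor `t^{-1/2}` leaves
`O(√|t|)`. -/
theorem norm_heatIntegral_sub_le {φ : ℂ → ℂ} {c η ρ A B μ θ : ℝ}
    (hcone : ConeBound φ c η ρ A B) (hρ : 0 < ρ) (hA : 0 < A) (hB : 0 < B) (hμ : 0 < μ)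
    (hμ' : μ < Real.pi) {τ z : ℂ} (h : Admissible c η μ B θ τ)
    (hz : z ∈ Metric.ball (0 : ℂ) (ρ / 2)) :
    ‖heatIntegral φ θ τ z - φ z‖ ≤
      (A / (ρ / 4) * (4 * (B + 1) / Real.sin μ) / Real.sqrt (4 * Real.pi)) *
        Real.exp (τ.re / 2) := by
  have hpi := Real.pi_pos
  have hsin := Real.sin_pos_of_pos_of_lt_pi hμ hμ'
  have hz1 : z ∈ Metric.ball (0 : ℂ) ρ := Metric.ball_subset_ball (by linarith) hz
  have hsq : 0 < Real.sqrt (4 * Real.pi) := Real.sqrt_pos.2 (by positivity)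
  have hsqc : (Real.sqrt (4 * Real.pi) : ℂ) ≠ 0 := Complex.ofReal_ne_zero.2 hsq.ne'
  have h0 := Complex.exp_ne_zero (τ / 2)
  set P : ℂ := 1 / ((Real.sqrt (4 * Real.pi) : ℂ) * Complex.exp (τ / 2)) with hP
  set lam := Real.sin μ * Real.exp (-τ.re) / 4 with hlam
  have hle : B + 1 ≤ lam := h.le hB
  let k : ℝ → ℂ := fun x => Complex.exp (-(ray θ x) ^ 2 / (4 * Complex.exp τ)) *
      Complex.exp (θ / 2 * Complex.I)
  have hk : ∫ x in Ioi (0 : ℝ), k x = (Real.sqrt (4 * Real.pi) : ℂ) * Complex.exp (τ / 2) / 2 :=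
    integral_gaussian_ray (lt_of_le_of_lt h.angle (by linarith))
  have hki : IntegrableOn k (Ioi 0) := by
    -- A non-integrable function would have integral `0`, but the value just computed is not `0`.
    by_contra hni
    rw [integral_undef hni] at hk
    exact (div_ne_zero (mul_ne_zero hsqc h0) two_ne_zero) hk.symm
  have hi0 : Integrable (heatIntegrand φ θ τ z) (volume.restrict (Ioi 0)) :=
    integrableOn_heatIntegrand hcone hA hB hμ h hz1
  have hdiff : heatIntegral φ θ τ z - φ z =
      P * ∫ x in Ioi (0 : ℝ), (heatIntegrand φ θ τ z x - 2 * φ z * k x) := by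
    rw [integral_sub hi0 (hki.const_mul _), integral_const_mul, hk, mul_sub, heatIntegral, ← hP]
    congr 1
    rw [hP]
    field_simp
  have hbound : ∀ x ∈ Ioi (0 : ℝ), ‖heatIntegrand φ θ τ z x - 2 * φ z * k x‖ ≤
      2 * (A / (ρ / 4)) * (x * Real.exp (-(lam - B) * x ^ 2)) := by
    intro x hx
    have e : heatIntegrand φ θ τ z x - 2 * φ z * k x =
        (φ (z + ray θ x) + φ (z - ray θ x) - 2 * φ z) * k x := by
      rw [heatIntegrand_eq, heatForm]
      simp only [k]
      ring
    have h1 := hcone.norm_sub_le hρ hA hB hz h.direction (le_of_lt hx)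
    have h2 := norm_gaussian_le hμ h.angle x
    rw [e, norm_mul]
    simp only [k]
    rw [norm_mul, norm_exp_half_mul_I, mul_one]
    calc _ ≤ (2 * (A / (ρ / 4)) * Real.exp (B * x ^ 2) * x) * Real.exp (-lam * x ^ 2) :=
          mul_le_mul h1 h2 (norm_nonneg _) ((norm_nonneg _).trans h1)
      _ = 2 * (A / (ρ / 4)) * (x * (Real.exp (B * x ^ 2) * Real.exp (-lam * x ^ 2))) := by ring
      _ = _ := by
        rw [← Real.exp_add]
        congr 4
        ring
  have hlB : 0 < lam - B := by linarith
  have hint : ∫ x in Ioi (0 : ℝ), x * Real.exp (-(lam - B) * x ^ 2) = (2 * (lam - B))⁻¹ := by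
    have := integral_mul_cexp_neg_mul_sq (b := ((lam - B : ℝ) : ℂ)) (by simpa using hlB)
    have e : ∀ r : ℝ, (r : ℂ) * Complex.exp (-((lam - B : ℝ) : ℂ) * (r : ℂ) ^ 2) =
        ((r * Real.exp (-(lam - B) * r ^ 2) : ℝ) : ℂ) := fun r => by push_cast; rfl
    simp_rw [e] at this
    rw [integral_complex_ofReal] at this
    exact_mod_cast this
  have hinti : IntegrableOn (fun x : ℝ => 2 * (A / (ρ / 4)) *
      (x * Real.exp (-(lam - B) * x ^ 2))) (Ioi 0) :=
    ((integrable_mul_exp_neg_mul_sq hlB).const_mul _).integrableOn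
  have hnorm := norm_integral_le_of_norm_le hinti
    ((ae_restrict_mem measurableSet_Ioi).mono hbound)
  rw [integral_const_mul, hint] at hnorm
  have hPn : ‖P‖ = Real.exp (-(τ.re / 2)) / Real.sqrt (4 * Real.pi) := by
    rw [hP, norm_div, norm_mul, norm_one, Complex.norm_real, Real.norm_of_nonneg hsq.le,
      Complex.norm_exp, Real.exp_neg]
    have : (τ / 2).re = τ.re / 2 := by
      rw [show (2 : ℂ) = ((2 : ℝ) : ℂ) by norm_num, Complex.div_ofReal_re]
    rw [this]
    field_simp
  have hlam0 : 0 < lam := by linarith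
  -- Equivalent to `B (lam - B - 1) ≥ 0`, which follows from `B + 1 ≤ lam`.
  have hinv : (lam - B)⁻¹ ≤ (B + 1) / lam := by
    rw [inv_le_comm₀ hlB (by positivity), inv_div, div_le_iff₀ (by positivity)]
    nlinarith
  have hlam_inv : (B + 1) / lam = 4 * (B + 1) / Real.sin μ * Real.exp τ.re := by
    have e : Real.exp (-τ.re) * Real.exp τ.re = 1 := by rw [← Real.exp_add]; simp
    rw [hlam]
    have := Real.exp_pos τ.re
    rw [Real.exp_neg]
    field_simp
  rw [hdiff, norm_mul, hPn]
  calc Real.exp (-(τ.re / 2)) / Real.sqrt (4 * Real.pi) *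
        ‖∫ x in Ioi (0 : ℝ), (heatIntegrand φ θ τ z x - 2 * φ z * k x)‖
      ≤ Real.exp (-(τ.re / 2)) / Real.sqrt (4 * Real.pi) *
        (2 * (A / (ρ / 4)) * (2 * (lam - B))⁻¹) := by gcongr
    _ = Real.exp (-(τ.re / 2)) / Real.sqrt (4 * Real.pi) *
        ((A / (ρ / 4)) * (lam - B)⁻¹) := by rw [mul_inv]; ring
    _ ≤ Real.exp (-(τ.re / 2)) / Real.sqrt (4 * Real.pi) *
        ((A / (ρ / 4)) * (4 * (B + 1) / Real.sin μ * Real.exp τ.re)) := by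
          rw [← hlam_inv]
          gcongr
    _ = (A / (ρ / 4) * (4 * (B + 1) / Real.sin μ) / Real.sqrt (4 * Real.pi)) *
        (Real.exp (-(τ.re / 2)) * Real.exp τ.re) := by ring
    _ = _ := by
        rw [← Real.exp_add]
        congr 2
        ring

/-- The estimate above is uniform in the direction, so the ray may depend on `τ`. -/
theorem tendsto_heatIntegral {φ : ℂ → ℂ} {c η ρ A B μ : ℝ}
    (hcone : ConeBound φ c η ρ A B) (hρ : 0 < ρ) (hA : 0 < A) (hB : 0 < B) (hμ : 0 < μ)
    (hμ' : μ < Real.pi) {z : ℂ} (hz : z ∈ Metric.ball (0 : ℂ) (ρ / 2)) {U : Set ℂ} {Θ : ℂ → ℝ}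
    (h : ∀ τ ∈ U, Admissible c η μ B (Θ τ) τ) :
    Tendsto (fun τ => heatIntegral φ (Θ τ) τ z) (comap Complex.re atBot ⊓ 𝓟 U) (𝓝 (φ z)) := by
  rw [tendsto_iff_norm_sub_tendsto_zero]
  have h1 : Tendsto (fun τ : ℂ => Real.exp (τ.re / 2)) (comap Complex.re atBot ⊓ 𝓟 U) (𝓝 0) := by
    refine Tendsto.mono_left ?_ inf_le_left
    exact Real.tendsto_exp_atBot.comp (tendsto_comap.atBot_div_const zero_lt_two)
  have h2 := h1.const_mul
    (A / (ρ / 4) * (4 * (B + 1) / Real.sin μ) / Real.sqrt (4 * Real.pi))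
  rw [mul_zero] at h2
  refine squeeze_zero' (Eventually.of_forall fun _ => norm_nonneg _) ?_ h2
  filter_upwards [mem_inf_of_right (mem_principal_self U)] with τ hτ
  exact norm_heatIntegral_sub_le hcone hρ hA hB hμ hμ' (h τ hτ) hz

/-! ### The sums on the Riemann surface of the square root -/

/-- Only `θ/2`, `τ/2` and `e^τ` enter the integral, whence the period `4π`, that of the surface of
`√t`. -/
theorem heatIntegral_shift (φ : ℂ → ℂ) (θ : ℝ) (τ z : ℂ) (m : ℤ) :
    heatIntegral φ (θ + 4 * Real.pi * m) (τ + (4 * Real.pi * m : ℝ) * Complex.I) z =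
      heatIntegral φ θ τ z := by
  have e1 : Complex.exp (((θ + 4 * Real.pi * m : ℝ) : ℂ) / 2 * Complex.I) =
      Complex.exp (θ / 2 * Complex.I) := by
    rw [← Complex.exp_periodic.int_mul m (θ / 2 * Complex.I)]
    congr 1
    push_cast
    ring
  have e2 : Complex.exp (τ + (4 * Real.pi * m : ℝ) * Complex.I) = Complex.exp τ := by
    rw [← Complex.exp_periodic.int_mul (2 * m) τ]
    congr 1
    push_cast
    ring
  have e3 : Complex.exp ((τ + (4 * Real.pi * m : ℝ) * Complex.I) / 2) = Complex.exp (τ / 2) := by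
    rw [← Complex.exp_periodic.int_mul m (τ / 2)]
    congr 1
    push_cast
    ring
  unfold heatIntegral heatIntegrand
  rw [e1, e2, e3]

/-- A direction in `(c, c + 2π)` within `π/2` of `y`, for `y ∈ (c - π/2, c + 5π/2)`. -/
noncomputable def branchAngle (c y : ℝ) : ℝ := c + Real.pi + 2 / 3 * (y - (c + Real.pi))

/-- The number of turns by `4π` that bring `y` to `[c - π, c + 3π)`. -/
noncomputable def turns (c y : ℝ) : ℤ := ⌊(y - (c - Real.pi)) / (4 * Real.pi)⌋

/-- The function on the Riemann surface of `√t` which is the heat integral over the rays with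
`θ ∈ (c, c + 2π)`. -/
noncomputable def branch (φ : ℂ → ℂ) (c : ℝ) (τ z : ℂ) : ℂ :=
  heatIntegral φ (branchAngle c (τ.im - 4 * Real.pi * turns c τ.im))
    (τ - (4 * Real.pi * turns c τ.im : ℝ) * Complex.I) z

theorem turns_add (c y : ℝ) (m : ℤ) : turns c (y + 4 * Real.pi * m) = turns c y + m := by
  have hpi := Real.pi_pos
  rw [turns, turns, ← Int.floor_add_intCast]
  congr 1
  field_simp
  ring

theorem turns_add_left (c y : ℝ) (m : ℤ) : turns (c + 4 * Real.pi * m) y = turns c y - m := by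
  have hpi := Real.pi_pos
  rw [turns, turns, ← Int.floor_sub_intCast]
  congr 1
  field_simp
  ring

theorem turns_eq_zero {c y : ℝ} (h : |y - (c + Real.pi)| < 2 * Real.pi) : turns c y = 0 := by
  have hpi := Real.pi_pos
  have h1 := abs_lt.1 h
  rw [turns, Int.floor_eq_zero_iff]
  constructor
  · exact div_nonneg (by linarith) (by positivity)
  · rw [div_lt_one (by positivity)]
    linarith

theorem branch_add (φ : ℂ → ℂ) (c : ℝ) (τ z : ℂ) (m : ℤ) :
    branch φ c (τ + (4 * Real.pi * m : ℝ) * Complex.I) z = branch φ c τ z := by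
  have e : (τ + (4 * Real.pi * m : ℝ) * Complex.I).im = τ.im + 4 * Real.pi * m := by simp
  rw [branch, branch, e, turns_add]
  congr 1
  · congr 1
    push_cast
    ring
  · push_cast
    ring

/-- The branch depends on `c` only modulo `4π`. Since singular directions are spaced by `2π`, only
two branches exist. -/
theorem branch_add_left (φ : ℂ → ℂ) (c : ℝ) (m : ℤ) :
    branch φ (c + 4 * Real.pi * m) = branch φ c := by
  funext τ z
  rw [branch, branch, turns_add_left]
  refine Eq.trans ?_ (heatIntegral_shift φ _ _ z m)
  congr 1
  · rw [branchAngle, branchAngle]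
    push_cast
    ring
  · push_cast
    ring

theorem branch_eq {φ : ℂ → ℂ} {c : ℝ} {τ : ℂ} (h : |τ.im - (c + Real.pi)| < 2 * Real.pi) (z : ℂ) :
    branch φ c τ z = heatIntegral φ (branchAngle c τ.im) τ z := by
  rw [branch, turns_eq_zero h]
  simp

theorem branchAngle_mem {c η y : ℝ} (h : |y - (c + Real.pi)| ≤ 3 / 2 * (Real.pi - η)) :
    branchAngle c y ∈ Icc (c + η) (c + 2 * Real.pi - η) := by
  have h1 := abs_le.1 h
  rw [branchAngle]
  constructor <;> linarith

/-- The factor `2/3` in `branchAngle` contracts an interval of half-length `3π/2` to one of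
half-length `π`. The ray is then off by a third of the distance to the centre, which stays below
`π/2`. -/
theorem branchAngle_sub (c y : ℝ) : |branchAngle c y - y| = |y - (c + Real.pi)| / 3 := by
  rw [branchAngle, ← abs_neg, show -(c + Real.pi + 2 / 3 * (y - (c + Real.pi)) - y) =
    (y - (c + Real.pi)) / 3 by ring, abs_div, abs_of_pos (by norm_num : (0 : ℝ) < 3)]

/-- Near the direction `θ ∈ (c, c + 2π)` the branch is the heat integral over the ray `θ/2`. -/
theorem HasConeBounds.branch_eq_heatIntegral {φ : ℂ → ℂ} {c : ℝ} (h : HasConeBounds φ c)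
    {η R : ℝ} (hη : 0 < η) (hηπ : η < Real.pi) (hR : 0 < R) :
    ∃ ρ : ℝ, 0 < ρ ∧ ρ ≤ R ∧ ∀ α : ℝ, 0 < α → α < Real.pi → ∃ r : ℝ, 0 < r ∧
      ∀ θ ∈ Icc (c + η) (c + 2 * Real.pi - η), ∀ τ ∈ sector θ α (r : EReal),
        ∀ z ∈ Metric.ball (0 : ℂ) ρ, IntegrableOn (heatIntegrand φ θ τ z) (Ioi 0) ∧
          branch φ c τ z = heatIntegral φ θ τ z := by
  have hpi := Real.pi_pos
  obtain ⟨ρ, A, B, hρ, hρR, hA, hB, hcone⟩ := h (2 / 3 * η) R (by positivity) (by linarith) hR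
  refine ⟨ρ, hρ, hρR, fun α hα hαπ => ?_⟩
  -- The first term serves the ray `θ`; the second serves `branchAngle`, which is off by at most
  -- `π/2 - η/3`.
  set μ := min ((Real.pi - α) / 2) (η / 3) with hμ_def
  have hμ1 : μ ≤ (Real.pi - α) / 2 := min_le_left _ _
  have hμ2 : μ ≤ η / 3 := min_le_right _ _
  have hμ : 0 < μ := lt_min (by linarith) (by linarith)
  refine ⟨kernelRadius B μ, kernelRadius_pos hB hμ (by linarith), fun θ hθ τ hτ z hz => ?_⟩
  rw [mem_sector_coe] at hτ
  have h1 := abs_lt.1 hτ.2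
  have hy : |τ.im - (c + Real.pi)| ≤ 3 / 2 * (Real.pi - 2 / 3 * η) := by
    rw [abs_le]
    constructor <;> linarith [hθ.1, hθ.2]
  have hadm : Admissible c (2 / 3 * η) μ B θ τ :=
    ⟨hτ.1, ⟨by linarith [hθ.1], by linarith [hθ.2]⟩, by rw [abs_le]; constructor <;> linarith⟩
  have hadm' : Admissible c (2 / 3 * η) μ B (branchAngle c τ.im) τ :=
    ⟨hτ.1, branchAngle_mem hy, by rw [branchAngle_sub]; linarith⟩
  refine ⟨integrableOn_heatIntegrand hcone hA hB hμ hadm hz, ?_⟩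
  rw [branch_eq (lt_of_le_of_lt hy (by linarith))]
  exact heatIntegral_eq_of_admissible hcone hA hB hμ hadm' hadm hz

/-- The requirements on an actual solution in a subset of the covering space. -/
structure IsSectorSolution (φ : ℂ → ℂ) (u : ℂ → ℂ → ℂ) (U : Set ℂ) (ρ : ℝ) : Prop where
  holo : HolomorphicOn u U ρ
  heat : ∀ τ ∈ U, ∀ z ∈ Metric.ball (0 : ℂ) ρ,
    deriv (fun τ' => u τ' z) τ = Complex.exp τ * iteratedDeriv 2 (fun z' => u τ z') z
  initial : ∀ z ∈ Metric.ball (0 : ℂ) ρ,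
    Tendsto (fun τ => u τ z) (comap Complex.re atBot ⊓ 𝓟 U) (𝓝 (φ z))

theorem IsSectorSolution.mono {φ : ℂ → ℂ} {u : ℂ → ℂ → ℂ} {U U' : Set ℂ} {ρ ρ' : ℝ}
    (h : IsSectorSolution φ u U ρ) (hU : U' ⊆ U) (hρ : ρ' ≤ ρ) : IsSectorSolution φ u U' ρ' where
  holo := h.holo.mono hU hρ
  heat τ hτ z hz := h.heat τ (hU hτ) z (Metric.ball_subset_ball hρ hz)
  initial z hz := (h.initial z (Metric.ball_subset_ball hρ hz)).mono_left
    (inf_le_inf_left _ (principal_mono.2 hU))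

theorem HasConeBounds.isSectorSolution {φ : ℂ → ℂ} {c : ℝ} (h : HasConeBounds φ c)
    {ε : ℝ} (hε : 0 < ε) (hεπ : ε < Real.pi) :
    ∃ r ρ : ℝ, 0 < r ∧ 0 < ρ ∧ IsSectorSolution φ (branch φ c)
      (sector (c + Real.pi) (3 * Real.pi - ε) (r : EReal)) ρ := by
  have hpi := Real.pi_pos
  -- The half-opening is `(3π - ε)/2 = (3/2)(π - ε/3)`, so `branchAngle` keeps the margin `ε/3`. It
  -- is off by less than `π/2 - ε/6`, so `μ = ε/12` leaves a strict inequality.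
  obtain ⟨ρ, A, B, hρ, -, hA, hB, hcone⟩ := h (ε / 3) 1 (by positivity) (by linarith) one_pos
  set μ := ε / 12 with hμ_def
  have hμ : 0 < μ := by positivity
  have hang : ∀ τ ∈ sector (c + Real.pi) (3 * Real.pi - ε) (kernelRadius B μ : EReal),
      Real.exp τ.re < kernelRadius B μ ∧
      branchAngle c τ.im ∈ Icc (c + ε / 3) (c + 2 * Real.pi - ε / 3) ∧
      |branchAngle c τ.im - τ.im| < Real.pi / 2 - μ := by
    intro τ hτ
    rw [mem_sector_coe] at hτ
    refine ⟨hτ.1, branchAngle_mem (by linarith), ?_⟩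
    rw [branchAngle_sub]
    linarith
  have hadm : ∀ τ ∈ sector (c + Real.pi) (3 * Real.pi - ε) (kernelRadius B μ : EReal),
      Admissible c (ε / 3) μ B (branchAngle c τ.im) τ := fun τ hτ =>
    ⟨(hang τ hτ).1, (hang τ hτ).2.1, (hang τ hτ).2.2.le⟩
  have hbr : ∀ τ ∈ sector (c + Real.pi) (3 * Real.pi - ε) (kernelRadius B μ : EReal), ∀ z,
      branch φ c τ z = heatIntegral φ (branchAngle c τ.im) τ z := fun τ hτ z =>
    branch_eq (by linarith [(mem_sector_coe.1 hτ).2]) z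
  -- The direction defining the branch varies with `t`, but near a given point it can be frozen; the
  -- derivatives of the branch are then those of an integral over a fixed ray.
  have hloc : ∀ τ ∈ sector (c + Real.pi) (3 * Real.pi - ε) (kernelRadius B μ : EReal),
      ∀ᶠ τ' in 𝓝 τ, ∀ z ∈ Metric.ball (0 : ℂ) ρ,
        branch φ c τ' z = heatIntegral φ (branchAngle c τ.im) τ' z := by
    intro τ hτ
    obtain ⟨O, hO, hO1, hO2⟩ := isOpen_admissible c (ε / 3) μ B (branchAngle c τ.im)
      (hang τ hτ).2.1
    filter_upwards [hO.mem_nhds (hO2 τ (hang τ hτ).1 (hang τ hτ).2.2),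
      (isOpen_sector _ _ _).mem_nhds hτ] with τ' h1 h2 z hz
    rw [hbr τ' h2]
    exact heatIntegral_eq_of_admissible hcone hA hB hμ (hadm τ' h2) (hO1 τ' h1) hz
  refine ⟨kernelRadius B μ, ρ / 4, kernelRadius_pos hB hμ (by linarith), by positivity,
    ?_, ?_, ?_⟩
  · rintro ⟨τ, z⟩ ⟨hτ, hz⟩
    have hz1 : z ∈ Metric.ball (0 : ℂ) ρ := Metric.ball_subset_ball (by linarith) hz
    refine DifferentiableAt.differentiableWithinAt ?_
    refine (differentiableAt_heatIntegral hcone hB hμ (hang τ hτ).2.1 (hang τ hτ).1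
      (hang τ hτ).2.2 hz1).congr_of_eventuallyEq ?_
    filter_upwards [(hloc τ hτ).prod_nhds (Metric.isOpen_ball.mem_nhds hz1)] with p hp
    exact hp.1 p.2 hp.2
  · intro τ hτ z hz
    have hz1 : z ∈ Metric.ball (0 : ℂ) ρ := Metric.ball_subset_ball (by linarith) hz
    have e1 : (fun τ' => branch φ c τ' z) =ᶠ[𝓝 τ]
        fun τ' => heatIntegral φ (branchAngle c τ.im) τ' z := by
      filter_upwards [hloc τ hτ] with τ' h' using h' z hz1
    have e2 : (fun z' => branch φ c τ z') = heatIntegral φ (branchAngle c τ.im) τ :=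
      funext (hbr τ hτ)
    rw [e1.deriv_eq, e2]
    exact deriv_heatIntegral_left hcone hρ hA hB hμ (hang τ hτ).2.1 (hang τ hτ).1
      (hang τ hτ).2.2 hz
  · intro z hz
    refine (tendsto_heatIntegral hcone hρ hA hB hμ (by linarith)
      (Metric.ball_subset_ball (by linarith) hz) hadm).congr' ?_
    filter_upwards [mem_inf_of_right (mem_principal_self _)] with τ hτ
    exact (hbr τ hτ z).symm


/-! ### The difference of the integrals over two rays enclosing a pole -/

theorem integrableOn_ray_of_eventual_decay {f : ℂ → ℂ} {θ : ℝ}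
    (hf : ∀ x ≥ 0, ContinuousAt f (ray θ x)) {C X : ℝ}
    (hC : ∀ x ≥ X, ‖f (ray θ x)‖ ≤ C / x ^ 2) :
    IntegrableOn (fun x : ℝ => f (ray θ x) * Complex.exp (θ / 2 * Complex.I)) (Ioi 0) := by
  obtain ⟨K, -, hK⟩ := exists_decay_bound (f := f) (θ₁ := θ) (θ₂ := θ) (C := C) (X := X)
    (fun x hx β hβ => by rw [Icc_self, mem_singleton_iff] at hβ; rw [hβ]; exact hf x hx)
    (fun x hx β hβ => by rw [Icc_self, mem_singleton_iff] at hβ; rw [hβ]; exact hC x hx)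
  exact integrableOn_ray_of_decay hf fun x hx => hK x hx θ ⟨le_rfl, le_rfl⟩

/-- The iterated difference quotients of `f` at `p`. -/
noncomputable def iterSlope (f : ℂ → ℂ) (p : ℂ) (i : ℕ) : ℂ → ℂ :=
  (Function.swap dslope p)^[i] f

theorem iterSlope_succ (f : ℂ → ℂ) (p : ℂ) (i : ℕ) :
    iterSlope f p (i + 1) = dslope (iterSlope f p i) p :=
  Function.iterate_succ_apply' _ _ _

theorem differentiable_iterSlope {f : ℂ → ℂ} (hf : Differentiable ℂ f) (p : ℂ) (i : ℕ) :
    Differentiable ℂ (iterSlope f p i) := by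
  induction i with
  | zero => exact hf
  | succ i ih =>
    rw [iterSlope_succ, ← differentiableOn_univ]
    exact (Complex.differentiableOn_dslope univ_mem).2 ih.differentiableOn

/-- Taylor's formula at `p` with an entire remainder; the coefficients are identified in
`iterSlope_self`. -/
theorem eq_sum_iterSlope (f : ℂ → ℂ) (p s : ℂ) (j : ℕ) :
    f s = ∑ i ∈ Finset.range j, iterSlope f p i p * (s - p) ^ i +
      (s - p) ^ j * iterSlope f p j s := by
  induction j with
  | zero => simp [iterSlope]
  | succ j ih =>
    have h := sub_smul_dslope (iterSlope f p j) p s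
    rw [smul_eq_mul, ← iterSlope_succ] at h
    rw [Finset.sum_range_succ]
    refine ih.trans ?_
    linear_combination -(s - p) ^ j * h

theorem iterSlope_self {f : ℂ → ℂ} (hf : Differentiable ℂ f) (p : ℂ) (i : ℕ) :
    iterSlope f p i p = iteratedDeriv i f p / (i.factorial : ℂ) := by
  obtain ⟨q, hq⟩ := hf.analyticAt p
  have h1 := (hq.has_fpower_series_iterate_dslope_fslope i).coeff_zero 1
  have h2 : iterSlope f p i p = q.coeff i := by
    rw [iterSlope, ← h1]
    have := FormalMultilinearSeries.coeff_iterate_fslope (p := q) i 0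
    rw [zero_add] at this
    rw [← this]
    rfl
  obtain ⟨r, hr⟩ := hq
  have h3 := hr.factorial_smul 1 i
  have h4 : (i.factorial : ℂ) ≠ 0 := Nat.cast_ne_zero.2 i.factorial_ne_zero
  rw [h2, eq_div_iff h4, iteratedDeriv_eq_iteratedFDeriv, ← h3, nsmul_eq_mul, mul_comm]
  rfl

/-- A pole of order at least `2` has a rational primitive vanishing at infinity, so its integral
does not depend on the ray. Only simple poles contribute to the difference of two rays. -/
theorem integral_inv_sub_pow {θ : ℝ} {p : ℂ} (hp : ∀ x ≥ 0, ray θ x - p ≠ 0) {m : ℕ}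
    (hi : IntegrableOn (fun x : ℝ => (((ray θ x - p) ^ (m + 2))⁻¹) *
      Complex.exp (θ / 2 * Complex.I)) (Ioi 0)) :
    rayIntegral (fun s => ((s - p) ^ (m + 2))⁻¹) θ = (((m : ℂ) + 1) * (-p) ^ (m + 1))⁻¹ := by
  have hm : ((m : ℂ) + 1) ≠ 0 := Nat.cast_add_one_ne_zero m
  let F : ℝ → ℂ := fun x => -(((m : ℂ) + 1)⁻¹ * ((ray θ x - p) ^ (m + 1))⁻¹)
  have hF : ∀ x ∈ Ici (0 : ℝ), HasDerivAt F (((ray θ x - p) ^ (m + 2))⁻¹ *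
      Complex.exp (θ / 2 * Complex.I)) x := by
    intro x hx
    have hne := hp x hx
    have h1 := ((((hasDerivAt_ray θ x).sub_const p).pow (m + 1)).inv
      (pow_ne_zero _ hne)).const_mul (((m : ℂ) + 1)⁻¹)
    refine h1.neg.congr_deriv ?_
    simp only [Pi.pow_apply]
    push_cast
    rw [show m + 2 = m + 1 + 1 by ring]
    simp only [pow_succ]
    field_simp
  have hlim : Tendsto F atTop (𝓝 0) := by
    have h1 : Tendsto (fun x : ℝ => ‖ray θ x - p‖) atTop atTop := by
      refine tendsto_atTop_mono' _ ?_ (tendsto_atTop_add_const_right _ (-‖p‖) tendsto_id)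
      filter_upwards [eventually_ge_atTop 0] with x hx
      have := norm_sub_norm_le (ray θ x) p
      rw [norm_ray hx] at this
      simp only [id]
      linarith
    have h2 : Tendsto (fun x : ℝ => ((ray θ x - p) ^ (m + 1))⁻¹) atTop (𝓝 0) := by
      rw [tendsto_zero_iff_norm_tendsto_zero]
      simp_rw [norm_inv, norm_pow]
      exact tendsto_inv_atTop_zero.comp ((tendsto_pow_atTop (Nat.succ_ne_zero m)).comp h1)
    simpa [F] using (h2.const_mul ((m : ℂ) + 1)⁻¹).neg
  have := integral_Ioi_of_hasDerivAt_of_tendsto (hF 0 self_mem_Ici).continuousAt.continuousWithinAt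
    (fun x hx => hF x (Ioi_subset_Ici_self hx)) hi hlim
  rw [rayIntegral, this]
  have e : ray θ 0 - p = -p := by simp [ray]
  simp only [F, e]
  rw [mul_inv]
  ring

theorem log_neg_sub_log {w : ℂ} : (0 < w.im → Complex.log (-w) - Complex.log w = -(Real.pi * Complex.I)) ∧
    (w.im < 0 → Complex.log (-w) - Complex.log w = Real.pi * Complex.I) := by
  constructor
  · intro h
    rw [Complex.log, Complex.log, norm_neg, Complex.arg_neg_eq_arg_sub_pi_of_im_pos h]
    push_cast
    ring
  · intro h
    rw [Complex.log, Complex.log, norm_neg, Complex.arg_neg_eq_arg_add_pi_of_im_neg h]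
    push_cast
    ring

theorem mem_slitPlane_of_im_ne {w : ℂ} (h : w.im ≠ 0) : w ∈ Complex.slitPlane := Or.inr h

/-- The primitive is `log(1 - xw) - log(1 + xw)`. Both arguments stay in the slit plane because `w`
is not real, and at infinity the common positive factor `x` cancels. -/
theorem integral_pole_log {w : ℂ} (hw : w.im ≠ 0)
    (hi : IntegrableOn (fun x : ℝ => w / (x * w - 1) - w / (x * w + 1)) (Ioi 0)) :
    ∫ x in Ioi (0 : ℝ), (w / (x * w - 1) - w / (x * w + 1)) =
      Complex.log (-w) - Complex.log w := by
  let F : ℝ → ℂ := fun x => Complex.log (1 - x * w) - Complex.log (1 + x * w)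
  have hslit : ∀ x : ℝ, 0 ≤ x → 1 - x * w ∈ Complex.slitPlane ∧ 1 + x * w ∈ Complex.slitPlane := by
    intro x hx
    rcases hx.eq_or_lt with rfl | hx
    · simp
    · constructor <;> refine mem_slitPlane_of_im_ne ?_ <;> simp [hx.ne', hw]
  have hF : ∀ x ∈ Ici (0 : ℝ), HasDerivAt F (w / (x * w - 1) - w / (x * w + 1)) x := by
    intro x hx
    obtain ⟨h1, h2⟩ := hslit x hx
    have hx' : HasDerivAt (fun x : ℝ => (x : ℂ) * w) w x := by
      exact ((Complex.ofRealCLM.hasDerivAt (x := x)).mul_const w).congr_deriv (by simp)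
    refine (((hx'.const_sub 1).clog_real h1).sub ((hx'.const_add 1).clog_real h2)).congr_deriv ?_
    have n1 : (1 - x * w : ℂ) ≠ 0 := Complex.slitPlane_ne_zero h1
    have n2 : (1 + x * w : ℂ) ≠ 0 := Complex.slitPlane_ne_zero h2
    have n3 : (x * w - 1 : ℂ) = -(1 - x * w) := by ring
    rw [n3, div_neg, neg_div, add_comm (x * w : ℂ) 1]
  have hlim : Tendsto F atTop (𝓝 (Complex.log (-w) - Complex.log w)) := by
    have hinv : Tendsto (fun x : ℝ => ((x⁻¹ : ℝ) : ℂ)) atTop (𝓝 0) := by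
      have := (Complex.continuous_ofReal.tendsto 0).comp tendsto_inv_atTop_zero
      rw [Complex.ofReal_zero] at this
      exact this
    have t1 : Tendsto (fun x : ℝ => Complex.log ((x⁻¹ : ℝ) - w)) atTop (𝓝 (Complex.log (-w))) := by
      have := hinv.sub_const w
      rw [zero_sub] at this
      exact this.clog (mem_slitPlane_of_im_ne (by simpa using hw))
    have t2 : Tendsto (fun x : ℝ => Complex.log ((x⁻¹ : ℝ) + w)) atTop (𝓝 (Complex.log w)) := by
      have := hinv.add_const w
      rw [zero_add] at this
      exact this.clog (mem_slitPlane_of_im_ne hw)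
    refine (t1.sub t2).congr' ?_
    filter_upwards [eventually_gt_atTop 0] with x hx
    have e1 : (1 - x * w : ℂ) = (x : ℂ) * ((x⁻¹ : ℝ) - w) := by
      have : (x : ℂ) ≠ 0 := Complex.ofReal_ne_zero.2 hx.ne'
      push_cast
      field_simp
    have e2 : (1 + x * w : ℂ) = (x : ℂ) * ((x⁻¹ : ℝ) + w) := by
      have : (x : ℂ) ≠ 0 := Complex.ofReal_ne_zero.2 hx.ne'
      push_cast
      field_simp
    have n1 : (((x⁻¹ : ℝ) : ℂ) - w) ≠ 0 := fun h => hw (by simpa using congrArg Complex.im h)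
    have n2 : (((x⁻¹ : ℝ) : ℂ) + w) ≠ 0 := fun h => hw (by simpa using congrArg Complex.im h)
    simp only [F]
    rw [e1, e2, Complex.log_ofReal_mul hx n1, Complex.log_ofReal_mul hx n2]
    ring
  have := integral_Ioi_of_hasDerivAt_of_tendsto (hF 0 self_mem_Ici).continuousAt.continuousWithinAt
    (fun x hx => hF x (Ioi_subset_Ici_self hx)) hi hlim
  rw [this]
  simp [F]

/-- `1/(s - p) - 1/(s + p)`. -/
noncomputable def poleKernel (p s : ℂ) : ℂ := (s - p)⁻¹ - (s + p)⁻¹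

theorem half_le_norm_sub {θ x : ℝ} {p : ℂ} (hx : 2 * ‖p‖ + 2 ≤ x) :
    x / 2 ≤ ‖ray θ x - p‖ ∧ x / 2 ≤ ‖ray θ x + p‖ := by
  have hx0 : 0 ≤ x := by linarith [norm_nonneg p]
  have h1 := norm_sub_norm_le (ray θ x) p
  have h2 := norm_sub_norm_le (ray θ x) (-p)
  rw [norm_ray hx0] at h1 h2
  rw [norm_neg, sub_neg_eq_add] at h2
  constructor <;> linarith

theorem norm_inv_pow_le {θ x : ℝ} {p : ℂ} (hx : 2 * ‖p‖ + 2 ≤ x) (m : ℕ) :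
    ‖((ray θ x - p) ^ (m + 2))⁻¹‖ ≤ 4 / x ^ 2 := by
  have h1 := (half_le_norm_sub (θ := θ) hx).1
  have hx1 : 1 ≤ x / 2 := by linarith [norm_nonneg p]
  have h2 : (x / 2) ^ 2 ≤ ‖ray θ x - p‖ ^ (m + 2) :=
    (pow_le_pow_right₀ hx1 (by omega)).trans (pow_le_pow_left₀ (by linarith) h1 _)
  rw [norm_inv, norm_pow]
  calc (‖ray θ x - p‖ ^ (m + 2))⁻¹ ≤ ((x / 2) ^ 2)⁻¹ := by gcongr
    _ = 4 / x ^ 2 := by rw [div_pow, inv_div]; norm_num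

/-- A simple pole alone is not integrable at infinity; subtracting the opposite pole leaves `2p /
((s - p)(s + p))`. -/
theorem norm_poleKernel_le {θ x : ℝ} {p : ℂ} (hx : 2 * ‖p‖ + 2 ≤ x) :
    ‖poleKernel p (ray θ x)‖ ≤ 8 * ‖p‖ / x ^ 2 := by
  obtain ⟨h1, h2⟩ := half_le_norm_sub (θ := θ) hx
  have hx1 : 1 ≤ x / 2 := by linarith [norm_nonneg p]
  have n1 : ray θ x - p ≠ 0 := norm_pos_iff.1 (by linarith)
  have n2 : ray θ x + p ≠ 0 := norm_pos_iff.1 (by linarith)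
  have e : poleKernel p (ray θ x) = 2 * p * ((ray θ x - p)⁻¹ * (ray θ x + p)⁻¹) := by
    rw [poleKernel]
    field_simp
    ring
  rw [e, norm_mul, norm_mul, norm_mul, norm_inv, norm_inv, Complex.norm_ofNat]
  calc 2 * ‖p‖ * (‖ray θ x - p‖⁻¹ * ‖ray θ x + p‖⁻¹)
      ≤ 2 * ‖p‖ * ((x / 2)⁻¹ * (x / 2)⁻¹) := by gcongr
    _ = _ := by
      have : x ≠ 0 := by linarith
      field_simp
      ring

theorem continuousAt_inv_sub_pow {θ x : ℝ} {p : ℂ} (hp : ray θ x - p ≠ 0) (m : ℕ) :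
    ContinuousAt (fun s : ℂ => ((s - p) ^ m)⁻¹) (ray θ x) :=
  ContinuousAt.inv₀ (by fun_prop) (pow_ne_zero _ hp)

theorem ray_mul_exp_neg (θ β x : ℝ) :
    (ray θ x * Complex.exp ((-(β / 2) : ℝ) * Complex.I)).im = x * Real.sin ((θ - β) / 2) := by
  have e : ray θ x * Complex.exp ((-(β / 2) : ℝ) * Complex.I) =
      x * Complex.exp (((θ - β) / 2 : ℝ) * Complex.I) := by
    rw [ray, mul_assoc, ← Complex.exp_add]
    congr 2
    push_cast
    ring
  rw [e, Complex.im_ofReal_mul, Complex.exp_ofReal_mul_I_im]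

theorem ray_ne_of_im_ne {θ x : ℝ} {p : ℂ}
    (hp : (p * Complex.exp ((-(θ / 2) : ℝ) * Complex.I)).im ≠ 0) :
    ray θ x - p ≠ 0 ∧ ray θ x + p ≠ 0 := by
  have h := ray_mul_exp_neg θ θ x
  rw [sub_self, zero_div, Real.sin_zero, mul_zero] at h
  constructor
  · intro e
    rw [sub_eq_zero] at e
    rw [e] at h
    exact hp h
  · intro e
    rw [add_eq_zero_iff_eq_neg] at e
    rw [e, neg_mul, Complex.neg_im, neg_eq_zero] at h
    exact hp h

/-- With `w = e^{iθ/2} / p` this is the logarithmic integral above. The sign records the side of the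
line of direction `θ/2` on which `p` lies, `Im w` being of the opposite sign to `Im(p e^{-iθ/2})`.
-/
theorem rayIntegral_poleKernel {θ : ℝ} {p : ℂ}
    (hp : (p * Complex.exp ((-(θ / 2) : ℝ) * Complex.I)).im ≠ 0) :
    IntegrableOn (fun x : ℝ => poleKernel p (ray θ x) * Complex.exp (θ / 2 * Complex.I)) (Ioi 0) ∧
    ((p * Complex.exp ((-(θ / 2) : ℝ) * Complex.I)).im < 0 →
      rayIntegral (poleKernel p) θ = -(Real.pi * Complex.I)) ∧
    (0 < (p * Complex.exp ((-(θ / 2) : ℝ) * Complex.I)).im →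
      rayIntegral (poleKernel p) θ = Real.pi * Complex.I) := by
  have hp0 : p ≠ 0 := by
    rintro rfl
    simp at hp
  have hi : IntegrableOn (fun x : ℝ => poleKernel p (ray θ x) * Complex.exp (θ / 2 * Complex.I))
      (Ioi 0) := by
    refine integrableOn_ray_of_eventual_decay (f := poleKernel p) (fun x _ => ?_)
      fun x hx => norm_poleKernel_le hx
    obtain ⟨h1, h2⟩ := ray_ne_of_im_ne (x := x) hp
    exact ContinuousAt.sub (ContinuousAt.inv₀ (by fun_prop) h1) (ContinuousAt.inv₀ (by fun_prop) h2)
  set e := Complex.exp (θ / 2 * Complex.I) with he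
  have hew : Complex.exp ((-(θ / 2) : ℝ) * Complex.I) = e⁻¹ := by
    rw [he, ← Complex.exp_neg]
    congr 1
    push_cast
    ring
  set w := e / p with hw
  have he0 : e ≠ 0 := Complex.exp_ne_zero _
  have hfun : ∀ x : ℝ, poleKernel p (ray θ x) * e = w / (x * w - 1) - w / (x * w + 1) := by
    intro x
    obtain ⟨h1, h2⟩ := ray_ne_of_im_ne (x := x) hp
    have hr : ray θ x = x * e := rfl
    have e1 : (x * w - 1 : ℂ) = (ray θ x - p) / p := by rw [hr, hw]; field_simp
    have e2 : (x * w + 1 : ℂ) = (ray θ x + p) / p := by rw [hr, hw]; field_simp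
    rw [e1, e2, hw, poleKernel]
    field_simp
  have hwi : w = (p * e⁻¹)⁻¹ := by rw [hw]; field_simp
  have hne : p * e⁻¹ ≠ 0 := mul_ne_zero hp0 (inv_ne_zero he0)
  have him : w.im = -(p * e⁻¹).im / Complex.normSq (p * e⁻¹) := by rw [hwi, Complex.inv_im]
  have hns := Complex.normSq_pos.2 hne
  rw [hew] at hp ⊢
  have hw0 : w.im ≠ 0 := by
    rw [him]
    exact div_ne_zero (neg_ne_zero.2 hp) hns.ne'
  have hint : rayIntegral (poleKernel p) θ = Complex.log (-w) - Complex.log w := by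
    rw [← integral_pole_log hw0 (hi.congr_fun (fun x _ => hfun x) measurableSet_Ioi), rayIntegral]
    exact setIntegral_congr_fun measurableSet_Ioi fun x _ => hfun x
  refine ⟨hi, fun h => ?_, fun h => ?_⟩
  · rw [hint]
    exact log_neg_sub_log.1 (by rw [him]; exact div_pos (by linarith) hns)
  · rw [hint]
    exact log_neg_sub_log.2 (by rw [him]; exact div_neg_of_neg_of_pos (by linarith) hns)

/-- The residue formula for the difference of two integrals over rays. -/
theorem rayIntegral_sub_of_pole {E : ℂ → ℂ} (hE : Differentiable ℂ E) {θ₁ θ₂ M : ℝ}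
    (h12 : θ₁ ≤ θ₂) (hopen : θ₂ - θ₁ ≤ 2 * Real.pi)
    (hM : ∀ x ≥ 0, ∀ θ ∈ Icc θ₁ θ₂, ‖E (ray θ x)‖ ≤ M * (1 + x ^ 2)⁻¹) {p : ℂ}
    (hp₁ : 0 < (p * Complex.exp ((-(θ₁ / 2) : ℝ) * Complex.I)).im)
    (hp₂ : (p * Complex.exp ((-(θ₂ / 2) : ℝ) * Complex.I)).im < 0) (k : ℕ) :
    (∀ θ ∈ ({θ₁, θ₂} : Set ℝ), IntegrableOn (fun x : ℝ => E (ray θ x) / (ray θ x - p) ^ (k + 1) *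
      Complex.exp (θ / 2 * Complex.I)) (Ioi 0)) ∧
    rayIntegral (fun s => E s / (s - p) ^ (k + 1)) θ₂ -
      rayIntegral (fun s => E s / (s - p) ^ (k + 1)) θ₁ =
      -(2 * Real.pi * Complex.I) * (iteratedDeriv k E p / (k.factorial : ℂ)) := by
  have hM0 : 0 ≤ M := by
    have := (norm_nonneg _).trans (hM 0 le_rfl θ₁ ⟨le_rfl, h12⟩)
    simpa using this
  -- The auxiliary pole `-p` is off the cone: after rotation by `e^{-iθ₁/2}` the cone lies in the
  -- closed upper half-plane and `-p` strictly below it.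
  have hneg : ∀ x ≥ 0, ∀ θ ∈ Icc θ₁ θ₂, ray θ x + p ≠ 0 := by
    intro x hx θ hθ e
    have h := ray_mul_exp_neg θ θ₁ x
    rw [add_eq_zero_iff_eq_neg] at e
    rw [e, neg_mul, Complex.neg_im] at h
    have : 0 ≤ Real.sin ((θ - θ₁) / 2) :=
      Real.sin_nonneg_of_nonneg_of_le_pi (by linarith [hθ.1]) (by linarith [hθ.2])
    have := mul_nonneg hx this
    linarith
  set e := iterSlope E p k p with he
  -- The part without singularity in the cone: the Taylor remainder, plus the term `e / (s + p)`
  -- that compensates the pole added in `poleKernel`.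
  let R : ℂ → ℂ := fun s => iterSlope E p (k + 1) s + e * (s + p)⁻¹
  have hRd : ∀ x ≥ 0, ∀ θ ∈ Icc θ₁ θ₂, DifferentiableAt ℂ R (ray θ x) := by
    intro x hx θ hθ
    refine ((differentiable_iterSlope hE p (k + 1)) _).add ?_
    exact ((differentiableAt_id.add_const p).inv (hneg x hx θ hθ)).const_mul e
  have hdec : ∀ s : ℂ, s - p ≠ 0 → E s / (s - p) ^ (k + 1) =
      R s + ∑ i ∈ Finset.range k, iterSlope E p i p * ((s - p) ^ (k - 1 - i + 2))⁻¹ +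
        e * poleKernel p s := by
    intro s hs
    have h1 := eq_sum_iterSlope E p s (k + 1)
    rw [Finset.sum_range_succ, ← he] at h1
    have h2 : E s / (s - p) ^ (k + 1) = (∑ i ∈ Finset.range k, iterSlope E p i p * (s - p) ^ i) /
        (s - p) ^ (k + 1) + e * (s - p)⁻¹ + iterSlope E p (k + 1) s := by
      rw [div_eq_iff (pow_ne_zero _ hs), h1]
      have := pow_ne_zero k hs
      rw [pow_succ]
      field_simp
    have h3 : ∀ i ∈ Finset.range k, iterSlope E p i p * (s - p) ^ i / (s - p) ^ (k + 1) =
        iterSlope E p i p * ((s - p) ^ (k - 1 - i + 2))⁻¹ := by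
      intro i hi
      have hi' := Finset.mem_range.1 hi
      rw [show k + 1 = i + (k - 1 - i + 2) by omega, pow_add]
      have := pow_ne_zero i hs
      field_simp
    rw [h2, Finset.sum_div, Finset.sum_congr rfl h3, poleKernel]
    simp only [R]
    ring
  -- The two summands of `R` need not decay quadratically by themselves; `R` does, because all the
  -- other terms of the decomposition do.
  have hRb : ∀ x ≥ 2 * ‖p‖ + 2, ∀ θ ∈ Icc θ₁ θ₂, ‖R (ray θ x)‖ ≤
      (M + ∑ i ∈ Finset.range k, ‖iterSlope E p i p‖ * 4 + ‖e‖ * (8 * ‖p‖)) / x ^ 2 := by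
    intro x hx θ hθ
    have hx1 : 1 ≤ x / 2 := by linarith [norm_nonneg p]
    have h1 := (half_le_norm_sub (θ := θ) hx).1
    have hne : ray θ x - p ≠ 0 := norm_pos_iff.1 (by linarith)
    have h2 : R (ray θ x) = E (ray θ x) / (ray θ x - p) ^ (k + 1) -
        ∑ i ∈ Finset.range k, iterSlope E p i p * ((ray θ x - p) ^ (k - 1 - i + 2))⁻¹ -
        e * poleKernel p (ray θ x) := by
      rw [hdec _ hne]
      ring
    have b1 : ‖E (ray θ x) / (ray θ x - p) ^ (k + 1)‖ ≤ M / x ^ 2 := by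
      rw [norm_div, norm_pow]
      have h3 : 1 ≤ ‖ray θ x - p‖ ^ (k + 1) := one_le_pow₀ (by linarith)
      refine (div_le_self (norm_nonneg _) h3).trans ((hM x (by linarith) θ hθ).trans ?_)
      have hx0 : 0 < x := by linarith
      rw [div_eq_mul_inv]
      gcongr
      linarith
    have b2 : ‖∑ i ∈ Finset.range k, iterSlope E p i p * ((ray θ x - p) ^ (k - 1 - i + 2))⁻¹‖ ≤
        (∑ i ∈ Finset.range k, ‖iterSlope E p i p‖ * 4) / x ^ 2 := by
      rw [Finset.sum_div]
      refine (norm_sum_le _ _).trans (Finset.sum_le_sum fun i _ => ?_)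
      rw [norm_mul, mul_div_assoc]
      gcongr
      exact norm_inv_pow_le hx _
    have b3 : ‖e * poleKernel p (ray θ x)‖ ≤ ‖e‖ * (8 * ‖p‖) / x ^ 2 := by
      rw [norm_mul, mul_div_assoc]
      gcongr
      exact norm_poleKernel_le hx
    rw [h2, add_div, add_div]
    exact (norm_sub_le _ _).trans (add_le_add ((norm_sub_le _ _).trans (add_le_add b1 b2)) b3)
  have hray : ∀ θ ∈ Icc θ₁ θ₂, (p * Complex.exp ((-(θ / 2) : ℝ) * Complex.I)).im ≠ 0 →
      IntegrableOn (fun x : ℝ => E (ray θ x) / (ray θ x - p) ^ (k + 1) *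
        Complex.exp (θ / 2 * Complex.I)) (Ioi 0) ∧
      rayIntegral (fun s => E s / (s - p) ^ (k + 1)) θ = rayIntegral R θ +
        ∑ i ∈ Finset.range k, iterSlope E p i p *
          ((((k - 1 - i : ℕ) : ℂ) + 1) * (-p) ^ (k - 1 - i + 1))⁻¹ +
        e * rayIntegral (poleKernel p) θ := by
    intro θ hθ him
    have hne : ∀ x ≥ (0 : ℝ), ray θ x - p ≠ 0 := fun x _ => (ray_ne_of_im_ne him).1
    have iR := integrableOn_ray_of_eventual_decay (fun x hx => (hRd x hx θ hθ).continuousAt)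
      fun x hx => hRb x hx θ hθ
    have iP : ∀ m : ℕ, IntegrableOn (fun x : ℝ => ((ray θ x - p) ^ (m + 2))⁻¹ *
        Complex.exp (θ / 2 * Complex.I)) (Ioi 0) := fun m =>
      integrableOn_ray_of_eventual_decay (f := fun s => ((s - p) ^ (m + 2))⁻¹)
        (fun x hx => continuousAt_inv_sub_pow (hne x hx) _) fun x hx => norm_inv_pow_le hx m
    have iK := (rayIntegral_poleKernel him).1
    have hpt : ∀ x ∈ Ioi (0 : ℝ), E (ray θ x) / (ray θ x - p) ^ (k + 1) *
        Complex.exp (θ / 2 * Complex.I) = R (ray θ x) * Complex.exp (θ / 2 * Complex.I) +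
        ∑ i ∈ Finset.range k, iterSlope E p i p * (((ray θ x - p) ^ (k - 1 - i + 2))⁻¹ *
          Complex.exp (θ / 2 * Complex.I)) +
        e * (poleKernel p (ray θ x) * Complex.exp (θ / 2 * Complex.I)) := by
      intro x hx
      rw [hdec _ (hne x (le_of_lt hx)), add_mul, add_mul, Finset.sum_mul]
      simp only [mul_assoc]
    have iS : Integrable (fun x : ℝ => ∑ i ∈ Finset.range k, iterSlope E p i p *
        (((ray θ x - p) ^ (k - 1 - i + 2))⁻¹ * Complex.exp (θ / 2 * Complex.I)))
        (volume.restrict (Ioi 0)) :=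
      integrable_finsetSum _ fun i _ => (iP _).const_mul _
    have iRS : Integrable (fun x : ℝ => R (ray θ x) * Complex.exp (θ / 2 * Complex.I) +
        ∑ i ∈ Finset.range k, iterSlope E p i p * (((ray θ x - p) ^ (k - 1 - i + 2))⁻¹ *
          Complex.exp (θ / 2 * Complex.I))) (volume.restrict (Ioi 0)) := Integrable.add iR iS
    constructor
    · exact IntegrableOn.congr_fun (Integrable.add iRS (iK.const_mul e))
        (fun x hx => (hpt x hx).symm) measurableSet_Ioi
    · rw [rayIntegral, setIntegral_congr_fun measurableSet_Ioi hpt,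
        integral_add iRS (iK.const_mul e), integral_add iR iS, integral_const_mul,
        integral_finsetSum _ fun i _ => (iP _).const_mul _]
      congr 2
      refine Finset.sum_congr rfl fun i _ => ?_
      rw [integral_const_mul]
      congr 1
      exact integral_inv_sub_pow hne (iP _)
  obtain ⟨i1, r1⟩ := hray θ₁ ⟨le_rfl, h12⟩ hp₁.ne'
  obtain ⟨i2, r2⟩ := hray θ₂ ⟨h12, le_rfl⟩ hp₂.ne
  refine ⟨?_, ?_⟩
  · rintro θ (rfl | rfl)
    · exact i1
    · exact i2
  -- The regular part and the higher poles cancel; the simple pole gives `-πi - πi`.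
  · rw [r1, r2, rayIntegral_eq_of_holomorphic h12 hRd hRb,
      (rayIntegral_poleKernel hp₁.ne').2.2 hp₁, (rayIntegral_poleKernel hp₂.ne).2.1 hp₂, he,
      iterSlope_self hE]
    ring


/-! ### The jump -/

/-- The jump across the Stokes line of direction `2 arg z₀`. -/
noncomputable def jumpFn (n : ℕ) (a : ℤ → ℂ) (z₀ τ z : ℂ) : ℂ :=
  -Complex.I * sqrtPiDiv τ *
    ∑ k ∈ Finset.range n, a ((k : ℤ) - n) / ((n - k - 1).factorial : ℂ) *
      gaussDeriv (n - k - 1) τ (z₀ - z)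

namespace IsPolar

variable {n : ℕ} {a : ℤ → ℂ} {z₀ : ℂ} {δ : ℝ} {ψ φ : ℂ → ℂ}

/-- Rotated by `e^{-iδ/2}`, the ray lies in the right half-plane and `z₀` becomes `‖z₀‖`. -/
theorem norm_le_norm_ray_add (h : IsPolar n a z₀ δ ψ φ) {θ x : ℝ} (hx : 0 ≤ x)
    (hθ : |θ - δ| ≤ Real.pi) : ‖z₀‖ ≤ ‖ray θ x + z₀‖ := by
  have e : (ray θ x + z₀) * Complex.exp ((-(δ / 2) : ℝ) * Complex.I) =
      x * Complex.exp (((θ - δ) / 2 : ℝ) * Complex.I) + ‖z₀‖ := by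
    rw [add_mul, ray, mul_assoc, ← Complex.exp_add]
    conv_lhs => rw [h.polar]
    rw [mul_assoc, ← Complex.exp_add]
    have e1 : ((δ / 2 : ℝ) * Complex.I + ((-(δ / 2) : ℝ) : ℂ) * Complex.I : ℂ) = 0 := by
      push_cast; ring
    have e2 : (θ / 2 * Complex.I + ((-(δ / 2) : ℝ) : ℂ) * Complex.I : ℂ) =
        ((θ - δ) / 2 : ℝ) * Complex.I := by
      push_cast; ring
    rw [e1, e2, Complex.exp_zero, mul_one]
  have e2 : ‖ray θ x + z₀‖ = ‖(ray θ x + z₀) * Complex.exp ((-(δ / 2) : ℝ) * Complex.I)‖ := by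
    rw [norm_mul, Complex.norm_exp_ofReal_mul_I, mul_one]
  rw [e2, e]
  refine le_trans ?_ (Complex.re_le_norm _)
  rw [Complex.add_re, Complex.re_ofReal_mul, Complex.exp_ofReal_mul_I_re, Complex.ofReal_re]
  have h1 := abs_le.1 hθ
  have : 0 ≤ Real.cos ((θ - δ) / 2) := Real.cos_nonneg_of_mem_Icc ⟨by linarith, by linarith⟩
  linarith [mul_nonneg hx this]

/-- The part of the heat integrand without singularity in the directions around `δ/2`. -/
theorem exists_regular_bound (h : IsPolar n a z₀ δ ψ φ) :
    ∃ A B : ℝ, 0 < A ∧ 0 < B ∧ ∀ z ∈ Metric.ball (0 : ℂ) (‖z₀‖ / 2), ∀ x ≥ 0, ∀ θ : ℝ,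
      |θ - δ| ≤ Real.pi → DifferentiableAt ℂ (fun s => ψ (z + s) + φ (z - s)) (ray θ x) ∧
        ‖ψ (z + ray θ x) + φ (z - ray θ x)‖ ≤ A * Real.exp (B * x ^ 2) := by
  have hz0 := h.norm_pos
  obtain ⟨A, B, hA, hB, hAB⟩ := h.exists_bound (half_pos hz0)
  obtain ⟨hψ, C₁, C₂, hC₁, hC₂, hC⟩ := h.growth
  refine ⟨(A + C₁) * Real.exp ((B + C₂) * (2 * ‖z₀‖ ^ 2)), (B + C₂) * 2, by positivity,
    by positivity, fun z hz x hx θ hθ => ?_⟩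
  rw [mem_ball_zero_iff] at hz
  have hd : ‖z₀‖ / 2 ≤ ‖z - ray θ x - z₀‖ := by
    have h1 := h.norm_le_norm_ray_add hx hθ
    have h2 := norm_sub_norm_le (ray θ x + z₀) z
    have e : z - ray θ x - z₀ = -(ray θ x + z₀ - z) := by ring
    rw [e, norm_neg]
    linarith
  have hn : ∀ w : ℂ, ‖w‖ ^ 2 = x ^ 2 → ‖z + w‖ ^ 2 ≤ 2 * ‖z₀‖ ^ 2 + 2 * x ^ 2 := by
    intro w hw
    have h4 : ‖z + w‖ ^ 2 ≤ (‖z‖ + ‖w‖) ^ 2 := by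
      gcongr
      exact norm_add_le _ _
    have h6 : ‖z‖ ^ 2 ≤ ‖z₀‖ ^ 2 := by
      gcongr
      linarith
    nlinarith [sq_nonneg (‖z‖ - ‖w‖)]
  constructor
  · refine DifferentiableAt.add ?_ ?_
    · exact DifferentiableAt.comp (ray θ x) (f := fun s : ℂ => z + s) hψ.differentiableAt
        (by fun_prop)
    · refine DifferentiableAt.comp (ray θ x) (f := fun s : ℂ => z - s) (h.differentiableAt ?_)
        (by fun_prop)
      intro e
      rw [e, sub_self, norm_zero] at hd
      linarith
  · have h1 := hAB _ hd
    have h2 := hC (z + ray θ x)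
    rw [Real.rpow_two] at h2
    have n1 := hn (ray θ x) (norm_ray_sq θ x)
    have n2 := hn (-ray θ x) (by rw [norm_neg]; exact norm_ray_sq θ x)
    rw [← sub_eq_add_neg] at n2
    have e1 : Real.exp (B * ‖z - ray θ x‖ ^ 2) ≤
        Real.exp ((B + C₂) * (2 * ‖z₀‖ ^ 2 + 2 * x ^ 2)) := by
      refine Real.exp_le_exp.2 (mul_le_mul (by linarith) n2 (by positivity) (by positivity))
    have e2 : Real.exp (C₂ * ‖z + ray θ x‖ ^ 2) ≤
        Real.exp ((B + C₂) * (2 * ‖z₀‖ ^ 2 + 2 * x ^ 2)) := by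
      refine Real.exp_le_exp.2 (mul_le_mul (by linarith) n1 (by positivity) (by positivity))
    calc _ ≤ ‖ψ (z + ray θ x)‖ + ‖φ (z - ray θ x)‖ := norm_add_le _ _
      _ ≤ C₁ * Real.exp ((B + C₂) * (2 * ‖z₀‖ ^ 2 + 2 * x ^ 2)) +
          A * Real.exp ((B + C₂) * (2 * ‖z₀‖ ^ 2 + 2 * x ^ 2)) :=
        add_le_add (h2.trans (by gcongr)) (h1.trans (by gcongr))
      _ = _ := by
        rw [mul_assoc, ← Real.exp_add]
        ring_nf

/-- Between the two rays only the principal part of `φ(z + s)` is singular, at `p = z₀ - z`. The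
rest, `ψ(z + s) + φ(z - s)`, times the Gaussian, has the same integral over both rays. -/
theorem heatIntegral_sub (h : IsPolar n a z₀ δ ψ φ) {η : ℝ} (hη : 0 < η) (hη' : η < Real.pi / 2) :
    ∃ r ρ : ℝ, 0 < r ∧ 0 < ρ ∧ ∀ τ : ℂ, Real.exp τ.re < r → |τ.im - δ| ≤ Real.pi / 2 - 2 * η →
      ∀ z ∈ Metric.ball (0 : ℂ) ρ,
        heatIntegral φ (δ + η) τ z - heatIntegral φ (δ - η) τ z = jumpFn n a z₀ τ z := by
  have hpi := Real.pi_pos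
  have hz0 := h.norm_pos
  obtain ⟨A, B, hA, hB, hreg⟩ := h.exists_regular_bound
  have hsin : 0 < Real.sin (η / 2) := Real.sin_pos_of_pos_of_lt_pi (by linarith) (by linarith)
  -- The second bound on `‖z‖` keeps `p` strictly between the two rays.
  refine ⟨kernelRadius B η, min (‖z₀‖ / 2) (‖z₀‖ * Real.sin (η / 2)),
    kernelRadius_pos hB hη (by linarith), lt_min (by linarith) (by positivity),
    fun τ hr hτ z hz => ?_⟩
  have hz1 : z ∈ Metric.ball (0 : ℂ) (‖z₀‖ / 2) :=
    Metric.ball_subset_ball (min_le_left _ _) hz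
  have hz2 : ‖z‖ < ‖z₀‖ * Real.sin (η / 2) :=
    (mem_ball_zero_iff.1 hz).trans_le (min_le_right _ _)
  -- Only the Gaussian bound is wanted here; the range `[δ - π, δ + π]` makes the condition on the
  -- direction harmless.
  have hadm : ∀ θ ∈ Icc (δ - η) (δ + η), Admissible (δ - Real.pi) 0 η B θ τ := by
    intro θ hθ
    have h1 := abs_le.1 hτ
    refine ⟨hr, ⟨by linarith [hθ.1], by linarith [hθ.2]⟩, ?_⟩
    rw [abs_le]
    constructor <;> linarith [hθ.1, hθ.2]
  have hδ : ∀ θ ∈ Icc (δ - η) (δ + η), |θ - δ| ≤ Real.pi := by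
    intro θ hθ
    rw [abs_le]
    constructor <;> linarith [hθ.1, hθ.2]
  set p := z₀ - z with hp
  let E : ℂ → ℂ := fun s => Complex.exp (-s ^ 2 / (4 * Complex.exp τ))
  have hE : Differentiable ℂ E := by
    intro s
    have : ∀ s : ℂ, 4 * Complex.exp τ ≠ 0 := fun s =>
      mul_ne_zero (by norm_num) (Complex.exp_ne_zero _)
    fun_prop
  let G : ℂ → ℂ := fun s => (ψ (z + s) + φ (z - s)) * E s
  have hGd : ∀ x ≥ 0, ∀ θ ∈ Icc (δ - η) (δ + η), DifferentiableAt ℂ G (ray θ x) := fun x hx θ hθ =>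
    (hreg z hz1 x hx θ (hδ θ hθ)).1.fun_mul (hE _)
  have hGb : ∀ x ≥ 1, ∀ θ ∈ Icc (δ - η) (δ + η), ‖G (ray θ x)‖ ≤ A / x ^ 2 := by
    intro x hx θ hθ
    have hx0 : 0 < x := by linarith
    refine ((hadm θ hθ).norm_mul_gaussian_le hB hη
      (hreg z hz1 x hx0.le θ (hδ θ hθ)).2).trans ?_
    rw [div_eq_mul_inv]
    refine mul_le_mul_of_nonneg_left ((exp_neg_sq_le x).trans ?_) hA.le
    gcongr
    linarith
  have hGi : ∀ θ ∈ Icc (δ - η) (δ + η), IntegrableOn (fun x : ℝ => G (ray θ x) *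
      Complex.exp (θ / 2 * Complex.I)) (Ioi 0) := fun θ hθ =>
    integrableOn_ray_of_eventual_decay (fun x hx => (hGd x hx θ hθ).continuousAt)
      fun x hx => hGb x hx θ hθ
  have hEb : ∀ x ≥ 0, ∀ θ ∈ Icc (δ - η) (δ + η), ‖E (ray θ x)‖ ≤ 1 * (1 + x ^ 2)⁻¹ := by
    intro x hx θ hθ
    rw [one_mul]
    refine ((hadm θ hθ).norm_gaussian_le hB hη x).trans ((Real.exp_le_exp.2 ?_).trans
      (exp_neg_sq_le x))
    nlinarith [sq_nonneg x, mul_nonneg hB.le (sq_nonneg x)]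
  have him : ∀ β : ℝ, ‖z₀‖ * Real.sin ((δ - β) / 2) - ‖z‖ ≤
      (p * Complex.exp ((-(β / 2) : ℝ) * Complex.I)).im ∧
      (p * Complex.exp ((-(β / 2) : ℝ) * Complex.I)).im ≤
        ‖z₀‖ * Real.sin ((δ - β) / 2) + ‖z‖ := by
    intro β
    have e1 : z₀ = ray δ ‖z₀‖ := by
      rw [ray]
      conv_lhs => rw [h.polar]
      push_cast
      rfl
    have e2 : (p * Complex.exp ((-(β / 2) : ℝ) * Complex.I)).im =
        ‖z₀‖ * Real.sin ((δ - β) / 2) - (z * Complex.exp ((-(β / 2) : ℝ) * Complex.I)).im := by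
      rw [← ray_mul_exp_neg, ← e1, hp, sub_mul, Complex.sub_im]
    have e3 : ‖z * Complex.exp ((-(β / 2) : ℝ) * Complex.I)‖ = ‖z‖ := by
      rw [norm_mul, Complex.norm_exp_ofReal_mul_I, mul_one]
    have e4 := abs_le.1 (Complex.abs_im_le_norm (z * Complex.exp ((-(β / 2) : ℝ) * Complex.I)))
    rw [e3] at e4
    rw [e2]
    constructor <;> linarith
  have hp1 : 0 < (p * Complex.exp ((-((δ - η) / 2) : ℝ) * Complex.I)).im := by
    have := (him (δ - η)).1
    rw [show (δ - (δ - η)) / 2 = η / 2 by ring] at this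
    linarith
  have hp2 : (p * Complex.exp ((-((δ + η) / 2) : ℝ) * Complex.I)).im < 0 := by
    have := (him (δ + η)).2
    rw [show (δ - (δ + η)) / 2 = -(η / 2) by ring, Real.sin_neg] at this
    linarith
  have hle : δ - η ≤ δ + η := by linarith
  have hpole := fun k : ℕ => rayIntegral_sub_of_pole hE hle (by linarith) hEb hp1 hp2 k
  have hsum : ∀ θ ∈ ({δ - η, δ + η} : Set ℝ), rayIntegral (heatForm φ τ z) θ = rayIntegral G θ +
      ∑ k ∈ Finset.range n, a (-((k + 1 : ℕ) : ℤ)) *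
        rayIntegral (fun s => E s / (s - p) ^ (k + 1)) θ := by
    intro θ hθ
    have hθ' : θ ∈ Icc (δ - η) (δ + η) := by
      rcases hθ with rfl | rfl
      · exact ⟨le_rfl, hle⟩
      · exact ⟨hle, le_rfl⟩
    have hi : ∀ k : ℕ, IntegrableOn (fun x : ℝ => E (ray θ x) / (ray θ x - p) ^ (k + 1) *
        Complex.exp (θ / 2 * Complex.I)) (Ioi 0) := fun k => (hpole k).1 θ hθ
    have iS : Integrable (fun x : ℝ => ∑ k ∈ Finset.range n, a (-((k + 1 : ℕ) : ℤ)) *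
        (E (ray θ x) / (ray θ x - p) ^ (k + 1) * Complex.exp (θ / 2 * Complex.I)))
        (volume.restrict (Ioi 0)) := integrable_finsetSum _ fun k _ => (hi k).const_mul _
    have hpt : ∀ x : ℝ, heatForm φ τ z (ray θ x) * Complex.exp (θ / 2 * Complex.I) =
        G (ray θ x) * Complex.exp (θ / 2 * Complex.I) +
        ∑ k ∈ Finset.range n, a (-((k + 1 : ℕ) : ℤ)) *
          (E (ray θ x) / (ray θ x - p) ^ (k + 1) * Complex.exp (θ / 2 * Complex.I)) := by
      intro x
      have e1 : ∑ j ∈ Finset.Icc 1 n, a (-(j : ℤ)) / (z + ray θ x - z₀) ^ j =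
          ∑ k ∈ Finset.range n, a (-((k + 1 : ℕ) : ℤ)) / (ray θ x - p) ^ (k + 1) := by
        rw [show z + ray θ x - z₀ = ray θ x - p by rw [hp]; ring, Finset.range_eq_Ico,
          Finset.sum_Ico_add' (fun j : ℕ => a (-(j : ℤ)) / (ray θ x - p) ^ j) 0 n 1]
        rfl
      rw [heatForm, h.eq (z + ray θ x), e1]
      simp only [G]
      have e2 : ∑ k ∈ Finset.range n, a (-((k + 1 : ℕ) : ℤ)) *
          (E (ray θ x) / (ray θ x - p) ^ (k + 1) * Complex.exp (θ / 2 * Complex.I)) =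
          (∑ k ∈ Finset.range n, a (-((k + 1 : ℕ) : ℤ)) / (ray θ x - p) ^ (k + 1)) *
            (E (ray θ x) * Complex.exp (θ / 2 * Complex.I)) := by
        rw [Finset.sum_mul]
        exact Finset.sum_congr rfl fun k _ => by ring
      rw [e2]
      simp only [E]
      ring
    rw [rayIntegral]
    simp_rw [hpt]
    rw [integral_add (hGi θ hθ') iS, integral_finsetSum _ fun k _ => (hi k).const_mul _]
    simp_rw [integral_const_mul]
    rfl
  have hrot : rayIntegral G (δ - η) = rayIntegral G (δ + η) :=
    rayIntegral_eq_of_holomorphic hle hGd hGb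
  have hJ : ∑ k ∈ Finset.range n, a ((k : ℤ) - n) / ((n - k - 1).factorial : ℂ) *
      gaussDeriv (n - k - 1) τ p = ∑ k ∈ Finset.range n, a (-((k + 1 : ℕ) : ℤ)) *
        (iteratedDeriv k E p / (k.factorial : ℂ)) := by
    -- The stated sum runs from the highest pole down, the sum over principal parts from the simple
    -- pole up.
    rw [← Finset.sum_range_reflect]
    refine Finset.sum_congr rfl fun k hk => ?_
    have hk' := Finset.mem_range.1 hk
    have e1 : ((n - 1 - k : ℕ) : ℤ) - n = -((k + 1 : ℕ) : ℤ) := by omega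
    have e2 : n - (n - 1 - k) - 1 = k := by omega
    have e3 : gaussDeriv k τ p = iteratedDeriv k E p := rfl
    rw [e1, e2, e3]
    ring
  have hdiff : rayIntegral (heatForm φ τ z) (δ + η) - rayIntegral (heatForm φ τ z) (δ - η) =
      -(2 * Real.pi * Complex.I) * ∑ k ∈ Finset.range n, a (-((k + 1 : ℕ) : ℤ)) *
        (iteratedDeriv k E p / (k.factorial : ℂ)) := by
    rw [hsum _ (by simp), hsum _ (by simp), hrot, Finset.mul_sum, add_sub_add_left_eq_sub,
      ← Finset.sum_sub_distrib]
    refine Finset.sum_congr rfl fun k _ => ?_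
    rw [← mul_sub, (hpole k).2]
    ring
  -- The constant is `-2πi / (2√π √t) = -i √(π/t)`.
  rw [heatIntegral_eq, heatIntegral_eq, ← mul_sub, hdiff, jumpFn, ← hp, hJ, sqrtPiDiv,
    sqrt_four_mul_pi]
  have hs : (Real.sqrt Real.pi : ℂ) ≠ 0 :=
    Complex.ofReal_ne_zero.2 (Real.sqrt_pos.2 hpi).ne'
  have hs2 : (Real.pi : ℂ) = (Real.sqrt Real.pi : ℂ) * (Real.sqrt Real.pi : ℂ) := by
    rw [← Complex.ofReal_mul, Real.mul_self_sqrt hpi.le]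
  have h0 := Complex.exp_ne_zero (τ / 2)
  conv_lhs => rw [hs2]
  push_cast
  field_simp

/-- Near the direction `δ` the branches on the two sides are integrals over the rays `δ + ε/4` and
`δ - ε/4`, both within `π/2` of `arg t`. -/
theorem branch_sub (h : IsPolar n a z₀ δ ψ φ) {ε : ℝ} (hε : 0 < ε) (hεπ : ε < Real.pi) :
    ∃ r ρ : ℝ, 0 < r ∧ 0 < ρ ∧ ∀ τ ∈ sector δ (Real.pi - ε) (r : EReal),
      ∀ z ∈ Metric.ball (0 : ℂ) ρ,
        branch φ δ τ z - branch φ (δ - 2 * Real.pi) τ z = jumpFn n a z₀ τ z := by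
  have hpi := Real.pi_pos
  obtain ⟨r, ρ, hr, hρ, hJ⟩ := h.heatIntegral_sub (η := ε / 4) (by linarith) (by linarith)
  obtain ⟨ρ₁, hρ₁, -, h1⟩ := (h.hasConeBounds (c := δ) (m := 0) (by simp)).branch_eq_heatIntegral
    (η := ε / 4) (by linarith) (by linarith) one_pos
  obtain ⟨ρ₂, hρ₂, -, h2⟩ := (h.hasConeBounds (c := δ - 2 * Real.pi) (m := -1)
    (by push_cast; ring)).branch_eq_heatIntegral (η := ε / 4) (by linarith) (by linarith) one_pos
  obtain ⟨r₁, hr₁, h1⟩ := h1 (Real.pi - ε / 2) (by linarith) (by linarith)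
  obtain ⟨r₂, hr₂, h2⟩ := h2 (Real.pi - ε / 2) (by linarith) (by linarith)
  refine ⟨min r (min r₁ r₂), min ρ (min ρ₁ ρ₂), lt_min hr (lt_min hr₁ hr₂),
    lt_min hρ (lt_min hρ₁ hρ₂), fun τ hτ z hz => ?_⟩
  rw [mem_sector_coe, lt_min_iff, lt_min_iff] at hτ
  rw [mem_ball_zero_iff, lt_min_iff, lt_min_iff] at hz
  obtain ⟨⟨g0, g1, g2⟩, hτ⟩ := hτ
  have hτ' := abs_lt.1 hτ
  rw [← hJ τ g0 (by linarith) z (mem_ball_zero_iff.2 hz.1)]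
  have s1 : τ ∈ sector (δ + ε / 4) (Real.pi - ε / 2) (r₁ : EReal) :=
    mem_sector_coe.2 ⟨g1, by rw [abs_lt]; constructor <;> linarith⟩
  have s2 : τ ∈ sector (δ - ε / 4) (Real.pi - ε / 2) (r₂ : EReal) :=
    mem_sector_coe.2 ⟨g2, by rw [abs_lt]; constructor <;> linarith⟩
  rw [(h1 (δ + ε / 4) ⟨by linarith, by linarith⟩ τ s1 z (mem_ball_zero_iff.2 hz.2.1)).2,
    (h2 (δ - ε / 4) ⟨by linarith, by linarith⟩ τ s2 z (mem_ball_zero_iff.2 hz.2.2)).2]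

end IsPolar

theorem branch_neg (φ : ℂ → ℂ) (c : ℝ) (τ z : ℂ) :
    branch (fun w => φ (-w)) c τ (-z) = branch φ c τ z := by
  have h : ∀ θ τ, heatIntegral (fun w => φ (-w)) θ τ (-z) = heatIntegral φ θ τ z := by
    intro θ τ
    unfold heatIntegral heatIntegrand
    congr 2
    funext x
    rw [add_comm (φ (-(-z + _)))]
    congr 4
    · ring_nf
    · ring_nf
  rw [branch, branch, h]

/-! ### Growth of the jump -/

/-- A Hermite-type formula with recursion `H_{j+1} = κ ∂_s H_j - 2s H_j`. Its use is that `H` stays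
regular at `κ = 4t = 0`, with the explicit value `(-2s)^j`. -/
theorem exists_gaussDeriv_eq (j : ℕ) : ∃ H : ℂ × ℂ → ℂ, ContDiff ℂ (⊤ : ℕ∞) H ∧
    (∀ s, H (s, 0) = (-2 * s) ^ j) ∧ ∀ κ : ℂ, κ ≠ 0 → ∀ s,
      iteratedDeriv j (fun s : ℂ => Complex.exp (-s ^ 2 / κ)) s =
        (1 / κ) ^ j * H (s, κ) * Complex.exp (-s ^ 2 / κ) := by
  induction j with
  | zero => exact ⟨fun _ => 1, contDiff_const, by simp, by simp⟩
  | succ j ih =>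
    obtain ⟨H, h1, h2, h3⟩ := ih
    refine ⟨fun p => p.2 * fderiv ℂ H p (1, 0) - 2 * p.1 * H p, ?_, ?_, ?_⟩
    · have hf : ContDiff ℂ (⊤ : ℕ∞) (fderiv ℂ H) := h1.fderiv_right (by simp)
      exact (contDiff_snd.mul (hf.clm_apply contDiff_const)).sub
        ((contDiff_const.mul contDiff_fst).mul h1)
    · intro s
      simp only [zero_mul, zero_sub]
      rw [h2, pow_succ]
      ring
    · intro κ hκ s
      have hfun : iteratedDeriv j (fun s : ℂ => Complex.exp (-s ^ 2 / κ)) = fun s =>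
          (1 / κ) ^ j * H (s, κ) * Complex.exp (-s ^ 2 / κ) := funext (h3 κ hκ)
      have hd1 : HasDerivAt (fun s : ℂ => H (s, κ)) (fderiv ℂ H (s, κ) (1, 0)) s := by
        have hl : HasDerivAt (fun s : ℂ => (s, κ)) ((1 : ℂ), (0 : ℂ)) s :=
          (hasDerivAt_id s).prodMk (hasDerivAt_const s κ)
        exact ((h1.differentiable (by simp)) (s, κ)).hasFDerivAt.comp_hasDerivAt s hl
      have hd2 : HasDerivAt (fun s : ℂ => Complex.exp (-s ^ 2 / κ))
          (-(2 * s * κ⁻¹) * Complex.exp (-s ^ 2 / κ)) s := hasDerivAt_gaussian κ⁻¹ s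
      rw [iteratedDeriv_succ, hfun, ((hd1.const_mul ((1 / κ) ^ j)).fun_mul hd2).deriv,
        pow_succ (1 / κ)]
      have hk : κ * κ⁻¹ = 1 := mul_inv_cancel₀ hκ
      simp only [one_div]
      linear_combination (-(κ⁻¹ ^ j * fderiv ℂ H (s, κ) (1, 0) * Complex.exp (-s ^ 2 / κ))) * hk

theorem differentiable_jumpFn (n : ℕ) (a : ℤ → ℂ) (z₀ z : ℂ) :
    Differentiable ℂ fun τ => jumpFn n a z₀ τ z := by
  have h4 : ∀ τ : ℂ, 4 * Complex.exp τ ≠ 0 := fun τ =>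
    mul_ne_zero (by norm_num) (Complex.exp_ne_zero _)
  have hg : ∀ (j : ℕ) (s : ℂ), Differentiable ℂ fun τ => gaussDeriv j τ s := by
    intro j s
    obtain ⟨H, h1, -, h3⟩ := exists_gaussDeriv_eq j
    have e : (fun τ => gaussDeriv j τ s) = fun τ => (1 / (4 * Complex.exp τ)) ^ j *
        H (s, 4 * Complex.exp τ) * Complex.exp (-s ^ 2 / (4 * Complex.exp τ)) :=
      funext fun τ => h3 _ (h4 τ) s
    have hH : Differentiable ℂ H := h1.differentiable (by simp)
    rw [e]
    intro τ
    have := h4 τ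
    fun_prop (disch := assumption)
  have hs : Differentiable ℂ sqrtPiDiv := by
    unfold sqrtPiDiv
    intro τ
    have := Complex.exp_ne_zero (τ / 2)
    fun_prop (disch := assumption)
  unfold jumpFn
  fun_prop

/-- With `κ = 4t` the jump at `z = 0` is `-i √(π/t) κ^{-(n-1)} e^{-z₀²/κ} G(κ)`, where `G` is
continuous and `G(0) = a_{-n} (-2z₀)^{n-1} / (n-1)! ≠ 0`. For small `t` every factor is nonzero.
When `cos(δ - arg t) ≤ 0` the factors before `G` have modulus at least `1`. -/
theorem IsPolar.jumpFn_lower_bound {n : ℕ} {a : ℤ → ℂ} {z₀ : ℂ} {δ : ℝ} {ψ φ : ℂ → ℂ}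
    (h : IsPolar n a z₀ δ ψ φ) : ∃ X M : ℝ, 0 < M ∧ ∀ τ : ℂ, τ.re < X →
      jumpFn n a z₀ τ 0 ≠ 0 ∧ (Real.cos (δ - τ.im) ≤ 0 → M ≤ ‖jumpFn n a z₀ τ 0‖) := by
  have hpi := Real.pi_pos
  choose H h1 h2 h3 using exists_gaussDeriv_eq
  let G : ℂ → ℂ := fun κ => ∑ k ∈ Finset.range n, a ((k : ℤ) - n) / ((n - k - 1).factorial : ℂ) *
    (κ ^ k * H (n - k - 1) (z₀, κ))
  have hGc : Continuous G := by
    have hH : ∀ j, Continuous fun κ : ℂ => H j (z₀, κ) := fun j =>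
      (h1 j).continuous.comp (by fun_prop)
    exact continuous_finsetSum _ fun k _ =>
      continuous_const.mul ((continuous_pow k).mul (hH _))
  have hn := h.one_le
  have hG0 : G 0 ≠ 0 := by
    simp only [G]
    rw [Finset.sum_eq_single 0]
    · rw [h2, pow_zero, one_mul]
      refine mul_ne_zero (div_ne_zero ?_ (Nat.cast_ne_zero.2 (Nat.factorial_ne_zero _)))
        (pow_ne_zero _ (mul_ne_zero (by norm_num) h.ne_zero))
      have := h.lead
      simpa using this
    · intro k _ hk
      rw [zero_pow hk]
      ring
    · intro h0
      exact absurd (Finset.mem_range.2 hn) h0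
  set M := ‖G 0‖ / 2 with hM
  have hMpos : 0 < M := half_pos (norm_pos_iff.2 hG0)
  have hev : ∀ᶠ κ in 𝓝 (0 : ℂ), M < ‖G κ‖ :=
    hGc.norm.continuousAt.eventually_const_lt (half_lt_self (norm_pos_iff.2 hG0))
  obtain ⟨R, hR, hball⟩ := Metric.eventually_nhds_iff_ball.1 hev
  have hR' : 0 < min R 1 / 4 := by have := lt_min hR one_pos; positivity
  -- This ensures `|κ| < min(R, 1)`: below `R` for the bound on `G`, below `1` for the powers of
  -- `1/κ` and `1/t`.
  refine ⟨Real.log (min R 1 / 4), M, hMpos, fun τ hτ => ?_⟩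
  rw [Real.lt_log_iff_exp_lt hR'] at hτ
  set κ := 4 * Complex.exp τ with hκ
  have hκ0 : κ ≠ 0 := mul_ne_zero (by norm_num) (Complex.exp_ne_zero _)
  have hκn : ‖κ‖ = 4 * Real.exp τ.re := by
    rw [hκ, norm_mul, Complex.norm_exp, Complex.norm_ofNat]
  have hκR : ‖κ‖ < R := by rw [hκn]; linarith [min_le_left R 1]
  have hκ1 : ‖κ‖ < 1 := by rw [hκn]; linarith [min_le_right R 1]
  have hGκ := hball κ (mem_ball_zero_iff.2 hκR)
  have hform : jumpFn n a z₀ τ 0 = -Complex.I * sqrtPiDiv τ *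
      ((1 / κ) ^ (n - 1) * Complex.exp (-z₀ ^ 2 / κ) * G κ) := by
    rw [jumpFn]
    congr 1
    simp only [G]
    rw [Finset.mul_sum]
    refine Finset.sum_congr rfl fun k hk => ?_
    have hk' := Finset.mem_range.1 hk
    rw [sub_zero, gaussDeriv, ← hκ, h3 _ κ hκ0]
    have e : (1 / κ) ^ (n - 1) * κ ^ k = (1 / κ) ^ (n - k - 1) := by
      rw [show n - 1 = (n - k - 1) + k by omega, pow_add, mul_assoc, ← mul_pow,
        one_div_mul_cancel hκ0, one_pow, mul_one]
    rw [← e]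
    ring
  have hs : 0 < Real.sqrt Real.pi := Real.sqrt_pos.2 hpi
  have hsq : ‖sqrtPiDiv τ‖ = Real.sqrt Real.pi / Real.exp (τ.re / 2) := by
    rw [sqrtPiDiv, norm_div, Complex.norm_real, Real.norm_of_nonneg hs.le, Complex.norm_exp,
      show (2 : ℂ) = ((2 : ℝ) : ℂ) by norm_num, Complex.div_ofReal_re]
  constructor
  · rw [hform]
    refine mul_ne_zero (mul_ne_zero (neg_ne_zero.2 Complex.I_ne_zero) ?_) (mul_ne_zero
      (mul_ne_zero (pow_ne_zero _ (one_div_ne_zero hκ0)) (Complex.exp_ne_zero _)) ?_)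
    · rw [← norm_pos_iff, hsq]
      positivity
    · exact norm_pos_iff.1 (hMpos.trans hGκ)
  · intro hcos
    have b1 : 1 ≤ ‖sqrtPiDiv τ‖ := by
      rw [hsq, le_div_iff₀ (Real.exp_pos _), one_mul]
      have h4 : Real.exp (τ.re / 2) ≤ 1 := by
        rw [Real.exp_le_one_iff]
        have : Real.exp τ.re < 1 := by linarith [min_le_right R 1]
        rw [Real.exp_lt_one_iff] at this
        linarith
      refine h4.trans (Real.one_le_sqrt.2 (by linarith [Real.pi_gt_three]))
    have b2 : 1 ≤ ‖(1 / κ) ^ (n - 1)‖ := by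
      rw [norm_pow, norm_div, norm_one]
      exact one_le_pow₀ ((one_le_div (norm_pos_iff.2 hκ0)).2 hκ1.le)
    have b3 : 1 ≤ ‖Complex.exp (-z₀ ^ 2 / κ)‖ := by
      have e1 : z₀ = ray δ ‖z₀‖ := by
        rw [ray]
        conv_lhs => rw [h.polar]
        push_cast
        rfl
      rw [Complex.norm_exp, Real.one_le_exp_iff, e1, hκ, gaussian_exponent, ← Complex.ofReal_pow,
        Complex.re_mul_ofReal, Complex.neg_re, re_exp_sub]
      refine mul_nonneg ?_ (sq_nonneg _)
      have := mul_nonpos_of_nonneg_of_nonpos (Real.exp_pos (-τ.re)).le hcos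
      linarith
    rw [hform, norm_mul, norm_mul, norm_mul, norm_mul, norm_neg, Complex.norm_I, one_mul]
    have b4 : 1 ≤ ‖sqrtPiDiv τ‖ * (‖(1 / κ) ^ (n - 1)‖ * ‖Complex.exp (-z₀ ^ 2 / κ)‖) :=
      one_le_mul_of_one_le_of_one_le b1 (one_le_mul_of_one_le_of_one_le b2 b3)
    calc M ≤ 1 * ‖G κ‖ := by linarith
      _ ≤ (‖sqrtPiDiv τ‖ * (‖(1 / κ) ^ (n - 1)‖ * ‖Complex.exp (-z₀ ^ 2 / κ)‖)) * ‖G κ‖ := by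
        gcongr
      _ = _ := by ring


/-! ### Sectors on the Riemann surface of the square root -/

theorem mem_surfaceSector_two {d α : ℝ} {R : EReal} {τ : ℂ} : τ ∈ surfaceSector 2 d α R ↔
    ∃ m : ℤ, τ + (4 * Real.pi * m : ℝ) * Complex.I ∈ sector d α R := by
  have e : ∀ m : ℤ, (2 * Real.pi * ((2 : ℚ) : ℝ) * m : ℝ) = 4 * Real.pi * m := fun m => by
    push_cast; ring
  simp only [surfaceSector, mem_ofPred_eq, e]

theorem sector_add_subset (d α : ℝ) (R : EReal) (m : ℤ) :
    sector (d + 4 * Real.pi * m) α R ⊆ surfaceSector 2 d α R := by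
  rintro τ ⟨h1, h2⟩
  refine mem_surfaceSector_two.2 ⟨-m, ?_, ?_⟩
  · simpa using h1
  · have : (τ + (4 * Real.pi * (-m : ℤ) : ℝ) * Complex.I).im - d =
        τ.im - (d + 4 * Real.pi * m) := by
      simp
      ring
    rwa [this]

theorem surfaceSector_two_add (d α : ℝ) (R : EReal) (m : ℤ) :
    surfaceSector 2 (d + 4 * Real.pi * m) α R = surfaceSector 2 d α R := by
  ext τ
  rw [mem_surfaceSector_two, mem_surfaceSector_two]
  have e : ∀ k l : ℤ, k = l + m → (τ + (4 * Real.pi * k : ℝ) * Complex.I ∈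
      sector (d + 4 * Real.pi * m) α R ↔ τ + (4 * Real.pi * l : ℝ) * Complex.I ∈ sector d α R) := by
    rintro k l rfl
    simp only [sector, mem_ofPred_eq]
    simp [mul_add, add_sub_add_right_eq_sub, ← add_assoc]
  exact ⟨fun ⟨k, hk⟩ => ⟨k - m, (e k (k - m) (by ring)).1 hk⟩,
    fun ⟨l, hl⟩ => ⟨l + m, (e (l + m) l rfl).2 hl⟩⟩

/-- The half-opening `4π` already covers a full period, so the whole surface is a sector overlapping
itself, about any direction. -/
theorem puncturedDisc_eq (r : ℝ) (d : ℝ) :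
    puncturedDisc r = surfaceSector 2 d (8 * Real.pi) (r : EReal) := by
  have hpi := Real.pi_pos
  ext τ
  rw [mem_surfaceSector_two]
  change Real.exp τ.re < r ↔ _
  constructor
  · intro h
    refine ⟨-⌊(τ.im - d) / (4 * Real.pi)⌋, mem_sector_coe.2 ⟨by simpa using h, ?_⟩⟩
    have h1 := (le_div_iff₀ (by positivity)).1 (Int.floor_le ((τ.im - d) / (4 * Real.pi)))
    have h2 := (div_lt_iff₀ (by positivity)).1 (Int.lt_floor_add_one ((τ.im - d) / (4 * Real.pi)))
    have e : (τ + (4 * Real.pi * (-⌊(τ.im - d) / (4 * Real.pi)⌋ : ℤ) : ℝ) * Complex.I).im =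
        τ.im - ⌊(τ.im - d) / (4 * Real.pi)⌋ * (4 * Real.pi) := by
      simp
      ring
    rw [e, abs_lt]
    constructor <;> linarith
  · rintro ⟨m, hm⟩
    simpa using (mem_sector_coe.1 hm).1

theorem mem_sector_of_re_le {d α : ℝ} {R : EReal} {p τ : ℂ} (hp : p ∈ sector d α R)
    (hre : τ.re ≤ p.re) (him : |τ.im - d| < α / 2) : τ ∈ sector d α R :=
  ⟨lt_of_le_of_lt (EReal.coe_le_coe_iff.2 (Real.exp_le_exp.2 hre)) hp.1, him⟩

theorem abs_im_sub_lt {d α : ℝ} {R : EReal} {p q : ℂ} (hp : p ∈ sector d α R)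
    (hq : q ∈ sector d α R) {y : ℝ} (h1 : p.im ≤ y) (h2 : y ≤ q.im) : |y - d| < α / 2 := by
  have h3 := abs_lt.1 hp.2
  have h4 := abs_lt.1 hq.2
  rw [abs_lt]
  constructor <;> linarith

theorem tendsto_re_atBot_iff {f : ℂ → ℂ} {U : Set ℂ} {l : Filter ℂ} :
    Tendsto f (comap Complex.re atBot ⊓ 𝓟 U) l ↔
      ∀ s ∈ l, ∃ X : ℝ, ∀ τ ∈ U, τ.re < X → f τ ∈ s := by
  rw [((atBot_basis_Iio.comap Complex.re).inf_principal U).tendsto_left_iff]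
  refine forall₂_congr fun s _ => ⟨?_, ?_⟩
  · rintro ⟨X, -, hX⟩
    exact ⟨X, fun τ hτ h => hX ⟨h, hτ⟩⟩
  · rintro ⟨X, hX⟩
    exact ⟨X, trivial, fun τ hτ => hX τ hτ.2 hτ.1⟩

theorem IsSectorSolution.surfaceSector {φ : ℂ → ℂ} {u : ℂ → ℂ → ℂ} {d α ρ : ℝ} {R : EReal}
    (h : IsSectorSolution φ u (sector d α R) ρ)
    (hper : ∀ (τ z : ℂ) (m : ℤ), u (τ + (4 * Real.pi * m : ℝ) * Complex.I) z = u τ z) :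
    IsSectorSolution φ u (surfaceSector 2 d α R) ρ where
  holo := by
    rintro ⟨τ, z⟩ ⟨hτ, hz⟩
    obtain ⟨m, hm⟩ := mem_surfaceSector_two.1 hτ
    have h1 : DifferentiableAt ℂ (fun p : ℂ × ℂ => u p.1 p.2)
        (τ + (4 * Real.pi * m : ℝ) * Complex.I, z) :=
      (h.holo (τ + (4 * Real.pi * m : ℝ) * Complex.I, z) ⟨hm, hz⟩).differentiableAt
        (((isOpen_sector _ _ _).prod Metric.isOpen_ball).mem_nhds ⟨hm, hz⟩)
    have h2 : (fun p : ℂ × ℂ => u p.1 p.2) = fun p : ℂ × ℂ =>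
        u (p.1 + (4 * Real.pi * m : ℝ) * Complex.I) p.2 := by
      funext p
      rw [hper]
    rw [h2]
    refine DifferentiableAt.differentiableWithinAt ?_
    exact DifferentiableAt.comp (τ, z) (f := fun p : ℂ × ℂ =>
      (p.1 + (4 * Real.pi * m : ℝ) * Complex.I, p.2)) h1 (by fun_prop)
  heat τ hτ z hz := by
    obtain ⟨m, hm⟩ := mem_surfaceSector_two.1 hτ
    have h1 := h.heat _ hm z hz
    have e1 : Complex.exp (τ + (4 * Real.pi * m : ℝ) * Complex.I) = Complex.exp τ := by
      rw [← Complex.exp_periodic.int_mul (2 * m) τ]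
      congr 1
      push_cast
      ring
    rw [← deriv_comp_add_const (fun τ' => u τ' z), e1] at h1
    simpa only [hper] using h1
  initial z hz := by
    have h1 := tendsto_re_atBot_iff.1 (h.initial z hz)
    refine tendsto_re_atBot_iff.2 fun s hs => ?_
    obtain ⟨X, hX⟩ := h1 s hs
    refine ⟨X, fun τ hτ hre => ?_⟩
    obtain ⟨m, hm⟩ := mem_surfaceSector_two.1 hτ
    have := hX _ hm (by simpa using hre)
    rwa [hper] at this

theorem IsSectorSolution.branch_add {φ : ℂ → ℂ} {c e α ρ : ℝ} {R : EReal}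
    (h : IsSectorSolution φ (branch φ c) (sector e α R) ρ) (m : ℤ) :
    IsSectorSolution φ (branch φ (c + 4 * Real.pi * m)) (sector (e + 4 * Real.pi * m) α R) ρ := by
  rw [branch_add_left]
  exact (h.surfaceSector fun τ z k => Stokes.branch_add φ c τ z k).mono
    (sector_add_subset e α R m) le_rfl

theorem IsActualSolution.apply_add {φ : ℂ → ℂ} {v : ℂ → ℂ → ℂ} {d α ρ : ℝ} {R : EReal}
    (h : IsActualSolution 2 φ v (surfaceSector 2 d α R) ρ) {τ z : ℂ}
    (hτ : τ ∈ surfaceSector 2 d α R) (hz : z ∈ Metric.ball (0 : ℂ) ρ) (m : ℤ) :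
    v (τ + (4 * Real.pi * m : ℝ) * Complex.I) z = v τ z := by
  have hV : ∀ m : ℤ, τ + (4 * Real.pi * m : ℝ) * Complex.I ∈ surfaceSector 2 d α R := by
    intro m
    obtain ⟨k, hk⟩ := mem_surfaceSector_two.1 hτ
    refine mem_surfaceSector_two.2 ⟨k - m, ?_⟩
    convert hk using 1
    push_cast
    ring
  have hs : ∀ m : ℤ, v (τ + (4 * Real.pi * (m + 1 : ℤ) : ℝ) * Complex.I) z =
      v (τ + (4 * Real.pi * m : ℝ) * Complex.I) z := by
    intro m
    rw [← h.periodic _ (hV m) z hz]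
    congr 1
    push_cast
    ring
  induction m using Int.induction_on with
  | zero => simp
  | succ i ih => rw [hs, ih]
  | pred i ih => rw [← hs, sub_add_cancel, ih]

/-! ### Uniqueness of the sum -/

/-- The continued Borel transform is unique and the ray `arg s = d` is allowed in both sums, so both
are the same integral over the common disc. -/
theorem IsKSum.exists_eqOn {d : ℝ} {û : ℕ → ℂ → ℂ} {f f' : ℂ → ℂ → ℂ} {U U' : Set ℂ}
    (h : IsKSum 1 d û f U) (h' : IsKSum 1 d û f' U') :
    ∃ r ρ : ℝ, 0 < r ∧ 0 < ρ ∧ ∀ τ ∈ sector d (Real.pi / 2) (r : EReal), τ ∈ U → τ ∈ U' →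
      ∀ z ∈ Metric.ball (0 : ℂ) ρ, f τ z = f' τ z := by
  have hpi := Real.pi_pos
  obtain ⟨ε, ρ, hε, hρ, g, hg, hs⟩ := h
  obtain ⟨ε', ρ', hε', hρ', g', hg', hs'⟩ := h'
  obtain ⟨r, hr, hs⟩ := hs d (by simpa using hε) (Real.pi / 2) (by linarith) (by linarith)
  obtain ⟨r', hr', hs'⟩ := hs' d (by simpa using hε') (Real.pi / 2) (by linarith) (by linarith)
  refine ⟨min r r', min ρ ρ', lt_min hr hr', lt_min hρ hρ', fun τ hτ hU hU' z hz => ?_⟩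
  have hz1 := Metric.ball_subset_ball (min_le_left _ _) hz
  have hz2 := Metric.ball_subset_ball (min_le_right _ _) hz
  rw [(hs τ (sector_mono le_rfl (EReal.coe_le_coe_iff.2 (min_le_left _ _)) hτ) z hz1).2 hU,
    (hs' τ (sector_mono le_rfl (EReal.coe_le_coe_iff.2 (min_le_right _ _)) hτ) z hz2).2 hU']
  have hgg : ∀ ξ : ℝ, g (ξ + d * Complex.I) z = g' (ξ + d * Complex.I) z := fun ξ =>
    hg.eqOn hg' hε hε' hz1 hz2 _ (mem_sector_top.2 (by simpa using lt_min hε hε'))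
  simp only [ecalle, ecalleIntegrand, hgg]

/-! ### Crossing a Stokes line -/

/-- Over `z = 0`, the branches on the two sides of the line of direction `c` differ by an entire
function of the logarithmic coordinate, which does not tend to `0` beyond the anti-Stokes lines. -/
structure IsCrossing (φ : ℂ → ℂ) (c ε r : ℝ) (J : ℂ → ℂ) : Prop where
  differentiable : Differentiable ℂ J
  eq : ∀ τ ∈ sector c (Real.pi - ε) (r : EReal),
    branch φ c τ 0 - branch φ (c - 2 * Real.pi) τ 0 = J τ
  lower : ∃ X M : ℝ, 0 < M ∧ ∀ τ : ℂ, τ.re < X →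
    J τ ≠ 0 ∧ (Real.cos (c - τ.im) ≤ 0 → M ≤ ‖J τ‖)

theorem IsCrossing.add {φ : ℂ → ℂ} {c ε r : ℝ} {J : ℂ → ℂ} (h : IsCrossing φ c ε r J) (m : ℤ) :
    IsCrossing φ (c + 4 * Real.pi * m) ε r
      (fun τ => J (τ - (4 * Real.pi * m : ℝ) * Complex.I)) where
  differentiable := h.differentiable.comp (by fun_prop)
  eq τ hτ := by
    set σ := τ - (4 * Real.pi * m : ℝ) * Complex.I with hσ
    have hσs : σ ∈ sector c (Real.pi - ε) (r : EReal) := by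
      rw [mem_sector_coe] at hτ ⊢
      have e1 : σ.re = τ.re := by simp [hσ]
      have e2 : σ.im - c = τ.im - (c + 4 * Real.pi * m) := by
        simp [hσ]
        ring
      rwa [e1, e2]
    have e3 : τ = σ + (4 * Real.pi * m : ℝ) * Complex.I := by rw [hσ]; ring
    rw [← h.eq σ hσs, show c + 4 * Real.pi * m - 2 * Real.pi = c - 2 * Real.pi + 4 * Real.pi * m by
      ring, branch_add_left, branch_add_left, e3, branch_add, branch_add]
  lower := by
    obtain ⟨X, M, hM, hX⟩ := h.lower
    refine ⟨X, M, hM, fun τ hτ => ?_⟩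
    have := hX (τ - (4 * Real.pi * m : ℝ) * Complex.I) (by simpa using hτ)
    convert this using 4
    simp
    ring

/-- If `v` is the sum of `f` and `J`, and both `v` and `f` tend to `L` at the origin, then `J` is
small at the origin. -/
theorem false_of_eq_add {d α e β M X y r : ℝ} {R : EReal} {v f J : ℂ → ℂ} {L p : ℂ} {O : Set ℂ}
    (hv : DifferentiableOn ℂ v (sector d α R)) (hf : DifferentiableOn ℂ f (sector e β (r : EReal)))
    (hJ : Differentiable ℂ J) (hr : 0 < r) (hp : p ∈ sector d α R)
    (hvL : Tendsto v (comap Complex.re atBot ⊓ 𝓟 (sector d α R)) (𝓝 L))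
    (hfL : Tendsto f (comap Complex.re atBot ⊓ 𝓟 (sector e β (r : EReal))) (𝓝 L))
    (hO : IsOpen O) (hne : (O ∩ (sector d α R ∩ sector e β (r : EReal))).Nonempty)
    (h : ∀ w ∈ O ∩ (sector d α R ∩ sector e β (r : EReal)), v w = f w + J w)
    (hy1 : |y - d| < α / 2) (hy2 : |y - e| < β / 2) (hM : 0 < M)
    (hJM : ∀ τ : ℂ, τ.re < X → τ.im = y → M ≤ ‖J τ‖) : False := by
  -- The identity theorem carries the relation from the neighbourhood of the Stokes line to the
  -- height `y`, where `J` is known to be large.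
  have hid : EqOn v (fun w => f w + J w) (sector d α R ∩ sector e β (r : EReal)) :=
    eqOn_of_eqOn_open ((isOpen_sector _ _ _).inter (isOpen_sector _ _ _))
      ((convex_sector _ _ _).inter (convex_sector _ _ _)) (hv.mono inter_subset_left)
      ((hf.mono inter_subset_right).add hJ.differentiableOn) hO hne h
  obtain ⟨X₁, h1⟩ := tendsto_re_atBot_iff.1 hvL _ (Metric.ball_mem_nhds L (half_pos hM))
  obtain ⟨X₂, h2⟩ := tendsto_re_atBot_iff.1 hfL _ (Metric.ball_mem_nhds L (half_pos hM))
  obtain ⟨τ, hτ, hτ1, hτ2⟩ := exists_mem_sector (min (min X p.re) (min X₁ X₂)) hy2 hr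
  rw [lt_min_iff, lt_min_iff, lt_min_iff] at hτ1
  obtain ⟨⟨g1, g2⟩, g3, g4⟩ := hτ1
  have hτd : τ ∈ sector d α R := mem_sector_of_re_le hp g2.le (by rwa [hτ2])
  have k1 := h1 τ hτd g3
  have k2 := h2 τ hτ g4
  have k3 := hJM τ g1 hτ2
  rw [Metric.mem_ball, dist_eq_norm] at k1 k2
  have k4 : J τ = (v τ - L) - (f τ - L) := by
    have := hid ⟨hτd, hτ⟩
    simp only at this
    rw [this]
    ring
  have k5 := norm_sub_le (v τ - L) (f τ - L)
  rw [← k4] at k5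
  linarith

/-- The requirements, uniform in the direction `c` of the Stokes line, that determine the solutions
which are sums in a direction close to it. -/
structure IsBranching (φ : ℂ → ℂ) (c ε r ρ : ℝ) : Prop where
  solution : IsSectorSolution φ (branch φ c) (sector (c + Real.pi) (3 * Real.pi - ε) (r : EReal)) ρ
  crossing : ∃ J, IsCrossing φ c ε r J

theorem IsBranching.add {φ : ℂ → ℂ} {c ε r ρ : ℝ} (h : IsBranching φ c ε r ρ) (m : ℤ) :
    IsBranching φ (c + 4 * Real.pi * m) ε r ρ where
  solution := by
    rw [show c + 4 * Real.pi * m + Real.pi = c + Real.pi + 4 * Real.pi * m by ring]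
    exact h.solution.branch_add m
  crossing := h.crossing.imp' _ fun _ hJ => hJ.add m

/-! ### How far the sector of a solution that is a sum between two Stokes lines can extend. -/

section Maximality

variable {φ : ℂ → ℂ} {c ε r ρ d α : ℝ} {R : EReal} {û : ℕ → ℂ → ℂ} {v : ℂ → ℂ → ℂ} {p : ℂ}

/-- The equality of sums holds only near the direction of `p` and for `z` in a smaller disc. The
identity theorem extends it first in `τ`, then in `z`. -/
theorem IsBranching.eqOn (h : IsBranching φ c ε r ρ) (hr : 0 < r) (hρ : 0 < ρ)
    (hεπ : ε < Real.pi) (hv : HolomorphicOn v (sector d α R) ρ) (hp : p ∈ sector d α R)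
    (hpc : p.im ∈ Ioo c (c + 2 * Real.pi)) (hk : IsKSum 1 p.im û v (sector d α R))
    (hk' : IsKSum 1 p.im û (branch φ c) univ) :
    ∀ τ ∈ sector d α R ∩ sector (c + Real.pi) (3 * Real.pi - ε) (r : EReal),
      ∀ z ∈ Metric.ball (0 : ℂ) ρ, v τ z = branch φ c τ z := by
  have hpi := Real.pi_pos
  obtain ⟨r₁, ρ₁, hr₁, hρ₁, h1⟩ := hk.exists_eqOn hk'
  set S := sector (c + Real.pi) (3 * Real.pi - ε) (r : EReal) with hS
  have hτz : ∀ z ∈ Metric.ball (0 : ℂ) (min ρ ρ₁), EqOn (fun τ => v τ z) (fun τ => branch φ c τ z)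
      (sector d α R ∩ S) := by
    intro z hz
    have hz1 := Metric.ball_subset_ball (min_le_left ρ ρ₁) hz
    have hz2 := Metric.ball_subset_ball (min_le_right ρ ρ₁) hz
    refine eqOn_of_eqOn_open (O := sector p.im (Real.pi / 2) (r₁ : EReal))
      ((isOpen_sector _ _ _).inter (isOpen_sector _ _ _))
      ((convex_sector _ _ _).inter (convex_sector _ _ _)) ((hv.slice hz1).mono inter_subset_left)
      ((h.solution.holo.slice hz1).mono inter_subset_right) (isOpen_sector _ _ _) ?_
      fun w hw => h1 w hw.1 hw.2.1 trivial z hz2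
    have hpS : |p.im - (c + Real.pi)| < (3 * Real.pi - ε) / 2 := by
      rw [abs_lt]
      constructor <;> linarith [hpc.1, hpc.2]
    obtain ⟨τ, g1, g2, g3⟩ := exists_mem_sector (min p.re (Real.log r₁)) hpS hr
    rw [lt_min_iff, Real.lt_log_iff_exp_lt hr₁] at g2
    refine ⟨τ, mem_sector_coe.2 ⟨g2.2, ?_⟩, mem_sector_of_re_le hp g2.1.le ?_, g1⟩
    · rw [g3, sub_self, abs_zero]
      positivity
    · rw [g3]
      exact hp.2
  intro τ hτ
  refine eqOn_of_eqOn_open (O := Metric.ball 0 (min ρ ρ₁)) Metric.isOpen_ball (convex_ball _ _)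
    (hv.slice_right hτ.1) (h.solution.holo.slice_right hτ.2) Metric.isOpen_ball
    ⟨0, Metric.mem_ball_self (lt_min hρ hρ₁), Metric.mem_ball_self hρ⟩
    fun w hw => hτz w hw.1 hτ

/-- Otherwise the sector crosses the Stokes line `c` and goes on beyond the anti-Stokes line `c -
π/2`. There `v` is the previous branch plus the jump; both solutions tend to `φ(0)`, and the jump
does not tend to `0`. -/
theorem IsBranching.le_im (h : IsBranching φ c ε r ρ)
    (h' : IsBranching φ (c - 2 * Real.pi) ε r ρ) (hr : 0 < r) (hρ : 0 < ρ)
    (hεπ : ε < Real.pi) (hv : HolomorphicOn v (sector d α R) ρ)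
    (hvi : Tendsto (fun τ => v τ 0) (comap Complex.re atBot ⊓ 𝓟 (sector d α R)) (𝓝 (φ 0)))
    (hp : p ∈ sector d α R) (hpc : c < p.im)
    (heq : ∀ τ ∈ sector d α R ∩ sector (c + Real.pi) (3 * Real.pi - ε) (r : EReal),
      v τ 0 = branch φ c τ 0) :
    ∀ τ ∈ sector d α R, c - Real.pi / 2 ≤ τ.im := by
  have hpi := Real.pi_pos
  intro q hq
  by_contra! hlt
  have h0 : (0 : ℂ) ∈ Metric.ball (0 : ℂ) ρ := Metric.mem_ball_self hρ
  obtain ⟨J, hJ⟩ := h.crossing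
  obtain ⟨X, M, hM, hX⟩ := hJ.lower
  -- A height below `c - π/2` reached by the sector of `v`. The truncation at `c - π` keeps it in
  -- the domain of the previous branch and keeps `cos(c - y) ≤ 0`.
  have hyc : |max q.im (c - Real.pi) - (c - Real.pi)| < Real.pi / 2 := by
    rw [abs_of_nonneg (by linarith [le_max_right q.im (c - Real.pi)])]
    have : max q.im (c - Real.pi) < c - Real.pi / 2 := max_lt hlt (by linarith)
    linarith
  refine false_of_eq_add (X := X) (y := max q.im (c - Real.pi)) (O := sector c (Real.pi - ε) r)
    (hv.slice h0) (h'.solution.holo.slice h0) hJ.differentiable hr hp hvi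
    (h'.solution.initial 0 h0) (isOpen_sector _ _ _) ?_ ?_
    (abs_im_sub_lt hq hp (le_max_left _ _) (max_le (by linarith) (by linarith))) ?_ hM ?_
  · obtain ⟨τ, g1, g2, g3⟩ := exists_mem_sector (d := c) (α := Real.pi - ε) p.re (y := c)
      (by rw [sub_self, abs_zero]; linarith) hr
    refine ⟨τ, g1, mem_sector_of_re_le hp g2.le ?_, mem_sector_coe.2
      ⟨(mem_sector_coe.1 g1).1, ?_⟩⟩
    · rw [g3]
      exact abs_im_sub_lt hq hp (by linarith) (by linarith)
    · rw [g3, abs_lt]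
      constructor <;> linarith
  · rintro τ ⟨g1, g2, g3⟩
    rw [← hJ.eq τ g1, heq τ ⟨g2, mem_sector_coe.2 ⟨(mem_sector_coe.1 g1).1, ?_⟩⟩]
    · ring
    · have := abs_lt.1 (mem_sector_coe.1 g1).2
      rw [abs_lt]
      constructor <;> linarith
  · rw [show c - 2 * Real.pi + Real.pi = c - Real.pi by ring]
    linarith
  · intro τ g1 g2
    refine (hX τ g1).2 ?_
    have h3 := abs_lt.1 hyc
    rw [g2]
    exact Real.cos_nonpos_of_pi_div_two_le_of_le (by linarith) (by linarith)

/-- The mirror argument at the Stokes line `c + 2π`, where `v` is the next branch minus the jump. -/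
theorem IsBranching.im_le (h' : IsBranching φ (c + 2 * Real.pi) ε r ρ) (hr : 0 < r) (hρ : 0 < ρ)
    (hεπ : ε < Real.pi) (hv : HolomorphicOn v (sector d α R) ρ)
    (hvi : Tendsto (fun τ => v τ 0) (comap Complex.re atBot ⊓ 𝓟 (sector d α R)) (𝓝 (φ 0)))
    (hp : p ∈ sector d α R) (hpc : p.im < c + 2 * Real.pi)
    (heq : ∀ τ ∈ sector d α R ∩ sector (c + Real.pi) (3 * Real.pi - ε) (r : EReal),
      v τ 0 = branch φ c τ 0) :
    ∀ τ ∈ sector d α R, τ.im ≤ c + 5 * Real.pi / 2 := by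
  have hpi := Real.pi_pos
  intro q hq
  by_contra! hlt
  have h0 : (0 : ℂ) ∈ Metric.ball (0 : ℂ) ρ := Metric.mem_ball_self hρ
  obtain ⟨J, hJ⟩ := h'.crossing
  obtain ⟨X, M, hM, hX⟩ := hJ.lower
  have hyc : |min q.im (c + 3 * Real.pi) - (c + 3 * Real.pi)| < Real.pi / 2 := by
    rw [abs_of_nonpos (by linarith [min_le_right q.im (c + 3 * Real.pi)])]
    have : c + 5 * Real.pi / 2 < min q.im (c + 3 * Real.pi) := lt_min hlt (by linarith)
    linarith
  refine false_of_eq_add (X := X) (y := min q.im (c + 3 * Real.pi))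
    (O := sector (c + 2 * Real.pi) (Real.pi - ε) r)
    (hv.slice h0) (h'.solution.holo.slice h0) hJ.differentiable.neg hr hp hvi
    (h'.solution.initial 0 h0) (isOpen_sector _ _ _) ?_ ?_
    (abs_im_sub_lt hp hq (le_min (by linarith) (by linarith)) (min_le_left _ _)) ?_ hM ?_
  · obtain ⟨τ, g1, g2, g3⟩ := exists_mem_sector (d := c + 2 * Real.pi) (α := Real.pi - ε) p.re
      (y := c + 2 * Real.pi) (by rw [sub_self, abs_zero]; linarith) hr
    refine ⟨τ, g1, mem_sector_of_re_le hp g2.le ?_, mem_sector_coe.2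
      ⟨(mem_sector_coe.1 g1).1, ?_⟩⟩
    · rw [g3]
      exact abs_im_sub_lt hp hq (by linarith) (by linarith)
    · rw [g3, abs_lt]
      constructor <;> linarith
  · rintro τ ⟨g1, g2, g3⟩
    have e := hJ.eq τ g1
    rw [add_sub_cancel_right] at e
    rw [Pi.neg_apply, ← e, heq τ ⟨g2, mem_sector_coe.2 ⟨(mem_sector_coe.1 g1).1, ?_⟩⟩]
    · ring
    · have := abs_lt.1 (mem_sector_coe.1 g1).2
      rw [abs_lt]
      constructor <;> linarith
  · rw [show c + 2 * Real.pi + Real.pi = c + 3 * Real.pi by ring]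
    linarith
  · intro τ g1 g2
    rw [Pi.neg_apply, norm_neg]
    refine (hX τ g1).2 ?_
    have h3 := abs_lt.1 hyc
    rw [g2, ← Real.cos_neg]
    exact Real.cos_nonpos_of_pi_div_two_le_of_le (by linarith) (by linarith)

end Maximality


/-! ### Sums, jumps and the maximal family for a polar initial value. -/

namespace IsPolar

variable {n : ℕ} {a : ℤ → ℂ} {z₀ : ℂ} {δ : ℝ} {ψ φ : ℂ → ℂ} {û : ℕ → ℂ → ℂ} {ρ₀ : ℝ}

/-- The branch between two Stokes lines is given by the heat integral and is the sum of the formal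
solution in the directions between these lines. -/
theorem isHeatIntegral_isKSum (h : IsPolar n a z₀ δ ψ φ) (hρ₀ : 0 < ρ₀)
    (hû : IsFormalSolution φ û ρ₀) {c d : ℝ} {m : ℤ} (hc : c = δ + 2 * Real.pi * m)
    (hd : d ∈ Ioo c (c + 2 * Real.pi)) (U : Set ℂ) :
    IsHeatIntegral φ d (branch φ c) ∧ IsKSum 1 d û (branch φ c) U := by
  have hpi := Real.pi_pos
  set l := min (d - c) (c + 2 * Real.pi - d) with hl_def
  have hl1 : l ≤ d - c := min_le_left _ _
  have hl2 : l ≤ c + 2 * Real.pi - d := min_le_right _ _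
  have hl : 0 < l := lt_min (by linarith [hd.1]) (by linarith [hd.2])
  obtain ⟨ρ, A, B, hρ, hρR, hA, hB, hcone⟩ := h.hasConeBounds hc (l / 2) (min ρ₀ (‖z₀‖ / 3))
    (by linarith) (by linarith) (lt_min hρ₀ (by linarith [h.norm_pos]))
  obtain ⟨ρ', hρ', hρρ', hb⟩ := (h.hasConeBounds hc).branch_eq_heatIntegral (η := l / 2)
    (by linarith) (by linarith) hρ
  refine ⟨⟨ρ', hρ', fun α hα hαπ => ?_⟩, l, ρ', hl, hρ', borelFn φ,
    isBorelContinuation_borelFn (hû.mono ((hρρ'.trans hρR).trans (min_le_left _ _))) hρ' hA hB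
      (h.differentiableOn_ball.mono (Metric.ball_subset_ball ?_)) (hcone.mono le_rfl hρρ')
      (by linarith) (by linarith), fun θ hθ α hα hαπ => ?_⟩
  · obtain ⟨r, hr, hb⟩ := hb α hα hαπ
    exact ⟨r, hr, hb d ⟨by linarith, by linarith⟩⟩
  · linarith [hρR.trans (min_le_right _ _)]
  · obtain ⟨r, hr, hb⟩ := hb α hα (by simpa using hαπ)
    have h1 := abs_lt.1 hθ
    refine ⟨r, hr, fun τ hτ z hz => ?_⟩
    obtain ⟨h2, h3⟩ := hb θ ⟨by linarith, by linarith⟩ τ hτ z hz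
    exact ⟨(integrable_ecalleIntegrand_iff φ θ τ z).2 h2, fun _ => by rw [h3, ecalle_borelFn]⟩

theorem isHeatIntegral_isKSum_of_inIooMod (h : IsPolar n a z₀ δ ψ φ) (hρ₀ : 0 < ρ₀)
    (hû : IsFormalSolution φ û ρ₀) {c θ : ℝ} {m : ℤ} (hc : c = δ + 2 * Real.pi * m)
    (hθ : InIooMod θ c (c + 2 * Real.pi)) :
    IsHeatIntegral φ θ (branch φ c) ∧ IsKSum 1 θ û (branch φ c) univ := by
  obtain ⟨k, h1, h2⟩ := hθ
  rw [← branch_add_left φ c (-k)]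
  refine h.isHeatIntegral_isKSum (m := m - 2 * k) hρ₀ hû ?_ ⟨?_, ?_⟩ _
  · rw [hc]
    push_cast
    ring
  · push_cast
    linarith
  · push_cast
    linarith

/-- The jump across the Stokes line opposite to the one of direction `2 arg z₀`. -/
theorem branch_sub_neg (h : IsPolar n a z₀ δ ψ φ) {ε : ℝ} (hε : 0 < ε) (hεπ : ε < Real.pi) :
    ∃ r ρ : ℝ, 0 < r ∧ 0 < ρ ∧ ∀ τ ∈ sector (δ + 2 * Real.pi) (Real.pi - ε) (r : EReal),
      ∀ z ∈ Metric.ball (0 : ℂ) ρ, branch φ (δ + 2 * Real.pi) τ z - branch φ δ τ z =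
        jumpFn n (fun j => (-1) ^ j * a j) (-z₀) τ (-z) := by
  obtain ⟨r, ρ, hr, hρ, hJ⟩ := h.neg.branch_sub hε hεπ
  refine ⟨r, ρ, hr, hρ, fun τ hτ z hz => ?_⟩
  rw [← hJ τ hτ (-z) (by simpa using hz), branch_neg, branch_neg, add_sub_cancel_right]

/-- Only the directions `δ` and `δ + 2π` need work, the second one by reflection; shifts by `4π`
give the others with the same radii. -/
theorem exists_isBranching (h : IsPolar n a z₀ δ ψ φ) (hρ₀ : 0 < ρ₀) {ε : ℝ} (hε : 0 < ε)
    (hεπ : ε < Real.pi) : ∃ r ρ : ℝ, 0 < r ∧ 0 < ρ ∧ ρ ≤ ρ₀ ∧ ρ ≤ ‖z₀‖ ∧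
      (∀ m : ℤ, IsBranching φ (δ + 2 * Real.pi * m) ε r ρ) ∧
      (∀ τ ∈ sector δ (Real.pi - ε) (r : EReal), ∀ z ∈ Metric.ball (0 : ℂ) ρ,
        branch φ δ τ z - branch φ (δ - 2 * Real.pi) τ z = jumpFn n a z₀ τ z) ∧
      ∀ τ ∈ sector (δ + 2 * Real.pi) (Real.pi - ε) (r : EReal), ∀ z ∈ Metric.ball (0 : ℂ) ρ,
        branch φ (δ + 2 * Real.pi) τ z - branch φ δ τ z =
          jumpFn n (fun j => (-1) ^ j * a j) (-z₀) τ (-z) := by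
  obtain ⟨r₁, ρ₁, hr₁, hρ₁, h1⟩ :=
    (h.hasConeBounds (c := δ) (m := 0) (by simp)).isSectorSolution hε hεπ
  obtain ⟨r₂, ρ₂, hr₂, hρ₂, h2⟩ :=
    (h.hasConeBounds (c := δ + 2 * Real.pi) (m := 1) (by simp)).isSectorSolution hε hεπ
  obtain ⟨r₃, ρ₃, hr₃, hρ₃, h3⟩ := h.branch_sub hε hεπ
  obtain ⟨r₄, ρ₄, hr₄, hρ₄, h4⟩ := h.branch_sub_neg hε hεπ
  have hr : ∃ r, 0 < r ∧ r ≤ r₁ ∧ r ≤ r₂ ∧ r ≤ r₃ ∧ r ≤ r₄ :=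
    ⟨min (min r₁ r₂) (min r₃ r₄), by positivity, by simp, by simp, by simp, by simp⟩
  obtain ⟨r, hr, l1, l2, l3, l4⟩ := hr
  have hz₀ := h.norm_pos
  have hρ : ∃ ρ, 0 < ρ ∧ ρ ≤ ρ₀ ∧ ρ ≤ ‖z₀‖ ∧ ρ ≤ ρ₁ ∧ ρ ≤ ρ₂ ∧ ρ ≤ ρ₃ ∧ ρ ≤ ρ₄ :=
    ⟨min (min ρ₀ ‖z₀‖) (min (min ρ₁ ρ₂) (min ρ₃ ρ₄)), by positivity, by simp, by simp, by simp,
      by simp, by simp, by simp⟩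
  obtain ⟨ρ, hρ, k0, kz, k1, k2, k3, k4⟩ := hρ
  have hs : ∀ {d α r r' : ℝ}, r ≤ r' → sector d α (r : EReal) ⊆ sector d α (r' : EReal) :=
    fun hle => sector_mono le_rfl (EReal.coe_le_coe_iff.2 hle)
  have h0 : (0 : ℂ) ∈ Metric.ball (0 : ℂ) ρ := Metric.mem_ball_self hρ
  have hJ1 : ∀ τ ∈ sector δ (Real.pi - ε) (r : EReal), ∀ z ∈ Metric.ball (0 : ℂ) ρ,
      branch φ δ τ z - branch φ (δ - 2 * Real.pi) τ z = jumpFn n a z₀ τ z :=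
    fun τ hτ z hz => h3 τ (hs l3 hτ) z (Metric.ball_subset_ball k3 hz)
  have hJ2 : ∀ τ ∈ sector (δ + 2 * Real.pi) (Real.pi - ε) (r : EReal),
      ∀ z ∈ Metric.ball (0 : ℂ) ρ, branch φ (δ + 2 * Real.pi) τ z - branch φ δ τ z =
        jumpFn n (fun j => (-1) ^ j * a j) (-z₀) τ (-z) :=
    fun τ hτ z hz => h4 τ (hs l4 hτ) z (Metric.ball_subset_ball k4 hz)
  have hb1 : IsBranching φ δ ε r ρ := ⟨h1.mono (hs l1) k1, _, differentiable_jumpFn n a z₀ 0,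
    fun τ hτ => hJ1 τ hτ 0 h0, h.jumpFn_lower_bound⟩
  have hb2 : IsBranching φ (δ + 2 * Real.pi) ε r ρ := ⟨h2.mono (hs l2) k2, _,
    differentiable_jumpFn n _ (-z₀) 0, fun τ hτ => by
      simpa using hJ2 τ hτ 0 h0, h.neg.jumpFn_lower_bound⟩
  refine ⟨r, ρ, hr, hρ, k0, kz, fun m => ?_, hJ1, hJ2⟩
  rcases Int.even_or_odd' m with ⟨k, rfl | rfl⟩
  · convert hb1.add k using 1
    push_cast
    ring
  · convert hb2.add k using 1
    push_cast
    ring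

theorem isJump (h : IsPolar n a z₀ δ ψ φ) (hρ₀ : 0 < ρ₀) (hû : IsFormalSolution φ û ρ₀)
    {ε r ρ c : ℝ} (hb : ∀ m : ℤ, IsBranching φ (δ + 2 * Real.pi * m) ε r ρ) {m : ℤ}
    (hc : c = δ + 2 * Real.pi * m) :
    IsJump 1 c û (branch φ c) (branch φ (c - 2 * Real.pi))
      (sector c (Real.pi - ε) (r : EReal)) ρ := by
  have hpi := Real.pi_pos
  have hc' : c - 2 * Real.pi = δ + 2 * Real.pi * (m - 1 : ℤ) := by
    rw [hc]
    push_cast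
    ring
  have h1 := (hb m).solution.holo
  have h2 := (hb (m - 1)).solution.holo
  rw [← hc] at h1
  rw [← hc'] at h2
  have hsub : ∀ e, |e - c| ≤ Real.pi → sector c (Real.pi - ε) (r : EReal) ⊆
      sector e (3 * Real.pi - ε) (r : EReal) := by
    rintro e he τ ⟨g1, g2⟩
    refine ⟨g1, ?_⟩
    have g3 := abs_lt.1 g2
    have g4 := abs_le.1 he
    rw [abs_lt]
    constructor <;> linarith
  refine ⟨(h.isStokesLine_iff hρ₀ hû).2 ⟨m, hc⟩, h1.mono (hsub _ ?_) le_rfl,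
    h2.mono (hsub _ ?_) le_rfl, 2 * Real.pi, by positivity,
    fun d hd => (h.isHeatIntegral_isKSum hρ₀ hû hc hd _).2,
    fun d hd => (h.isHeatIntegral_isKSum hρ₀ hû hc' ⟨hd.1, by linarith [hd.2]⟩ _).2⟩
  · rw [abs_le]
    constructor <;> linarith
  · rw [abs_le]
    constructor <;> linarith

theorem isActualSolution (h : IsPolar n a z₀ δ ψ φ) {c ε r ρ : ℝ} (hρ : ρ ≤ ‖z₀‖)
    (hb : IsBranching φ c ε r ρ) : IsActualSolution 2 φ (branch φ c)
      (surfaceSector 2 (c + Real.pi) (3 * Real.pi - ε) (r : EReal)) ρ := by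
  have hs := hb.solution.surfaceSector fun τ z k => branch_add φ c τ z k
  refine ⟨hs.holo, fun τ _ z _ => ?_, hs.heat,
    h.differentiableOn_ball.mono (Metric.ball_subset_ball hρ), hs.initial⟩
  rw [← branch_add φ c τ z 1]
  congr 3
  push_cast
  ring

/-- An actual solution on the Riemann surface of the square root which is the sum of the formal
solution in a direction between two Stokes lines coincides with the branch between these lines. -/
theorem eq_branch (h : IsPolar n a z₀ δ ψ φ) (hρ₀ : 0 < ρ₀) (hû : IsFormalSolution φ û ρ₀)
    {ε r ρ : ℝ} (hr : 0 < r) (hρ : 0 < ρ) (hε : 0 < ε) (hεπ : ε < Real.pi)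
    (hb : ∀ m : ℤ, IsBranching φ (δ + 2 * Real.pi * m) ε r ρ) {d α : ℝ} {R : EReal}
    {v : ℂ → ℂ → ℂ} (hv : IsActualSolution 2 φ v (surfaceSector 2 d α R) ρ) {p : ℂ}
    (hp : p ∈ surfaceSector 2 d α R) {c : ℝ} {m : ℤ} (hc : c = δ + 2 * Real.pi * m)
    (hpc : p.im ∈ Ioo c (c + 2 * Real.pi)) (hk : IsKSum 1 p.im û v (surfaceSector 2 d α R))
    {τ z : ℂ} (hτ : τ ∈ surfaceSector 2 d α R)
    (hτ' : τ ∈ surfaceSector 2 (c + Real.pi) (3 * Real.pi - ε) (r : EReal))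
    (hz : z ∈ Metric.ball (0 : ℂ) ρ) : v τ z = branch φ c τ z := by
  have hpi := Real.pi_pos
  obtain ⟨k, hk1⟩ := mem_surfaceSector_two.1 hp
  -- Of all lifts of the sector to the covering space, the one containing `p` itself is chosen:
  -- convexity arguments apply only on a single lift.
  have hpT : p ∈ sector (d + 4 * Real.pi * (-k : ℤ)) α R := by
    refine ⟨by simpa using hk1.1, ?_⟩
    have := hk1.2
    convert this using 2
    simp
    ring
  set d' := d + 4 * Real.pi * (-k : ℤ) with hd'
  have hsub : sector d' α R ⊆ surfaceSector 2 d α R := sector_add_subset d α R (-k)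
  have hvT : HolomorphicOn v (sector d' α R) ρ := hv.holo.mono hsub le_rfl
  have h0 : (0 : ℂ) ∈ Metric.ball (0 : ℂ) ρ := Metric.mem_ball_self hρ
  have hvi := (hv.initial 0 h0).mono_left (inf_le_inf_left _ (principal_mono.2 hsub))
  have hkT : IsKSum 1 p.im û v (sector d' α R) := by
    obtain ⟨ε₁, ρ₁, q1, q2, g, q3, q4⟩ := hk
    refine ⟨ε₁, ρ₁, q1, q2, g, q3, fun θ hθ β hβ hβ' => ?_⟩
    obtain ⟨r₁, q5, q6⟩ := q4 θ hθ β hβ hβ'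
    exact ⟨r₁, q5, fun w hw y hy => ⟨(q6 w hw y hy).1, fun hU => (q6 w hw y hy).2 (hsub hU)⟩⟩
  have hb1 := hb m
  have hb0 := hb (m - 1)
  have hb2 := hb (m + 1)
  rw [← hc] at hb1
  rw [show δ + 2 * Real.pi * (m - 1 : ℤ) = c - 2 * Real.pi by rw [hc]; push_cast; ring] at hb0
  rw [show δ + 2 * Real.pi * (m + 1 : ℤ) = c + 2 * Real.pi by rw [hc]; push_cast; ring] at hb2
  have heq := hb1.eqOn hr hρ hεπ hvT hpT hpc hkT (h.isHeatIntegral_isKSum hρ₀ hû hc hpc univ).2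
  have hle := hb1.le_im hb0 hr hρ hεπ hvT hvi hpT hpc.1 fun w hw => heq w hw 0 h0
  have hge := hb2.im_le hr hρ hεπ hvT hvi hpT hpc.2 fun w hw => heq w hw 0 h0
  obtain ⟨i, hi⟩ := mem_surfaceSector_two.1 ((surfaceSector_two_add d α R (-k)).symm ▸ hτ)
  obtain ⟨j, hj⟩ := mem_surfaceSector_two.1 hτ'
  have him : ∀ l : ℤ, (τ + (4 * Real.pi * l : ℝ) * Complex.I).im = τ.im + 4 * Real.pi * l :=
    fun l => by simp
  -- The two lifts of `τ` both have arguments in `[c - π/2, c + 5π/2]`. This interval is shorter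
  -- than `4π`, so the lifts coincide.
  have hij : i = j := by
    have e1 := hle _ hi
    have e2 := hge _ hi
    have e3 := abs_lt.1 hj.2
    rw [him] at e1 e2 e3
    have e4 : (i : ℝ) - j < 1 := by nlinarith
    have e5 : -1 < (i : ℝ) - j := by nlinarith
    norm_cast at e4 e5
    omega
  rw [← hv.apply_add hτ hz i, ← branch_add φ c τ z i]
  exact heq _ ⟨hi, hij ▸ hj⟩ z hz

theorem isMaximalFamily (h : IsPolar n a z₀ δ ψ φ) (hρ₀ : 0 < ρ₀) (hû : IsFormalSolution φ û ρ₀)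
    {ε r ρ : ℝ} (hr : 0 < r) (hρ : 0 < ρ) (hρ₀' : ρ ≤ ρ₀) (hρz : ρ ≤ ‖z₀‖) (hε : 0 < ε)
    (hεπ : ε < Real.pi) (hb : ∀ m : ℤ, IsBranching φ (δ + 2 * Real.pi * m) ε r ρ) :
    IsMaximalFamily 1 2 φ û (puncturedDisc r) ρ
      ![surfaceSector 2 (δ + Real.pi) (3 * Real.pi - ε) (r : EReal),
        surfaceSector 2 (δ + 2 * Real.pi + Real.pi) (3 * Real.pi - ε) (r : EReal)]
      ![branch φ δ, branch φ (δ + 2 * Real.pi)] := by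
  have hpi := Real.pi_pos
  have hr' : (0 : EReal) < (r : EReal) := EReal.coe_pos.2 hr
  have hb0 : IsBranching φ δ ε r ρ := by simpa using hb 0
  have hb1 : IsBranching φ (δ + 2 * Real.pi) ε r ρ := by simpa using hb 1
  have hpiece : ∀ e, surfaceSector 2 e (3 * Real.pi - ε) (r : EReal) ⊆ puncturedDisc r ∧
      IsSurfaceSector 2 (Real.pi / 1) (surfaceSector 2 e (3 * Real.pi - ε) (r : EReal)) := by
    refine fun e => ⟨?_, e, 3 * Real.pi - ε, r, by rw [div_one]; linarith, hr', rfl⟩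
    rw [puncturedDisc_eq r e]
    rintro τ ⟨m, hm⟩
    exact ⟨m, sector_mono (by linarith) le_rfl hm⟩
  have hdist : ∃ τ ∈ surfaceSector 2 (δ + Real.pi) (3 * Real.pi - ε) (r : EReal) ∩
      surfaceSector 2 (δ + 2 * Real.pi + Real.pi) (3 * Real.pi - ε) (r : EReal),
      ∃ z ∈ Metric.ball (0 : ℂ) ρ, branch φ δ τ z ≠ branch φ (δ + 2 * Real.pi) τ z := by
    obtain ⟨J, hJ⟩ := hb0.crossing
    obtain ⟨X, M, -, hX⟩ := hJ.lower
    obtain ⟨τ, h1, h2, h3⟩ := exists_mem_sector (d := δ) (α := Real.pi - ε) X (y := δ)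
      (by rw [sub_self, abs_zero]; linarith) hr
    have hre := (mem_sector_coe.1 h1).1
    -- The point has argument `δ`. It lies in the first sector as it stands and in the second one as
    -- `δ + 4π`; there the branches differ by the nonvanishing jump.
    refine ⟨τ, ⟨mem_surfaceSector_two.2 ⟨0, mem_sector_coe.2 ⟨by simpa using hre, ?_⟩⟩,
      mem_surfaceSector_two.2 ⟨1, mem_sector_coe.2 ⟨by simpa using hre, ?_⟩⟩⟩, 0,
      Metric.mem_ball_self hρ, fun heq => ?_⟩
    · have e : (τ + (4 * Real.pi * (0 : ℤ) : ℝ) * Complex.I).im = δ := by simp [h3]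
      rw [e, abs_lt]
      constructor <;> linarith
    · have e : (τ + (4 * Real.pi * (1 : ℤ) : ℝ) * Complex.I).im = δ + 4 * Real.pi := by simp [h3]
      rw [e, abs_lt]
      constructor <;> linarith
    · refine (hX τ h2).1 ?_
      rw [← hJ.eq τ h1, heq, ← branch_add_left φ (δ - 2 * Real.pi) 1]
      rw [show δ - 2 * Real.pi + 4 * Real.pi * (1 : ℤ) = δ + 2 * Real.pi by push_cast; ring,
        sub_self]
  refine ⟨by norm_num, hû.mono hρ₀', h.isKSummable hρ₀ hû,
    ⟨0, 8 * Real.pi, r, by rw [div_one]; linarith, hr', puncturedDisc_eq r 0⟩,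
    Fin.forall_fin_two.2 ⟨hpiece _, hpiece _⟩, ?_,
    Fin.forall_fin_two.2 ⟨h.isActualSolution hρz hb0, h.isActualSolution hρz hb1⟩, ?_, ?_⟩
  · intro τ hτ
    obtain ⟨m, h1, h2⟩ := mem_surfaceSector_two.1 (puncturedDisc_eq r (δ + 2 * Real.pi) ▸ hτ)
    have h3 := abs_lt.1 h2
    rw [mem_iUnion]
    set y := (τ + (4 * Real.pi * m : ℝ) * Complex.I).im with hy
    have him : ∀ l : ℤ, (τ + (4 * Real.pi * (m + l : ℤ) : ℝ) * Complex.I).im =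
        y + 4 * Real.pi * l := fun l => by
      simp [hy]
      ring
    have hre : ∀ l : ℤ, Real.exp (τ + (4 * Real.pi * l : ℝ) * Complex.I).re < r := fun l => by
      simpa using show Real.exp τ.re < r from hτ
    -- After a shift `y` lies in `(δ - 2π, δ + 6π)`. Cut at `δ`, `δ + 2π` and `δ + 4π`, this
    -- interval is covered alternately by the two sectors.
    rcases lt_or_ge y δ with h4 | h4
    · refine ⟨1, mem_surfaceSector_two.2 ⟨m + 1, mem_sector_coe.2 ⟨hre _, ?_⟩⟩⟩
      rw [him, abs_lt]
      push_cast
      constructor <;> linarith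
    rcases le_or_gt y (δ + 2 * Real.pi) with h5 | h5
    · refine ⟨0, mem_surfaceSector_two.2 ⟨m + 0, mem_sector_coe.2 ⟨hre _, ?_⟩⟩⟩
      rw [him, abs_lt]
      push_cast
      constructor <;> linarith
    rcases le_or_gt y (δ + 4 * Real.pi) with h6 | h6
    · refine ⟨1, mem_surfaceSector_two.2 ⟨m + 0, mem_sector_coe.2 ⟨hre _, ?_⟩⟩⟩
      rw [him, abs_lt]
      push_cast
      constructor <;> linarith
    · refine ⟨0, mem_surfaceSector_two.2 ⟨m + -1, mem_sector_coe.2 ⟨hre _, ?_⟩⟩⟩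
      rw [him, abs_lt]
      push_cast
      constructor <;> linarith
  · refine Fin.forall_fin_two.2 ⟨Fin.forall_fin_two.2 ⟨fun h => absurd rfl h, fun _ _ => hdist⟩,
      Fin.forall_fin_two.2 ⟨fun _ _ => ?_, fun h => absurd rfl h⟩⟩
    obtain ⟨τ, ⟨h1, h2⟩, z, hz, hne⟩ := hdist
    exact ⟨τ, ⟨h2, h1⟩, z, hz, hne.symm⟩
  · rintro V' v d ⟨d', α, R, -, -, rfl⟩ hV hv hs ⟨p, hp, rfl⟩ hk
    rw [h.summableInDir_iff hρ₀ hû] at hs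
    obtain ⟨m, hm⟩ := exists_mem_Ioo hs
    have hpW : p ∈ surfaceSector 2 (δ + 2 * Real.pi * m + Real.pi) (3 * Real.pi - ε) (r : EReal) :=
      mem_surfaceSector_two.2 ⟨0, mem_sector_coe.2 ⟨by simpa using show Real.exp p.re < r from hV hp, by
        have e : (p + (4 * Real.pi * (0 : ℤ) : ℝ) * Complex.I).im = p.im := by simp
        rw [e, abs_lt]
        constructor <;> linarith [hm.1, hm.2]⟩⟩
    have key : ∀ τ ∈ surfaceSector 2 d' α R ∩
        surfaceSector 2 (δ + 2 * Real.pi * m + Real.pi) (3 * Real.pi - ε) (r : EReal),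
        ∀ z ∈ Metric.ball (0 : ℂ) ρ, v τ z = branch φ (δ + 2 * Real.pi * m) τ z :=
      fun τ hτ z hz => h.eq_branch hρ₀ hû hr hρ hε hεπ hb hv hp rfl hm hk hτ.1 hτ.2 hz
    -- The parity of `m` tells which of the two branches belongs to the gap containing `p`.
    rcases Int.even_or_odd' m with ⟨k, rfl | rfl⟩
    · refine ⟨0, ?_⟩
      rw [show δ + 2 * Real.pi * (2 * k : ℤ) = δ + 4 * Real.pi * k by push_cast; ring] at hpW key
      rw [show δ + 4 * Real.pi * k + Real.pi = δ + Real.pi + 4 * Real.pi * k by ring,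
        surfaceSector_two_add] at hpW key
      rw [branch_add_left] at key
      exact ⟨⟨p, hp, hpW⟩, key⟩
    · refine ⟨1, ?_⟩
      rw [show δ + 2 * Real.pi * (2 * k + 1 : ℤ) = δ + 2 * Real.pi + 4 * Real.pi * k by
        push_cast; ring] at hpW key
      rw [show δ + 2 * Real.pi + 4 * Real.pi * k + Real.pi =
        δ + 2 * Real.pi + Real.pi + 4 * Real.pi * k by ring, surfaceSector_two_add] at hpW key
      rw [branch_add_left] at key
      exact ⟨⟨p, hp, hpW⟩, key⟩

end IsPolar

end Stokes

/-! ### Conclusion. -/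

theorem corollary5p6
    (n : ℕ) (hn : 1 ≤ n) (a : ℤ → ℂ) (ha : a (-(n : ℤ)) ≠ 0)
    (z₀ : ℂ) (hz₀ : z₀ ≠ 0)
    (δ : ℝ) (hδ : z₀ = (‖z₀‖ : ℂ) * Complex.exp ((δ / 2 : ℝ) * Complex.I))
    (ψ : ℂ → ℂ) (hψ : IsEntireOfGrowth 2 ψ)
    (φ : ℂ → ℂ)
    (hφ : ∀ z : ℂ, φ z = ∑ j ∈ Finset.Icc 1 n, a (-(j : ℤ)) / (z - z₀) ^ j + ψ z)
    (û : ℕ → ℂ → ℂ) (ρ₀ : ℝ) (hρ₀ : 0 < ρ₀) (hû : IsFormalSolution φ û ρ₀) :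
    -- the Stokes lines and the anti-Stokes lines
    (∀ d : ℝ, IsStokesLine 1 û d ↔
      ∃ m : ℤ, d = δ + 4 * Real.pi * m ∨ d = δ + 2 * Real.pi + 4 * Real.pi * m) ∧
    (∀ d : ℝ, IsAntiStokesLine 1 û d ↔
      ∃ m : ℤ, (d = δ + Real.pi / 2 + 4 * Real.pi * m ∨ d = δ - Real.pi / 2 + 4 * Real.pi * m) ∨
        (d = δ + 2 * Real.pi + Real.pi / 2 + 4 * Real.pi * m ∨
          d = δ + 2 * Real.pi - Real.pi / 2 + 4 * Real.pi * m)) ∧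
    ∃ u₁ u₂ : ℂ → ℂ → ℂ,
      -- `u₁ = u^θ` for `θ ∈ (δ, δ + 2π)` and `u₂ = u^θ` for `θ ∈ (δ + 2π, δ + 4π)`, modulo `4π`
      (∀ θ : ℝ, InIooMod θ δ (δ + 2 * Real.pi) →
        IsHeatIntegral φ θ u₁ ∧ IsKSum 1 θ û u₁ Set.univ) ∧
      (∀ θ : ℝ, InIooMod θ (δ + 2 * Real.pi) (δ + 4 * Real.pi) →
        IsHeatIntegral φ θ u₂ ∧ IsKSum 1 θ û u₂ Set.univ) ∧
      ∀ ε : ℝ, 0 < ε → ε < Real.pi → ∃ r ρ : ℝ, 0 < r ∧ 0 < ρ ∧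
        -- `u_l ∈ 𝓞(V_l × D)`, and `{u₁, u₂}` is a maximal family of solutions on `W_r × D`
        IsMaximalFamily 1 2 φ û (puncturedDisc r) ρ
          ![surfaceSector 2 (δ + Real.pi) (3 * Real.pi - ε) (r : EReal),
            surfaceSector 2 (δ + 3 * Real.pi) (3 * Real.pi - ε) (r : EReal)]
          ![u₁, u₂] ∧
        -- the jump across `arg t = δ`
        IsJump 1 δ û u₁ u₂ (sector δ (Real.pi - ε) (r : EReal)) ρ ∧
        (∀ τ ∈ sector δ (Real.pi - ε) (r : EReal), ∀ z ∈ Metric.ball (0 : ℂ) ρ,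
          u₁ τ z - u₂ τ z = -Complex.I * sqrtPiDiv τ *
            ∑ k ∈ Finset.range n, a ((k : ℤ) - n) / ((n - k - 1).factorial : ℂ) *
              gaussDeriv (n - k - 1) τ (z₀ - z)) ∧
        -- the jump across `arg t = δ + 2π`
        IsJump 1 (δ + 2 * Real.pi) û u₂ u₁
          (sector (δ + 2 * Real.pi) (Real.pi - ε) (r : EReal)) ρ ∧
        (∀ τ ∈ sector (δ + 2 * Real.pi) (Real.pi - ε) (r : EReal), ∀ z ∈ Metric.ball (0 : ℂ) ρ,
          u₂ τ z - u₁ τ z = -Complex.I * sqrtPiDiv τ *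
            ∑ k ∈ Finset.range n,
              (-1 : ℂ) ^ ((k : ℤ) - n) * a ((k : ℤ) - n) / ((n - k - 1).factorial : ℂ) *
                gaussDeriv (n - k - 1) τ (z - z₀)) := by
  have hpi := Real.pi_pos
  have h : IsPolar n a z₀ δ ψ φ := ⟨hn, ha, hz₀, hδ, hψ, hφ⟩
  refine ⟨fun d => ?_, fun d => h.isAntiStokesLine_iff hρ₀ hû, branch φ δ,
    branch φ (δ + 2 * Real.pi), fun θ hθ => ?_, fun θ hθ => ?_, fun ε hε hεπ => ?_⟩
  · rw [h.isStokesLine_iff hρ₀ hû, IsPolar.exists_two_pi_iff]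
  · exact h.isHeatIntegral_isKSum_of_inIooMod (m := 0) hρ₀ hû (by simp) hθ
  · refine h.isHeatIntegral_isKSum_of_inIooMod (m := 1) hρ₀ hû (by simp) ?_
    rwa [show δ + 2 * Real.pi + 2 * Real.pi = δ + 4 * Real.pi by ring]
  · obtain ⟨r, ρ, hr, hρ, hρ₀', hρz, hb, hJ1, hJ2⟩ := h.exists_isBranching hρ₀ hε hεπ
    -- Below the line `δ` the sum is the branch of `δ - 2π`, which is `u₂` because the two
    -- directions differ by `4π`.
    have e : branch φ (δ - 2 * Real.pi) = branch φ (δ + 2 * Real.pi) := by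
      rw [← branch_add_left φ (δ - 2 * Real.pi) 1]
      congr 1
      push_cast
      ring
    have j1 := h.isJump hρ₀ hû hb (c := δ) (m := 0) (by simp)
    have j2 := h.isJump hρ₀ hû hb (c := δ + 2 * Real.pi) (m := 1) (by simp)
    rw [e] at j1 hJ1
    rw [add_sub_cancel_right] at j2
    refine ⟨r, ρ, hr, hρ, ?_, j1, hJ1, j2, fun τ hτ z hz => ?_⟩
    · rw [show δ + 3 * Real.pi = δ + 2 * Real.pi + Real.pi by ring]
      exact h.isMaximalFamily hρ₀ hû hr hρ hρ₀' hρz hε hεπ hb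
    · rw [hJ2 τ hτ z hz, jumpFn, show -z₀ - -z = z - z₀ by ring]
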